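/- Let $W=\bigoplus_{k=0}^{\ell}W^{-k}$ be a finite-dimensional non-positively graded real vector space, $U\subset W^0$ an open subset, and $Q$ a differential (a derivation of degree $1$ with $Q^2=0$) on the graded commutative algebra $\mathcal A_{W|_U}=C^\infty(U)\otimes S\bigl((W^{<0})^*\bigr)$, in which $(W^{-k})^*$ has degree $k$. Let $F_Q\in\mathcal A_{W|_U}\otimes W$ be defined by $\langle F_Q,\xi\rangle=Q\xi$ for $\xi\in W^*$. Let $N\subset\mathbb R^n$ be an $n$-dimensional submanifold with corners which contains $0$ and is star-shaped with respect to $0$. Put $$\Omega(N,W)^m=\bigoplus_{k\ge 0}\Omega^{m+k}(N)\otimes W^{-k},$$ and let $\Omega(N,W|_U)^0\subset\Omega(N,W)^0$ be the set of those $A$ whose $0$-form part takes values in $U$; for such $A$ let $F_Q(A)\in\Omega(N,W)^1$ be obtained by substituting $\langle A,\xi\rangle$ for every $\xi\in W^*$ in $F_Q$. Let $E=\sum_i x^i\partial_{x^i}$ be the Euler vector field, let $h$ be the de Rham homotopy operator of the retraction $R(x,t)=tx$, that is $h\beta=\int_0^1 i_{\partial_t}R^*\beta\,dt$, and put $$\kappa(A)=A-h(F_Q(A)).$$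 For $B\in\Omega(N,W)^0$ consider the vector field $$\hat E_B=E_{\mathrm{lift}}+F_Q(B+i_E\,\cdot\,)$$ on the part of the total space of $(\bigwedge T^*N\otimes W)^1\to N$ where the $0$-form part of $B+i_E\,\cdot\,$ lies in $U$. Here $E_{\mathrm{lift}}$ is the natural lift of $E$: in linear coordinates it is $E$ plus the vertical linear field which multiplies the fibre coordinates of form degree $j$ by $-j$. The second term is a vertical vector field. (1) Let $1\le\rho\le\infty$ and let $B\in\Omega(N,W)^0$ be of class $C^\rho$, with $0$-form part sending $0\in N$ into $U$. Among the pairs $(N',a)$, where $N'\subset N$ is a star-shaped open neighbourhood of $0$ in $N$ and $a\in\Omega(N',W)^1$ is a $C^\rho$ solution of $$\mathcal L_E a=F_Q(B+i_Ea)$$ (the $0$-form part of $B+i_Ea$ taking values in $U$), there is a greatest one: its domain $N'$ contains the domain of every other solution, and every other solution is the restriction of $a$. A $C^\rho$ form $A\in\Omega(N,W|_U)^0$ with $\kappa(A)=B$ exists if and only if $N'=N$, and in that case $A$ is unique and $A=B+i_Ea$. The vector field $\hat E_B$ has exactly one fixed point $P$; it lies over $0$ and is hyperbolic. The stable subspace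 of the linearization at $P$ is the vertical subspace, on which the linearization acts by $-j$ on forms of degree $j$; the unstable subspace, on which the linearization is the identity, projects bijectively onto $T_0\mathbb R^n=\mathbb R^n$. The image of the greatest solution $a:N'\to(\bigwedge T^*N\otimes W)^1$ is the unstable manifold of $\hat E_B$ at $P$. (2) Suppose in addition that $N$ is compact and let $r\ge1$ be an integer. Then the space $\Omega_r(N,W)^0$ of $C^r$ forms, with the $C^r$ norm, is a Banach space, the subset $\Omega_r(N,W|_U)^0$ is open in it, and $$\kappa:\Omega_r(N,W|_U)^0\to\Omega_r(N,W)^0$$ is a smooth open embedding of Banach manifolds: it is injective and smooth ($C^\infty$), its image is open, and the inverse map, defined on the image, is smooth. For every $B$ in the image, $\kappa^{-1}(B)=B+i_Ea$, where $a$ is a $C^r$ solution of $\mathcal L_Ea=F_Q(B+i_Ea)$ on the whole of $N$ whose image is the unstable manifold of $\hat E_B$ at its hyperbolic fixed point. -/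

import Mathlib

open scoped ContDiff Manifold

noncomputable section

namespace Kuranishi

/-- The Euclidean space `ℝⁿ`. -/
abbrev Euc (n : ℕ) : Type := EuclideanSpace ℝ (Fin n)

/-! ### Codimension zero submanifolds with corners -/

/-- `N ⊆ ℝⁿ` is an `n`-dimensional submanifold with corners: near each of its points there is a
smooth chart of `ℝⁿ` which turns `N` into a coordinate sector `{y | ∀ i ∈ s, 0 ≤ y i}`. -/
def IsSubmanifoldWithCorners {n : ℕ} (N : Set (Euc n)) : Prop :=
  ∀ x ∈ N, ∃ φ : OpenPartialHomeomorph (Euc n) (Euc n), x ∈ φ.source ∧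
    ContDiffOn ℝ ∞ φ φ.source ∧ ContDiffOn ℝ ∞ φ.symm φ.target ∧
    ∃ s : Finset (Fin n), ∀ y ∈ φ.source, y ∈ N ↔ ∀ i ∈ s, 0 ≤ φ y i

/-! ### Exterior forms on `ℝⁿ` and the exterior algebra of its dual -/

/-- The algebra `⋀ (ℝⁿ)^*`. -/
abbrev Ext (n : ℕ) : Type := ExteriorAlgebra ℝ (Module.Dual ℝ (Euc n))

/-- The coordinate covector `dxⁱ`. -/
def dx {n : ℕ} (i : Fin n) : Module.Dual ℝ (Euc n) :=
  (EuclideanSpace.basisFun (Fin n) ℝ).toBasis.coord i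

/-- The alternating form `w`, seen as the element
`(1/k!) ∑ w(e_{i₁}, …, e_{i_k}) dx^{i₁} ⋯ dx^{i_k}` of the exterior algebra. -/
def toExt {n k : ℕ} : (Euc n [⋀^Fin k]→L[ℝ] ℝ) →ₗ[ℝ] Ext n :=
  (k.factorial : ℝ)⁻¹ • ∑ i : Fin k → Fin n,
    { toFun := fun w => w (fun j => EuclideanSpace.basisFun (Fin n) ℝ (i j)) •
        ExteriorAlgebra.ιMulti ℝ k (fun j => dx (i j))
      map_add' := fun w v => by simp [add_smul]
      map_smul' := fun c w => by simp [mul_smul] }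

theorem continuous_of_multilinear {n k : ℕ} (f : MultilinearMap ℝ (fun _ : Fin k => Euc n) ℝ) :
    Continuous f := by
  have h : (f : (Fin k → Euc n) → ℝ) = fun v => ∑ r : Fin k → Fin n,
      (∏ j, v j (r j)) * f (fun j => EuclideanSpace.basisFun (Fin n) ℝ (r j)) := by
    funext v
    have hv : v = fun j => ∑ i : Fin n, v j i • EuclideanSpace.basisFun (Fin n) ℝ i := by
      funext j
      conv_lhs => rw [← (EuclideanSpace.basisFun (Fin n) ℝ).sum_repr (v j)]
      simp
    conv_lhs => rw [hv, f.map_sum]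
    refine Finset.sum_congr rfl fun r _ => ?_
    rw [f.map_smul_univ, smul_eq_mul]
  rw [h]
  fun_prop

/-- The degree `k` part of an element of the exterior algebra as an alternating form, with
`(θ₁ ⋯ θ_k)(v₁, …, v_k) = det (θ_j(v_i))`. -/
def ofExt {n : ℕ} (k : ℕ) (w : Ext n) : Euc n [⋀^Fin k]→L[ℝ] ℝ :=
  let f : Euc n [⋀^Fin k]→ₗ[ℝ] ℝ :=
    (ExteriorAlgebra.liftAlternating
      (Function.update 0 k (exteriorPower.alternatingMapToDual ℝ (Euc n) k)) w).compAlternatingMap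
      (exteriorPower.ιMulti ℝ k)
  { f with cont := continuous_of_multilinear f.toMultilinearMap }

theorem ι_mul_list_prod {n : ℕ} (m : Module.Dual ℝ (Euc n)) (l : List (Module.Dual ℝ (Euc n))) :
    ExteriorAlgebra.ι ℝ m * (l.map (ExteriorAlgebra.ι ℝ)).prod =
      (-1 : Ext n) ^ l.length * ((l.map (ExteriorAlgebra.ι ℝ)).prod * ExteriorAlgebra.ι ℝ m) := by
  induction l with
  | nil => simp
  | cons a l ih =>
    have h : ExteriorAlgebra.ι ℝ m * ExteriorAlgebra.ι ℝ a =
        -(ExteriorAlgebra.ι ℝ a * ExteriorAlgebra.ι ℝ m) :=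
      eq_neg_of_add_eq_zero_left (ExteriorAlgebra.ι_add_mul_swap m a)
    have hc : Commute (ExteriorAlgebra.ι ℝ a) ((-1 : Ext n) ^ l.length) :=
      (Commute.neg_one_right _).pow_right _
    simp only [List.map_cons, List.prod_cons, List.length_cons]
    rw [← mul_assoc, h, neg_mul, mul_assoc, ih, ← mul_assoc (ExteriorAlgebra.ι ℝ a), hc.eq,
      pow_succ]
    simp only [mul_assoc, neg_mul, mul_neg, one_mul]

theorem list_prod_comm {n : ℕ} (l l' : List (Module.Dual ℝ (Euc n))) :
    (l.map (ExteriorAlgebra.ι ℝ)).prod * (l'.map (ExteriorAlgebra.ι ℝ)).prod =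
      (-1 : Ext n) ^ (l.length * l'.length) *
        ((l'.map (ExteriorAlgebra.ι ℝ)).prod * (l.map (ExteriorAlgebra.ι ℝ)).prod) := by
  induction l with
  | nil => simp
  | cons a l ih =>
    have hc : Commute (ExteriorAlgebra.ι ℝ a) ((-1 : Ext n) ^ (l.length * l'.length)) :=
      (Commute.neg_one_right _).pow_right _
    simp only [List.map_cons, List.prod_cons, List.length_cons]
    rw [mul_assoc, ih, ← mul_assoc, hc.eq, mul_assoc, ← mul_assoc (ExteriorAlgebra.ι ℝ a),
      ι_mul_list_prod, add_mul, one_mul, pow_add]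
    simp only [mul_assoc]

theorem toExt_graded_comm {n k l : ℕ} (w : Euc n [⋀^Fin k]→L[ℝ] ℝ) (η : Euc n [⋀^Fin l]→L[ℝ] ℝ) :
    toExt w * toExt η = (-1 : Ext n) ^ (k * l) * (toExt η * toExt w) := by
  have key : ∀ (a : Fin k → Module.Dual ℝ (Euc n)) (b : Fin l → Module.Dual ℝ (Euc n)),
      ExteriorAlgebra.ιMulti ℝ k a * ExteriorAlgebra.ιMulti ℝ l b =
        (-1 : Ext n) ^ (k * l) *
          (ExteriorAlgebra.ιMulti ℝ l b * ExteriorAlgebra.ιMulti ℝ k a) := by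
    intro a b
    have := list_prod_comm (List.ofFn a) (List.ofFn b)
    simpa [ExteriorAlgebra.ιMulti_apply, List.map_ofFn, Function.comp_def] using this
  simp only [toExt, LinearMap.smul_apply, LinearMap.sum_apply, LinearMap.coe_mk, AddHom.coe_mk,
    smul_mul_assoc, mul_smul_comm, Finset.sum_mul, Finset.mul_sum, Finset.smul_sum, key]
  rw [Finset.sum_comm]
  refine Finset.sum_congr rfl fun i _ => Finset.sum_congr rfl fun j _ => ?_
  simp only [smul_smul]
  congr 1
  ring

theorem toExt_zero_degree {n : ℕ} (w : Euc n [⋀^Fin 0]→L[ℝ] ℝ) :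
    toExt w = algebraMap ℝ (Ext n) (w 0) := by
  simp only [toExt, Nat.factorial_zero, Nat.cast_one, inv_one, one_smul, LinearMap.sum_apply,
    LinearMap.coe_mk, AddHom.coe_mk, ExteriorAlgebra.ιMulti_zero_apply]
  rw [Fintype.sum_unique, Algebra.algebraMap_eq_smul_one]
  congr 2
  exact Subsingleton.elim _ _

/-! ### Forms with values in a non-positively graded vector space

A finite-dimensional non-positively graded vector space `W = W⁰ ⊕ W⁻¹ ⊕ ⋯ ⊕ W^{-ℓ}` is given by
its homogeneous parts; `W k` is the part of degree `-k`. -/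

section Graded

variable {n ℓ : ℕ} (W : Fin (ℓ + 1) → Type*) [∀ k, NormedAddCommGroup (W k)]
  [∀ k, NormedSpace ℝ (W k)]

/-- The fibre `(⋀ (ℝⁿ)^* ⊗ W)^m = ⨁ₖ ⋀^{k+m} (ℝⁿ)^* ⊗ W^{-k}`. -/
abbrev Fiber (n : ℕ) (m : ℕ) : Type _ := ∀ k : Fin (ℓ + 1), Euc n [⋀^Fin ((k : ℕ) + m)]→L[ℝ] W k

variable {W}

/-- The `W⁰`-valued 0-form part of an element of degree `0`. -/
def zeroPart (α : Fiber W n 0) : W 0 := α 0 0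

/-! ### The graded algebra of functions on `W|_U` -/

variable (W)

/-- `C^∞(U)`. -/
abbrev SmoothFn (U : TopologicalSpace.Opens (W 0)) : Type _ :=
  C^∞⟮𝓘(ℝ, W 0), U; 𝓘(ℝ, ℝ), ℝ⟯

/-- The linear coordinates: a functional on `W^{-k}`, of degree `k`. -/
abbrev Coord : Type _ := Σ k : Fin (ℓ + 1), StrongDual ℝ (W k)

variable {W}

/-- The restriction to `U` of a linear functional on `W⁰`. -/
def linearFn (U : TopologicalSpace.Opens (W 0)) (ξ : StrongDual ℝ (W 0)) : SmoothFn W U :=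
  ⟨fun u => ξ u, ξ.contDiff.contMDiff.comp contMDiff_subtype_val⟩

variable (W)

/-- The relations defining `C^∞(U) ⊗ S((W^{<0})^*)`: linearity in the coordinates, graded
commutativity, and the identification of coordinates of degree `0` with functions on `U`. -/
inductive AlgRel (U : TopologicalSpace.Opens (W 0)) :
    FreeAlgebra (SmoothFn W U) (Coord W) → FreeAlgebra (SmoothFn W U) (Coord W) → Prop
  | add (k : Fin (ℓ + 1)) (ξ η : StrongDual ℝ (W k)) :
      AlgRel U (FreeAlgebra.ι _ ⟨k, ξ + η⟩) (FreeAlgebra.ι _ ⟨k, ξ⟩ + FreeAlgebra.ι _ ⟨k, η⟩)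
  | smul (k : Fin (ℓ + 1)) (c : ℝ) (ξ : StrongDual ℝ (W k)) :
      AlgRel U (FreeAlgebra.ι _ ⟨k, c • ξ⟩)
        (algebraMap ℝ (SmoothFn W U) c • FreeAlgebra.ι _ ⟨k, ξ⟩)
  | comm (g g' : Coord W) :
      AlgRel U (FreeAlgebra.ι _ g * FreeAlgebra.ι _ g')
        ((-1) ^ ((g.1 : ℕ) * (g'.1 : ℕ)) * (FreeAlgebra.ι _ g' * FreeAlgebra.ι _ g))
  | fn (ξ : StrongDual ℝ (W 0)) :
      AlgRel U (FreeAlgebra.ι _ ⟨0, ξ⟩) (algebraMap _ _ (linearFn U ξ))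

/-- The graded commutative algebra `𝒜_{W|_U} = C^∞(U) ⊗ S((W^{<0})^*)`. -/
abbrev FnAlg (U : TopologicalSpace.Opens (W 0)) : Type _ := RingQuot (AlgRel W U)

variable {W}

/-- The linear functional `ξ` on `W^{-k}` as an element of `𝒜_{W|_U}`. -/
def coordFn (U : TopologicalSpace.Opens (W 0)) (g : Coord W) : FnAlg W U :=
  RingQuot.mkAlgHom (SmoothFn W U) (AlgRel W U) (FreeAlgebra.ι _ g)

variable (W)

/-- The part of degree `m` of `𝒜_{W|_U}`: the `C^∞(U)`-span of the monomials of degree `m`. -/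
def degreePart (U : TopologicalSpace.Opens (W 0)) (m : ℕ) : Submodule (SmoothFn W U) (FnAlg W U) :=
  Submodule.span _ {p | ∃ l : List (Coord W), (l.map fun g => (g.1 : ℕ)).sum = m ∧
    p = (l.map (coordFn U)).prod}

/-- A differential `Q` on the graded algebra `𝒜_{W|_U}`: a derivation of degree `1` whose square
is zero. -/
structure Differential (U : TopologicalSpace.Opens (W 0)) where
  /-- the underlying linear map -/
  toLinearMap : FnAlg W U →ₗ[ℝ] FnAlg W U
  degree : ∀ m, ∀ a ∈ degreePart W U m, toLinearMap a ∈ degreePart W U (m + 1)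
  leibniz : ∀ m, ∀ a ∈ degreePart W U m, ∀ b : FnAlg W U,
    toLinearMap (a * b) = toLinearMap a * b + (-1) ^ m * (a * toLinearMap b)
  sq_zero : ∀ a, toLinearMap (toLinearMap a) = 0

variable {W}

/-- The pairing `⟨α, ξ⟩` of `α` with a coordinate, in the exterior algebra. -/
def pairing (α : Fiber W n 0) (g : Coord W) : Ext n :=
  toExt (g.2.compContinuousAlternatingMap (α g.1))

/-- Evaluation of functions at the point `u ∈ U`, with values in the scalars of `⋀ (ℝⁿ)^*`. -/
def evalFn (n : ℕ) {U : TopologicalSpace.Opens (W 0)} (u : U) : SmoothFn W U →+* Ext n where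
  toFun f := algebraMap ℝ (Ext n) (f u)
  map_one' := by simp
  map_mul' f g := by simp
  map_zero' := by simp
  map_add' f g := by simp

/-- The homomorphism `𝒜_{W|_U} → ⋀ (ℝⁿ)^*`, `F ↦ F(α)`, which substitutes `⟨α, ξ⟩` for each
coordinate `ξ`; functions on `U` are evaluated at the 0-form part of `α`. -/
def subst {U : TopologicalSpace.Opens (W 0)} (α : Fiber W n 0) (hα : zeroPart α ∈ U) :
    FnAlg W U →+* Ext n :=
  letI : Algebra (SmoothFn W U) (Ext n) := (evalFn n ⟨zeroPart α, hα⟩).toAlgebra' (by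
    intro c x
    exact Algebra.commutes (R := ℝ) (A := Ext n) (c ⟨zeroPart α, hα⟩) x)
  (RingQuot.liftAlgHom (SmoothFn W U) ⟨FreeAlgebra.lift (SmoothFn W U) (pairing α), by
    intro x y h
    have hmap : ∀ f : SmoothFn W U, algebraMap (SmoothFn W U) (Ext n) f =
        algebraMap ℝ (Ext n) (f ⟨zeroPart α, hα⟩) := fun f => rfl
    induction h with
    | add k ξ η =>
      simp only [map_add, FreeAlgebra.lift_ι_apply, pairing]
      rw [← map_add]
      rfl
    | smul k c ξ =>
      simp only [map_smul, FreeAlgebra.lift_ι_apply, pairing]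
      rw [Algebra.smul_def, hmap]
      have : (algebraMap ℝ (SmoothFn W U) c) ⟨zeroPart α, hα⟩ = c := by
        rfl
      rw [this, ← Algebra.smul_def, ← map_smul]
      rfl
    | comm g g' =>
      simp only [map_mul, map_pow, map_neg, map_one, FreeAlgebra.lift_ι_apply, pairing]
      exact toExt_graded_comm _ _
    | fn ξ =>
      rw [AlgHom.commutes, hmap, FreeAlgebra.lift_ι_apply]
      exact toExt_zero_degree _⟩).toRingHom

variable [∀ k, FiniteDimensional ℝ (W k)]

open Classical in
/-- `F_Q(α)`, where `F_Q = ∑ Qξⁱ ⊗ wᵢ ∈ 𝒜_{W|_U} ⊗ W` for dual bases `ξⁱ`, `wᵢ`, i.e.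
`⟨F_Q, ξ⟩ = Qξ`. (The value is `0` when the 0-form part of `α` is not in `U`.) -/
def FQ {U : TopologicalSpace.Opens (W 0)} (Q : Differential W U) (α : Fiber W n 0) :
    Fiber W n 1 :=
  if hα : zeroPart α ∈ U then fun k => ∑ i, (ofExt ((k : ℕ) + 1) (subst α hα (Q.toLinearMap
      (coordFn U ⟨k, LinearMap.toContinuousLinearMap ((Module.finBasis ℝ (W k)).coord i)⟩)))).smulRight
    (Module.finBasis ℝ (W k) i)
  else 0

end Graded

/-! ### Operations on forms -/

section Operations

variable {n : ℕ} {V : Type*} [NormedAddCommGroup V] [NormedSpace ℝ V]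

/-- The de Rham homotopy operator `h β = ∫₀¹ i_{∂_t} R^*β dt` of the retraction `R(x, t) = t x`. -/
def deRhamHomotopy {k : ℕ} (β : Euc n → Euc n [⋀^Fin (k + 1)]→L[ℝ] V) (x : Euc n) :
    Euc n [⋀^Fin k]→L[ℝ] V :=
  ∫ t in (0 : ℝ)..1, ((β (t • x)).curryLeft x).compContinuousLinearMap
    (t • ContinuousLinearMap.id ℝ (Euc n))

/-- The Lie derivative along the Euler vector field `E = ∑ xⁱ ∂/∂xⁱ`: the derivative at `s = 0` of
the pullback along its flow `x ↦ eˢ x`. On a star-shaped set the flow is defined for `s ≤ 0`. -/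
def lieDerivEuler {k : ℕ} (β : Euc n → Euc n [⋀^Fin k]→L[ℝ] V) (x : Euc n) :
    Euc n [⋀^Fin k]→L[ℝ] V :=
  derivWithin (fun s : ℝ => (β (Real.exp s • x)).compContinuousLinearMap
    (Real.exp s • ContinuousLinearMap.id ℝ (Euc n))) (Set.Iic 0) 0

end Operations

section GradedOperations

variable {n ℓ : ℕ} {W : Fin (ℓ + 1) → Type*} [∀ k, NormedAddCommGroup (W k)]
  [∀ k, NormedSpace ℝ (W k)]

/-- The homotopy operator on forms of degree `1` with values in `W`. -/
def hW (β : Euc n → Fiber W n 1) (x : Euc n) : Fiber W n 0 :=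
  fun k => deRhamHomotopy (fun y => β y k) x

/-- The Lie derivative along `E` on forms of degree `1` with values in `W`. -/
def lieW (β : Euc n → Fiber W n 1) (x : Euc n) : Fiber W n 1 :=
  fun k => lieDerivEuler (fun y => β y k) x

/-- Contraction with the Euler vector field at the point `x`. -/
def iE (x : Euc n) (y : Fiber W n 1) : Fiber W n 0 := fun k => (y k).curryLeft x

/-! ### Banach spaces of `C^r` maps -/

/-- Families of bounded continuous maps `N → (multilinear maps of order i)`, `i ≤ r`, with the
maximum of the supremum norms. -/
def JetSpace (N : Set (Euc n)) (r : ℕ) (F : Type*) [NormedAddCommGroup F] [NormedSpace ℝ F] :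
    Type _ :=
  ∀ i : Fin (r + 1), BoundedContinuousFunction N (Euc n [×(i : ℕ)]→L[ℝ] F)

section Jets

variable (N : Set (Euc n)) (r : ℕ) (F : Type*) [NormedAddCommGroup F] [NormedSpace ℝ F]

instance : NormedAddCommGroup (JetSpace N r F) :=
  inferInstanceAs (NormedAddCommGroup
    (∀ i : Fin (r + 1), BoundedContinuousFunction N (Euc n [×(i : ℕ)]→L[ℝ] F)))

instance : NormedSpace ℝ (JetSpace N r F) :=
  inferInstanceAs (NormedSpace ℝ
    (∀ i : Fin (r + 1), BoundedContinuousFunction N (Euc n [×(i : ℕ)]→L[ℝ] F)))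

/-- The space `C^r(N, F)` of `C^r` maps on `N` (with bounded derivatives, which is automatic when
`N` is compact). A map is recorded together with its derivatives of order `i ≤ r`; the norm is the
`C^r` norm, the maximum of the suprema of the norms of these derivatives. -/
def CrMap : Submodule ℝ (JetSpace N r F) where
  carrier := {J | ∃ p : Euc n → FormalMultilinearSeries ℝ (Euc n) F,
    HasFTaylorSeriesUpToOn r (fun x => (p x 0).curry0) p N ∧
      ∀ (i : Fin (r + 1)) (x : N), J i x = p x i}
  add_mem' := by
    rintro J K ⟨p, hp, hJ⟩ ⟨q, hq, hK⟩
    refine ⟨p + q, hp.add hq, fun i x => ?_⟩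
    change J i x + K i x = _
    simp [hJ, hK]
  zero_mem' := by
    refine ⟨0, ?_, fun i x => rfl⟩
    have h := (contDiff_const (𝕜 := ℝ) (E := Euc n) (n := (r : WithTop ℕ∞))
      (c := (0 : F))).ftaylorSeries.hasFTaylorSeriesUpToOn N
    refine (h.congr_series fun m _ x _ => ?_).congr fun x _ => by simp
    simp [ftaylorSeries]
  smul_mem' := by
    rintro c J ⟨p, hp, hJ⟩
    refine ⟨fun x => c • p x, ?_, fun i x => ?_⟩
    · exact hp.continuousLinearMap_comp (c • ContinuousLinearMap.id ℝ F)
    · change c • J i x = _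
      simp [hJ]

end Jets

open Classical in
/-- The value of a `C^r` map at a point (`0` outside `N`). -/
def ev {N : Set (Euc n)} {r : ℕ} {F : Type*} [NormedAddCommGroup F] [NormedSpace ℝ F]
    (f : CrMap N r F) (x : Euc n) : F :=
  if h : x ∈ N then (f.1 0 ⟨x, h⟩).curry0 else 0

variable (W) in
/-- The Banach space `Ω_r(N, W)^0`. -/
abbrev OmegaR (N : Set (Euc n)) (r : ℕ) : Type _ := CrMap N r (Fiber W n 0)

variable (W) in
/-- The subset `Ω_r(N, W|_U)^0`. -/
def OmegaRU (N : Set (Euc n)) (r : ℕ) (U : TopologicalSpace.Opens (W 0)) : Set (OmegaR W N r) :=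
  {A | ∀ x ∈ N, zeroPart (ev A x) ∈ U}

/-! ### The equation `ℒ_E a = F_Q(B + i_E a)` and the lifted Euler vector field -/

variable [∀ k, FiniteDimensional ℝ (W k)] {U : TopologicalSpace.Opens (W 0)}

/-- `κ(A) = A - h(F_Q(A))`, pointwise. -/
def kappa (Q : Differential W U) (A : Euc n → Fiber W n 0) (x : Euc n) : Fiber W n 0 :=
  A x - hW (fun y => FQ Q (A y)) x

/-- `a` is a `C^ρ` solution of `ℒ_E a = F_Q(B + i_E a)` on `N'`, a star-shaped open neighbourhood
of `0` in `N`. -/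
structure IsSolution (Q : Differential W U) (N : Set (Euc n)) (ρ : ℕ∞) (B : Euc n → Fiber W n 0)
    (N' : Set (Euc n)) (a : Euc n → Fiber W n 1) : Prop where
  zero_mem : (0 : Euc n) ∈ N'
  starConvex : StarConvex ℝ 0 N'
  isOpen : ∃ O : Set (Euc n), IsOpen O ∧ N' = N ∩ O
  contDiffOn : ContDiffOn ℝ ρ a N'
  mem : ∀ x ∈ N', zeroPart (B x + iE x (a x)) ∈ U
  eqn : ∀ x ∈ N', lieW a x = FQ Q (B x + iE x (a x))

/-- `A ∈ Ω(N, W|_U)^0`, of class `C^ρ`, satisfies `B = κ(A)`. -/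
structure IsPreimage (Q : Differential W U) (N : Set (Euc n)) (ρ : ℕ∞) (B A : Euc n → Fiber W n 0) :
    Prop where
  contDiffOn : ContDiffOn ℝ ρ A N
  mem : ∀ x ∈ N, zeroPart (A x) ∈ U
  eqn : ∀ x ∈ N, B x = kappa Q A x

/-- The part of the total space of `(⋀ T^*N ⊗ W)^1` where `F_Q(B + i_E ·)` is defined. -/
def hatDomain (U : TopologicalSpace.Opens (W 0)) (N : Set (Euc n)) (B : Euc n → Fiber W n 0) :
    Set (Euc n × Fiber W n 1) :=
  {p | p.1 ∈ N ∧ zeroPart (B p.1 + iE p.1 p.2) ∈ U}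

/-- The vector field `Ê = E_lift + F_Q(B + i_E ·)`; the natural lift `E_lift` of `E` multiplies the
fibre coordinates of form degree `j` by `-j`. -/
def hatE (Q : Differential W U) (B : Euc n → Fiber W n 0) (p : Euc n × Fiber W n 1) :
    Euc n × Fiber W n 1 :=
  (p.1, (fun k : Fin (ℓ + 1) => -(((k : ℕ) : ℝ) + 1) • p.2 k) + FQ Q (B p.1 + iE p.1 p.2))

end GradedOperations

/-! ### Hyperbolic fixed points and unstable manifolds -/

section Dynamics

variable {Z : Type*} [NormedAddCommGroup Z] [NormedSpace ℝ Z]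

/-- The stable subspace `{v | exp(tL) v → 0 as t → +∞}`. -/
def stableSubspace (L : Z →L[ℝ] Z) : Submodule ℝ Z where
  carrier := {v | Filter.Tendsto (fun t : ℝ => NormedSpace.exp (t • L) v) Filter.atTop (nhds 0)}
  add_mem' := fun {v w} hv hw => by simpa using Filter.Tendsto.add hv hw
  zero_mem' := by simp
  smul_mem' := fun c v hv => by simpa using Filter.Tendsto.const_smul hv c

/-- The unstable subspace `{v | exp(tL) v → 0 as t → -∞}`. -/
def unstableSubspace (L : Z →L[ℝ] Z) : Submodule ℝ Z where
  carrier := {v | Filter.Tendsto (fun t : ℝ => NormedSpace.exp (t • L) v) Filter.atBot (nhds 0)}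
  add_mem' := fun {v w} hv hw => by simpa using Filter.Tendsto.add hv hw
  zero_mem' := by simp
  smul_mem' := fun c v hv => by simpa using Filter.Tendsto.const_smul hv c

/-- The unstable manifold of the fixed point `P` of the vector field `X` on `D`: the points whose
integral curve exists in `D` for all negative times and tends to `P` as time tends to `-∞`. -/
def unstableManifold (X : Z → Z) (D : Set Z) (P : Z) : Set Z :=
  {p | ∃ γ : ℝ → Z, γ 0 = p ∧
    (∀ s ≤ 0, γ s ∈ D ∧ HasDerivWithinAt γ (X (γ s)) (Set.Iic 0) s) ∧
    Filter.Tendsto γ Filter.atBot (nhds P)}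

end Dynamics

section HatE

variable {n ℓ : ℕ} {W : Fin (ℓ + 1) → Type*} [∀ k, NormedAddCommGroup (W k)]
  [∀ k, NormedSpace ℝ (W k)] [∀ k, FiniteDimensional ℝ (W k)] {U : TopologicalSpace.Opens (W 0)}

/-- `P` is the unique fixed point of `Ê`, it lies over `0`, and it is hyperbolic: the stable
subspace is the vertical one, with eigenvalues `-j` on the forms of degree `j`, and the unstable
subspace, with the only eigenvalue `1`, projects bijectively onto `ℝⁿ`. -/
structure IsHyperbolicFixedPoint (Q : Differential W U) (N : Set (Euc n))
    (B : Euc n → Fiber W n 0) (P : Euc n × Fiber W n 1) : Prop where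
  fst_eq : P.1 = 0
  mem : P ∈ hatDomain U N B
  unique : ∀ p ∈ hatDomain U N B, hatE Q B p = 0 ↔ p = P
  hyperbolic : ∃ L : (Euc n × Fiber W n 1) →L[ℝ] (Euc n × Fiber W n 1),
    HasFDerivWithinAt (hatE Q B) L (hatDomain U N B) P ∧
    IsCompl (stableSubspace L) (unstableSubspace L) ∧
    stableSubspace L = LinearMap.ker (LinearMap.fst ℝ (Euc n) (Fiber W n 1)) ∧
    (∀ y : Fiber W n 1, L (0, y) = (0, fun k : Fin (ℓ + 1) => -(((k : ℕ) : ℝ) + 1) • y k)) ∧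
    Function.Bijective (fun v : unstableSubspace L => (v : Euc n × Fiber W n 1).1) ∧
    ∀ v ∈ unstableSubspace L, L v = v

end HatE

end Kuranishi

end

/-! The whole problem decomposes along rays. At `x` the homotopy operator is contraction with `x` of
the averages `∫₀¹ τ^k β_k(τ x) dτ` (`hW_eq`). Restricting `κ(A) = B` to the ray `t ↦ t x` therefore
gives the Volterra equation `A(t) = B(t x) + t J_x ∫₀¹ τ^k f_k(A(τ t)) dτ`, with `J` the contraction
and `f = F_Q` (`RaySol`). On the same ray the equation `ℒ_E a = F_Q(B + i_E a)` says `(t^{k+1} a_k)'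
= t^k f_k`; since `a` is continuous at `0`, integration identifies `a` with the average and `B + i_E
a` with a solution of the same Volterra equation (`raySol_of_hasDerivAt`,
`hasDerivWithinAt_average_exp`). With `t = e^s` this is also the equation of the backward integral
curves of `Ê` that converge to the fixed point, because their base component must be `e^s x`.
Preimages under `κ`, solutions `a`, and the unstable manifold are thus three descriptions of the
same ray solutions.

Iterating a Volterra operator gains a factor `1/m!`. Hence the nonlinear ray equation has at most
one solution (`eq_of_volterra_eq`) and its linearization is invertible (`isUnit_one_sub_volterra`).
By the inverse function theorem, `(x, A) ↦ (x, A - t J_x average(f ∘ A))` is a diffeomorphism from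
an open set of pairs (point, curve) onto an open image (`exists_rayChart`). The greatest domain `N'`
consists of the `x` whose ray is solvable; it is the preimage of that open image under `x ↦ (x, B ∘
ray_x)`. This map is `C^ρ` into a space of continuous curves (`contDiffOn_ray`), so `N'` is open in
`N` and `a` is `C^ρ`. The corners of `N` enter through two properties only: unique differentiability
and local quasiconvexity.

At the fixed point the linearization is block triangular, the identity on the base and `-(k+1)` on
the fibres, so its exponential and both invariant subspaces are explicit.

For compact `N`, superposition with `f` is smooth on `C^r` maps (`contDiffOn_crNem`), hence so is
`κ`. Injectivity of `κ` and bijectivity of its derivative are again checked ray by ray; the linear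
equation has `C^r` solutions for `C^r` data (`exists_linear_solution`). The inverse function theorem
then gives the smooth open embedding (`exists_kappa_crMap`). -/

noncomputable section

namespace Kuranishi

open Set Filter Topology Metric

/-! ### Locally quasiconvex sets -/

section Quasiconvex

variable {E F : Type*} [NormedAddCommGroup E] [NormedSpace ℝ E] [NormedAddCommGroup F]
  [NormedSpace ℝ F]

/-- Near each point of `S`, two points of `S` are joined by a differentiable curve in `S` whose
speed is at most a constant times their distance. -/
def LocallyQuasiconvex (S : Set E) : Prop :=
  ∀ z ∈ S, ∃ C : ℝ, 0 ≤ C ∧ ∀ V ∈ 𝓝 z, ∀ᶠ p : E × E in 𝓝 (z, z), p.1 ∈ S → p.2 ∈ S →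
    ∃ γ γ' : ℝ → E, γ 0 = p.1 ∧ γ 1 = p.2 ∧ ∀ t ∈ Icc (0 : ℝ) 1, γ t ∈ S ∧ γ t ∈ V ∧
      HasDerivWithinAt γ (γ' t) (Icc 0 1) t ∧ ‖γ' t‖ ≤ C * ‖p.2 - p.1‖

theorem IsOpen.locallyQuasiconvex {S : Set E} (hS : IsOpen S) : LocallyQuasiconvex S := by
  intro z hz
  refine ⟨1, zero_le_one, fun V hV => ?_⟩
  obtain ⟨δ, hδ, hball⟩ := Metric.mem_nhds_iff.1 (inter_mem (hS.mem_nhds hz) hV)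
  have : ball z δ ×ˢ ball z δ ∈ 𝓝 (z, z) := prod_mem_nhds (ball_mem_nhds z hδ) (ball_mem_nhds z hδ)
  filter_upwards [this] with p hp _ _
  refine ⟨fun t => p.1 + t • (p.2 - p.1), fun _ => p.2 - p.1, by simp, by simp, fun t ht => ?_⟩
  have hmem : p.1 + t • (p.2 - p.1) ∈ ball z δ :=
    (convex_ball z δ).add_smul_sub_mem hp.1 hp.2 ht
  refine ⟨(hball hmem).1, (hball hmem).2, ?_, by simp⟩
  simpa using (((hasDerivAt_id t).smul_const (p.2 - p.1)).const_add p.1).hasDerivWithinAt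

/-- This is the mean value inequality along the connecting curve. The order of quantifiers matters:
the constant depends on `z` only, and the neighbourhood of pairs does not depend on `g`, so a whole
sequence of functions can be treated at once. -/
theorem LocallyQuasiconvex.mean_value {S : Set E} (hS : LocallyQuasiconvex S) {z : E}
    (hz : z ∈ S) : ∃ C : ℝ, 0 ≤ C ∧ ∀ V ∈ 𝓝 z, ∀ᶠ p : E × E in 𝓝 (z, z), p.1 ∈ S → p.2 ∈ S →
      ∀ (g : E → F) (g' : E → E →L[ℝ] F) (ε : ℝ),
        (∀ y ∈ S, y ∈ V → HasFDerivWithinAt g (g' y) S y) → (∀ y ∈ S, y ∈ V → ‖g' y‖ ≤ ε) →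
          ‖g p.2 - g p.1‖ ≤ C * ε * ‖p.2 - p.1‖ := by
  obtain ⟨C, hC, h⟩ := hS z hz
  refine ⟨C, hC, fun V hV => ?_⟩
  filter_upwards [h V hV] with p hp h1 h2 g g' ε hg hb
  obtain ⟨γ, γ', h0, h1, hγ⟩ := hp h1 h2
  rw [← h0, ← h1]
  have key := norm_image_sub_le_of_norm_deriv_le_segment_01' (f := g ∘ γ)
    (f' := fun t => g' (γ t) (γ' t)) (C := C * ε * ‖p.2 - p.1‖) (fun t ht => ?_) (fun t ht => ?_)
  · simpa [h0, h1] using key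
  · obtain ⟨hs, hv, hd, -⟩ := hγ t ht
    exact (hg _ hs hv).comp_hasDerivWithinAt t hd (fun s hs => (hγ s hs).1)
  · obtain ⟨hs, hv, hd, hn⟩ := hγ t (Ico_subset_Icc_self ht)
    have hε : 0 ≤ ε := (norm_nonneg _).trans (hb _ hs hv)
    calc ‖g' (γ t) (γ' t)‖ ≤ ‖g' (γ t)‖ * ‖γ' t‖ := (g' (γ t)).le_opNorm _
      _ ≤ ε * (C * ‖p.2 - p.1‖) := by gcongr; exact hb _ hs hv
      _ = _ := by ring

/-- The mean value inequality is applied to `f - f' z`, whose derivative is small near `z`. The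
expansion is at the moving point `p.1`, as needed to bound Taylor remainders uniformly along a
curve. -/
theorem LocallyQuasiconvex.strict {S : Set E} (hS : LocallyQuasiconvex S) {f : E → F}
    {f' : E → E →L[ℝ] F} (hf : ∀ x ∈ S, HasFDerivWithinAt f (f' x) S x) (hf' : ContinuousOn f' S)
    {z : E} (hz : z ∈ S) {ε : ℝ} (hε : 0 < ε) :
    ∀ᶠ p : E × E in 𝓝 (z, z), p.1 ∈ S → p.2 ∈ S →
      ‖f p.2 - f p.1 - f' p.1 (p.2 - p.1)‖ ≤ ε * ‖p.2 - p.1‖ := by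
  obtain ⟨C, hC, h⟩ := hS.mean_value (F := F) hz
  -- `C * η` comes from the mean value inequality, one more `η` from replacing `f' z` by `f' p.1`.
  set η := ε / (C + 1) with hη
  have hη0 : 0 < η := by positivity
  have hV : {y | y ∈ S → ‖f' y - f' z‖ ≤ η} ∈ 𝓝 z := by
    have := (hf' z hz).eventually (Metric.closedBall_mem_nhds (f' z) hη0)
    rw [eventually_nhdsWithin_iff] at this
    filter_upwards [this] with y hy hyS
    simpa [dist_eq_norm] using hy hyS
  have hfst : ∀ᶠ p : E × E in 𝓝 (z, z), p.1 ∈ {y | y ∈ S → ‖f' y - f' z‖ ≤ η} :=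
    continuous_fst.continuousAt.eventually_mem (by exact hV)
  filter_upwards [h _ hV, hfst] with p hp hp1 h1 h2
  have key := hp h1 h2 (fun y => f y - f' z y) (fun y => f' y - f' z) η
    (fun y hy _ => (hf y hy).sub (f' z).hasFDerivWithinAt) (fun y hy hyV => hyV hy)
  have e : f p.2 - f p.1 - f' p.1 (p.2 - p.1) =
      ((f p.2 - f' z p.2) - (f p.1 - f' z p.1)) - (f' p.1 - f' z) (p.2 - p.1) := by
    simp only [_root_.sub_apply, map_sub]; abel
  rw [e]
  calc _ ≤ C * η * ‖p.2 - p.1‖ + η * ‖p.2 - p.1‖ := by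
        refine (norm_sub_le _ _).trans (add_le_add key ?_)
        exact (ContinuousLinearMap.le_opNorm _ _).trans (by gcongr; exact hp1 h1)
    _ = ε * ‖p.2 - p.1‖ := by rw [hη]; field_simp

/-- A Lebesgue number argument: the diagonal of `K` is compact, so a neighbourhood of it contains a
thickening. The second point `y'` need not lie in `K`. -/
theorem exists_dist_lt_of_mem_nhds_diag {α : Type*} [PseudoMetricSpace α] {K : Set α}
    (hK : IsCompact K) {T : Set (α × α)} (hT : ∀ z ∈ K, T ∈ 𝓝 (z, z)) :
    ∃ δ > 0, ∀ y ∈ K, ∀ y', dist y' y < δ → (y, y') ∈ T := by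
  have hc : IsCompact ((fun z => (z, z)) '' K) := hK.image (by fun_prop)
  have hsub : (fun z => (z, z)) '' K ⊆ interior T := by
    rintro _ ⟨z, hz, rfl⟩
    exact mem_interior_iff_mem_nhds.2 (hT z hz)
  obtain ⟨δ, hδ, h⟩ := hc.exists_thickening_subset_open isOpen_interior hsub
  refine ⟨δ, hδ, fun y hy y' hd => interior_subset (h ?_)⟩
  refine mem_thickening_iff.2 ⟨(y, y), ⟨y, hy, rfl⟩, ?_⟩
  simp [Prod.dist_eq, hd]

/-- A uniform limit of differentiable maps whose derivatives converge uniformly. -/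
theorem LocallyQuasiconvex.hasFDerivWithinAt_of_tendsto {S : Set E} (hS : LocallyQuasiconvex S)
    {f : ℕ → E → F} {f' : ℕ → E → E →L[ℝ] F} {g : E → F} {g' : E → E →L[ℝ] F}
    (hf : ∀ m, ∀ x ∈ S, HasFDerivWithinAt (f m) (f' m x) S x)
    (hfg : ∀ x ∈ S, Tendsto (fun m => f m x) atTop (𝓝 (g x)))
    (hfg' : ∀ ε > 0, ∀ᶠ m in atTop, ∀ x ∈ S, ‖f' m x - g' x‖ ≤ ε) {z : E} (hz : z ∈ S) :
    HasFDerivWithinAt g (g' z) S z := by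
  obtain ⟨C, hC, h⟩ := hS.mean_value (F := F) hz
  rw [hasFDerivWithinAt_iff_isLittleO, Asymptotics.isLittleO_iff]
  intro ε hε
  -- Two derivatives within `η` of the limit differ by at most `2 * η`, which contributes `2 * C *
  -- η`; the expansion of `f m₀` and the replacement of its derivative by `g' z` contribute `η`
  -- each.
  set η := ε / (2 * C + 2) with hη
  have hη0 : 0 < η := by positivity
  obtain ⟨m₀, hm₀⟩ := eventually_atTop.1 (hfg' η hη0)
  have h1 := (hasFDerivWithinAt_iff_isLittleO.1 (hf m₀ z hz)).def hη0
  have h2 : ∀ᶠ x in 𝓝[S] z, x ∈ S → ∀ (u : E → F) (u' : E → E →L[ℝ] F) (ε : ℝ),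
      (∀ y ∈ S, HasFDerivWithinAt u (u' y) S y) → (∀ y ∈ S, ‖u' y‖ ≤ ε) →
          ‖u x - u z‖ ≤ C * ε * ‖x - z‖ := by
    have := (Continuous.prodMk_right z).continuousAt (x := z) |>.eventually (h univ univ_mem)
    filter_upwards [nhdsWithin_le_nhds this] with x hx hxS u u' ε h1 h2
    exact hx hz hxS u u' ε (fun y hy _ => h1 y hy) (fun y hy _ => h2 y hy)
  filter_upwards [h1, h2, self_mem_nhdsWithin] with x hx1 hx2 hxS
  -- The bound is uniform in `m`, so it persists when `f m` is replaced by its pointwise limit `g`.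
  have key : ∀ᶠ m in atTop, ‖(f m x - f m₀ x) - (f m z - f m₀ z)‖ ≤ C * (2 * η) * ‖x - z‖ := by
    filter_upwards [eventually_ge_atTop m₀] with m hm
    refine hx2 hxS (fun y => f m y - f m₀ y) (fun y => f' m y - f' m₀ y) (2 * η)
      (fun y hy => (hf m y hy).sub (hf m₀ y hy)) (fun y hy => ?_)
    calc ‖f' m y - f' m₀ y‖ = ‖(f' m y - g' y) - (f' m₀ y - g' y)‖ := by congr 1; abel
      _ ≤ η + η := (norm_sub_le _ _).trans (add_le_add (hm₀ m hm y hy) (hm₀ m₀ le_rfl y hy))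
      _ = 2 * η := by ring
  have hlim : Tendsto (fun m => ‖(f m x - f m₀ x) - (f m z - f m₀ z)‖) atTop
      (𝓝 ‖(g x - f m₀ x) - (g z - f m₀ z)‖) :=
    (((hfg x hxS).sub_const _).sub ((hfg z hz).sub_const _)).norm
  have key' := le_of_tendsto hlim key
  have e : g x - g z - g' z (x - z) = ((g x - f m₀ x) - (g z - f m₀ z)) +
      (f m₀ x - f m₀ z - f' m₀ z (x - z)) + (f' m₀ z - g' z) (x - z) := by
    simp only [_root_.sub_apply]; abel
  rw [e]
  calc _ ≤ C * (2 * η) * ‖x - z‖ + η * ‖x - z‖ + η * ‖x - z‖ := by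
        refine (norm_add₃_le).trans (add_le_add (add_le_add key' hx1) ?_)
        exact (ContinuousLinearMap.le_opNorm _ _).trans (by gcongr; exact hm₀ m₀ le_rfl z hz)
    _ = ε * ‖x - z‖ := by rw [hη]; field_simp; ring

end Quasiconvex

/-! ### Superposition operators on spaces of continuous maps -/

section Superposition

variable {K : Type*} [TopologicalSpace K] [CompactSpace K]

/-- The bilinear operation on continuous maps induced pointwise by a continuous bilinear map. -/
def pointwise (K : Type*) [TopologicalSpace K] [CompactSpace K] {F G H : Type*}
    [NormedAddCommGroup F] [NormedSpace ℝ F] [NormedAddCommGroup G] [NormedSpace ℝ G]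
    [NormedAddCommGroup H] [NormedSpace ℝ H] (b : F →L[ℝ] G →L[ℝ] H) :
    C(K, F) →L[ℝ] C(K, G) →L[ℝ] C(K, H) :=
  LinearMap.mkContinuous₂
    (LinearMap.mk₂ ℝ (fun f g => (⟨fun t => b (f t) (g t), by fun_prop⟩ : C(K, H)))
      (fun f f' g => by ext; simp) (fun c f g => by ext; simp)
      (fun f g g' => by ext; simp) (fun c f g => by ext; simp))
    ‖b‖ (fun f g => by
      refine (ContinuousMap.norm_le _ (by positivity)).2 fun t => ?_
      calc ‖b (f t) (g t)‖ ≤ ‖b‖ * ‖f t‖ * ‖g t‖ := b.le_opNorm₂ _ _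
        _ ≤ ‖b‖ * ‖f‖ * ‖g‖ := by
          gcongr <;> exact ContinuousMap.norm_coe_le_norm _ _)

@[simp]
theorem pointwise_apply {F G H : Type*}
    [NormedAddCommGroup F] [NormedSpace ℝ F] [NormedAddCommGroup G] [NormedSpace ℝ G]
    [NormedAddCommGroup H] [NormedSpace ℝ H] (b : F →L[ℝ] G →L[ℝ] H) (f : C(K, F)) (g : C(K, G))
    (t : K) : pointwise K b f g t = b (f t) (g t) := rfl

open Classical in
/-- The superposition operator `A ↦ F ∘ A` (with value `0` where `F ∘ A` is not continuous). -/
def nem {X Y : Type*} [TopologicalSpace X] [TopologicalSpace Y] [Zero Y] (f : X → Y)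
    (A : C(K, X)) : C(K, Y) :=
  if h : Continuous (f ∘ A) then ⟨f ∘ A, h⟩ else 0

theorem nem_apply {X Y : Type*} [TopologicalSpace X] [TopologicalSpace Y] [Zero Y] {f : X → Y}
    {S : Set X} (hf : ContinuousOn f S) {A : C(K, X)} (hA : ∀ t, A t ∈ S) (t : K) :
    nem f A t = f (A t) := by
  have h : Continuous (f ∘ A) := hf.comp_continuous A.continuous hA
  simp [nem, h]

variable {X Y : Type*} [NormedAddCommGroup X] [NormedSpace ℝ X] [NormedAddCommGroup Y]
  [NormedSpace ℝ Y]

/-- The range of `A` is compact, so continuity of `f` at its points is uniform in the sense of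
`exists_dist_lt_of_mem_nhds_diag`. -/
theorem continuousOn_nem {f : X → Y} {S : Set X} (hf : ContinuousOn f S) :
    ContinuousOn (nem f : C(K, X) → C(K, Y)) {A | ∀ t, A t ∈ S} := by
  intro A hA
  rw [Metric.continuousWithinAt_iff]
  intro ε hε
  obtain ⟨δ, hδ, h⟩ := exists_dist_lt_of_mem_nhds_diag (isCompact_range A.continuous)
    (T := {p | p.1 ∈ S → p.2 ∈ S → dist (f p.2) (f p.1) ≤ ε / 2}) (by
      rintro _ ⟨t, rfl⟩
      -- Each of the two points contributes `ε / 4`; the resulting non-strict bound `ε / 2` leaves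
      -- room for the strict inequality in the supremum distance.
      have := Metric.continuousOn_iff.1 hf (A t) (hA t) (ε / 4) (by positivity)
      obtain ⟨δ, hδ, h⟩ := this
      filter_upwards [prod_mem_nhds (ball_mem_nhds (A t) hδ) (ball_mem_nhds (A t) hδ)]
      rintro p ⟨hp1, hp2⟩ h1 h2
      have := dist_triangle_right (f p.2) (f p.1) (f (A t))
      linarith [h _ h1 hp1, h _ h2 hp2])
  refine ⟨δ, hδ, fun A' hA' hd => ?_⟩
  refine lt_of_le_of_lt ((ContinuousMap.dist_le (by positivity)).2 fun t => ?_) (half_lt_self hε)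
  rw [nem_apply hf hA, nem_apply hf hA']
  exact h _ (mem_range_self t) _ (lt_of_le_of_lt (ContinuousMap.dist_apply_le_dist t) hd)
    (hA t) (hA' t)

/-- The remainder is estimated pointwise by `LocallyQuasiconvex.strict`, and compactness of the
range of `A` makes the estimate uniform in `t`. -/
theorem hasFDerivWithinAt_nem {f : X → Y} {f' : X → X →L[ℝ] Y} {S : Set X}
    (hS : LocallyQuasiconvex S) (hf : ∀ x ∈ S, HasFDerivWithinAt f (f' x) S x)
    (hf' : ContinuousOn f' S) {A : C(K, X)} (hA : ∀ t, A t ∈ S) :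
    HasFDerivWithinAt (nem f : C(K, X) → C(K, Y))
      (pointwise K (.id ℝ (X →L[ℝ] Y)) (nem f' A)) {A | ∀ t, A t ∈ S} A := by
  have hfc : ContinuousOn f S := fun x hx => (hf x hx).continuousWithinAt
  rw [hasFDerivWithinAt_iff_isLittleO, Asymptotics.isLittleO_iff]
  intro ε hε
  obtain ⟨δ, hδ, h⟩ := exists_dist_lt_of_mem_nhds_diag (isCompact_range A.continuous)
    (T := {p | p.1 ∈ S → p.2 ∈ S → ‖f p.2 - f p.1 - f' p.1 (p.2 - p.1)‖ ≤ ε * ‖p.2 - p.1‖}) (by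
      rintro _ ⟨t, rfl⟩
      exact hS.strict hf hf' (hA t) hε)
  filter_upwards [nhdsWithin_le_nhds (ball_mem_nhds A hδ), self_mem_nhdsWithin] with A' hd hA'
  refine (ContinuousMap.norm_le _ (by positivity)).2 fun t => ?_
  simp only [ContinuousMap.sub_apply, pointwise_apply, nem_apply hfc hA, nem_apply hfc hA',
    nem_apply hf' hA, ContinuousLinearMap.id_apply]
  refine (h _ (mem_range_self t) _ (lt_of_le_of_lt (ContinuousMap.dist_apply_le_dist t) hd)
    (hA t) (hA' t)).trans ?_
  gcongr
  exact ContinuousMap.norm_coe_le_norm (A' - A) t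

/-- The derivative of superposition with `f` is pointwise multiplication by superposition with `f'`,
and the former depends linearly and continuously on the latter; this drives the induction, with `Y`
replaced by `X →L[ℝ] Y`. The set of admissible curves need not be open, so the derivative is
exhibited explicitly. -/
theorem contDiffOn_nat_nem.{u, v} {K : Type*} [TopologicalSpace K] [CompactSpace K]
    {X : Type v} [NormedAddCommGroup X] [NormedSpace ℝ X]
    {S : Set X} (hS : LocallyQuasiconvex S) (hu : UniqueDiffOn ℝ S) (m : ℕ)
    {Y : Type (max u v)} [NormedAddCommGroup Y] [NormedSpace ℝ Y] {f : X → Y}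
    (hf : ContDiffOn ℝ m f S) :
    ContDiffOn ℝ m (nem f : C(K, X) → C(K, Y)) {A | ∀ t, A t ∈ S} := by
  induction m generalizing Y with
  | zero =>
    rw [Nat.cast_zero, contDiffOn_zero] at hf ⊢
    exact continuousOn_nem hf
  | succ m ih =>
    have h1 : ContDiffOn ℝ m (fderivWithin ℝ f S) S := hf.fderivWithin hu (by simp)
    have hd : DifferentiableOn ℝ f S := hf.differentiableOn (by simp)
    rw [Nat.cast_succ, contDiffOn_succ_iff_hasFDerivWithinAt (by simp)]
    intro A hA
    refine ⟨{A | ∀ t, A t ∈ S}, ?_, by simp, fun A =>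
      pointwise K (.id ℝ (X →L[ℝ] Y)) (nem (fderivWithin ℝ f S) A), fun A hA => ?_, ?_⟩
    · rw [insert_eq_of_mem hA]; exact self_mem_nhdsWithin
    · exact hasFDerivWithinAt_nem hS (fun x hx => (hd x hx).hasFDerivWithinAt) h1.continuousOn hA
    · exact (pointwise K (.id ℝ (X →L[ℝ] Y))).contDiff.comp_contDiffOn (ih h1)

theorem contDiffOn_nem.{u, v} {K : Type*} [TopologicalSpace K] [CompactSpace K]
    {X : Type v} [NormedAddCommGroup X] [NormedSpace ℝ X]
    {S : Set X} (hS : LocallyQuasiconvex S) (hu : UniqueDiffOn ℝ S) {ρ : ℕ∞}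
    {Y : Type (max u v)} [NormedAddCommGroup Y] [NormedSpace ℝ Y] {f : X → Y}
    (hf : ContDiffOn ℝ ρ f S) :
    ContDiffOn ℝ ρ (nem f : C(K, X) → C(K, Y)) {A | ∀ t, A t ∈ S} := by
  rw [contDiffOn_iff_forall_nat_le] at hf ⊢
  exact fun m hm => contDiffOn_nat_nem.{u, v} hS hu m (hf m hm)

end Superposition

end Kuranishi

end

noncomputable section

namespace Kuranishi

open Set Filter Topology Metric

/-! ### Submanifolds with corners -/

section Corners

variable {n : ℕ} {N : Set (Euc n)}

theorem convex_sector (s : Finset (Fin n)) : Convex ℝ {y : Euc n | ∀ i ∈ s, 0 ≤ y i} := by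
  intro x hx y hy a b ha hb _ i hi
  have h1 := hx i hi
  have h2 := hy i hi
  simp only [PiLp.add_apply, PiLp.smul_apply, smul_eq_mul]
  positivity

theorem interior_sector_nonempty (s : Finset (Fin n)) :
    (interior {y : Euc n | ∀ i ∈ s, 0 ≤ y i}).Nonempty := by
  refine ⟨WithLp.toLp 2 fun _ => 1, mem_interior.2 ⟨{y : Euc n | ∀ i, 0 < y i}, ?_, ?_, ?_⟩⟩
  · exact fun y hy i _ => (hy i).le
  · have : {y : Euc n | ∀ i, 0 < y i} = ⋂ i, {y : Euc n | 0 < y i} := by ext; simp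
    rw [this]
    exact isOpen_iInter_of_finite fun i => isOpen_lt continuous_const (by fun_prop)
  · intro i; simp

/-- A sector is convex with nonempty interior, hence uniquely differentiable. The property is
transported by the inverse chart, whose derivative is onto because the derivative of the chart is a
right inverse of it. -/
theorem IsSubmanifoldWithCorners.uniqueDiffOn (hN : IsSubmanifoldWithCorners N) :
    UniqueDiffOn ℝ N := by
  intro x hx
  obtain ⟨φ, hxφ, hφ, hφs, s, hs⟩ := hN x hx
  have hy : φ x ∈ φ.target := φ.map_source hxφ
  have h1 : UniqueDiffWithinAt ℝ ({y : Euc n | ∀ i ∈ s, 0 ≤ y i} ∩ φ.target) (φ x) :=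
    (uniqueDiffOn_convex (convex_sector s) (interior_sector_nonempty s)).inter φ.open_target
      (φ x) ⟨(hs x hxφ).1 hx, hy⟩
  have hd : HasFDerivAt φ.symm (fderiv ℝ φ.symm (φ x)) (φ x) :=
    ((hφs.differentiableOn (by simp)).differentiableAt (φ.open_target.mem_nhds hy)).hasFDerivAt
  have hd' : HasFDerivAt φ (fderiv ℝ φ x) x :=
    ((hφ.differentiableOn (by simp)).differentiableAt (φ.open_source.mem_nhds hxφ)).hasFDerivAt
  have hcomp : (fderiv ℝ φ.symm (φ x)).comp (fderiv ℝ φ x) = .id ℝ (Euc n) := by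
    have h2 := hd.comp x hd'
    refine h2.unique ((hasFDerivAt_id x).congr_of_eventuallyEq ?_)
    filter_upwards [φ.open_source.mem_nhds hxφ] with y hy
    simp [φ.left_inv hy]
  have h3 := hd.hasFDerivWithinAt.uniqueDiffWithinAt h1
    (Function.Surjective.denseRange fun v => ⟨fderiv ℝ φ x v, by
      simpa using congrArg (fun L => L v) hcomp⟩)
  rw [φ.left_inv hxφ] at h3
  refine h3.mono ?_
  rintro _ ⟨y, ⟨hy1, hy2⟩, rfl⟩
  refine (hs _ (φ.map_target hy2)).2 ?_
  rw [φ.right_inv hy2]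
  exact hy1

/-- The curve is the image under the inverse chart of a segment in the convex model. The constant is
the product of a local Lipschitz constant of the chart and a local bound on the derivative of its
inverse. -/
theorem exists_curve_of_chart {E : Type*} [NormedAddCommGroup E] [NormedSpace ℝ E] {N S : Set E}
    (hS : Convex ℝ S) {z : E} (φ : OpenPartialHomeomorph E E) (hzφ : z ∈ φ.source)
    (hφ : ContDiffOn ℝ ∞ φ φ.source) (hφs : ContDiffOn ℝ ∞ φ.symm φ.target)
    (hs : ∀ y ∈ φ.source, y ∈ N ↔ φ y ∈ S) :
    ∃ C : ℝ, 0 ≤ C ∧ ∀ V ∈ 𝓝 z, ∀ᶠ p : E × E in 𝓝 (z, z), p.1 ∈ N → p.2 ∈ N →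
      ∃ γ γ' : ℝ → E, γ 0 = p.1 ∧ γ 1 = p.2 ∧ ∀ t ∈ Icc (0 : ℝ) 1, γ t ∈ N ∧ γ t ∈ V ∧
        HasDerivWithinAt γ (γ' t) (Icc 0 1) t ∧ ‖γ' t‖ ≤ C * ‖p.2 - p.1‖ := by
  have hy : φ z ∈ φ.target := φ.map_source hzφ
  have hc1 : ContDiffAt ℝ 1 φ z :=
    (hφ.contDiffAt (φ.open_source.mem_nhds hzφ)).of_le (by simp)
  obtain ⟨C₁, T₁, hT₁, hL⟩ := hc1.exists_lipschitzOnWith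
  have hdc : ContinuousAt (fderiv ℝ φ.symm) (φ z) :=
    (hφs.continuousOn_fderiv_of_isOpen φ.open_target (by simp)).continuousAt
      (φ.open_target.mem_nhds hy)
  set C₂ := ‖fderiv ℝ φ.symm (φ z)‖ + 1 with hC₂
  have hb : ∀ᶠ y in 𝓝 (φ z), ‖fderiv ℝ φ.symm y‖ ≤ C₂ :=
    (hdc.norm.eventually_lt_const (by rw [hC₂]; linarith)).mono fun _ h => h.le
  refine ⟨C₂ * C₁, by positivity, fun V hV => ?_⟩
  have hVs : φ.symm ⁻¹' V ∈ 𝓝 (φ z) := by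
    refine (φ.continuousAt_symm hy).preimage_mem_nhds ?_
    rwa [φ.left_inv hzφ]
  obtain ⟨δ, hδ, hball⟩ := Metric.mem_nhds_iff.1
    (inter_mem (inter_mem hVs hb) (φ.open_target.mem_nhds hy))
  have hW : T₁ ∩ φ.source ∩ φ ⁻¹' ball (φ z) δ ∈ 𝓝 z :=
    inter_mem (inter_mem hT₁ (φ.open_source.mem_nhds hzφ))
      ((φ.continuousAt hzφ).preimage_mem_nhds (ball_mem_nhds _ hδ))
  filter_upwards [prod_mem_nhds hW hW] with p hp h1 h2
  obtain ⟨⟨⟨hp1, hp1s⟩, hp1b⟩, ⟨⟨hp2, hp2s⟩, hp2b⟩⟩ := hp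
  set ℓ : ℝ → E := fun t => φ p.1 + t • (φ p.2 - φ p.1) with hℓ
  refine ⟨fun t => φ.symm (ℓ t), fun t => fderiv ℝ φ.symm (ℓ t) (φ p.2 - φ p.1),
    by simp [hℓ, φ.left_inv hp1s], by simp [hℓ, φ.left_inv hp2s], fun t ht => ?_⟩
  have hmem : ℓ t ∈ ball (φ z) δ := (convex_ball _ _).add_smul_sub_mem hp1b hp2b ht
  obtain ⟨⟨hmV, hmb⟩, hmt⟩ := hball hmem
  refine ⟨(hs _ (φ.map_target hmt)).2 ?_, hmV, ?_, ?_⟩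
  · rw [φ.right_inv hmt]
    exact hS.add_smul_sub_mem ((hs _ hp1s).1 h1) ((hs _ hp2s).1 h2) ht
  · have hd : HasFDerivAt φ.symm (fderiv ℝ φ.symm (ℓ t)) (ℓ t) :=
      ((hφs.differentiableOn (by simp)).differentiableAt (φ.open_target.mem_nhds hmt)).hasFDerivAt
    have hl : HasDerivAt ℓ (φ p.2 - φ p.1) t := by
      simpa [hℓ] using ((hasDerivAt_id t).smul_const (φ p.2 - φ p.1)).const_add (φ p.1)
    exact (hd.comp_hasDerivAt t hl).hasDerivWithinAt
  · have := hL.norm_sub_le hp2 hp1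
    calc _ ≤ ‖fderiv ℝ φ.symm (ℓ t)‖ * ‖φ p.2 - φ p.1‖ := ContinuousLinearMap.le_opNorm _ _
      _ ≤ C₂ * (C₁ * ‖p.2 - p.1‖) := by gcongr; exact hmb
      _ = _ := by ring

theorem IsSubmanifoldWithCorners.locallyQuasiconvex (hN : IsSubmanifoldWithCorners N) :
    LocallyQuasiconvex N := by
  intro z hz
  obtain ⟨φ, hzφ, hφ, hφs, s, hs⟩ := hN z hz
  exact exists_curve_of_chart (convex_sector s) φ hzφ hφ hφs hs

end Corners

/-! ### Injective local diffeomorphisms, and maps into a closed subspace -/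

section Banach

/-- The open mapping theorem makes each derivative a continuous linear equivalence, so the inverse
function theorem shows that `f` is open with locally smooth inverse; injectivity glues the local
inverses. -/
theorem exists_openPartialHomeomorph {H : Type*} [NormedAddCommGroup H] [NormedSpace ℝ H]
    [CompleteSpace H] {f : H → H} {s : Set H} (hs : IsOpen s) (hf : ContDiffOn ℝ ∞ f s)
    (hinj : InjOn f s) (hf' : ∀ a ∈ s, Function.Bijective (fderiv ℝ f a)) :
    ∃ Φ : OpenPartialHomeomorph H H, Φ.source = s ∧ (Φ : H → H) = f ∧
      ContDiffOn ℝ ∞ Φ.symm Φ.target := by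
  have hcd : ∀ a ∈ s, ContDiffAt ℝ ∞ f a := fun a ha => hf.contDiffAt (hs.mem_nhds ha)
  have hinv : ∀ a ∈ s, ∃ e : H ≃L[ℝ] H, HasFDerivAt f (e : H →L[ℝ] H) a := by
    intro a ha
    refine ⟨ContinuousLinearEquiv.ofBijective (fderiv ℝ f a)
      (LinearMap.ker_eq_bot.2 (hf' a ha).1) (LinearMap.range_eq_top.2 (hf' a ha).2), ?_⟩
    rw [ContinuousLinearEquiv.coe_ofBijective]
    exact ((hcd a ha).differentiableAt (by simp)).hasFDerivAt
  have hopen : IsOpenMap (s.domRestrict f) := by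
    rw [isOpenMap_iff_nhds_le]
    rintro ⟨a, ha⟩
    obtain ⟨e, he⟩ := hinv a ha
    have h1 : map f (𝓝 a) = 𝓝 (f a) :=
      ((hcd a ha).hasStrictFDerivAt' he (by simp)).map_nhds_eq_of_equiv
    have h2 : map (s.domRestrict f) (𝓝 ⟨a, ha⟩) = map f (𝓝 a) := by
      rw [← hs.nhdsWithin_eq ha, nhdsWithin_eq_map_subtype_coe ha, Filter.map_map]
      rfl
    rw [h2, h1]
    rfl
  set Φ := OpenPartialHomeomorph.ofContinuousOpenRestrict (hinj.toPartialEquiv f s)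
    hf.continuousOn hopen hs with hΦ
  refine ⟨Φ, rfl, rfl, fun y hy => ?_⟩
  have hmem : Φ.symm y ∈ s := Φ.map_target hy
  obtain ⟨e, he⟩ := hinv _ hmem
  exact (Φ.contDiffAt_symm hy he (hcd _ hmem)).contDiffWithinAt

/-- The derivative of `ι ∘ f` factors as `ι ∘ L`, and `L` is the derivative of `f` since `ι` does
not shrink norms. Composition with `ι` on `H →L[ℝ] G` is bounded below in the same way, so the
induction continues with `fderiv ℝ f`. -/
theorem contDiffOn_nat_of_comp_antilipschitz.{u} {H : Type u} [NormedAddCommGroup H]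
    [NormedSpace ℝ H] {s : Set H} (hs : IsOpen s) (m : ℕ) {G G' : Type u} [NormedAddCommGroup G]
    [NormedSpace ℝ G] [CompleteSpace G] [NormedAddCommGroup G'] [NormedSpace ℝ G']
    (ι : G →L[ℝ] G') (hι : ∀ x, ‖x‖ ≤ ‖ι x‖) {f : H → G}
    (hf : ContDiffOn ℝ m (fun x => ι (f x)) s) : ContDiffOn ℝ m f s := by
  have hanti : AntilipschitzWith 1 ι := by
    refine AddMonoidHomClass.antilipschitz_of_bound ι fun x => by simpa using hι x
  have hemb : IsClosedEmbedding ι := hanti.isClosedEmbedding ι.uniformContinuous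
  induction m generalizing G G' with
  | zero =>
    rw [Nat.cast_zero, contDiffOn_zero] at hf ⊢
    exact hemb.isInducing.continuousOn_iff.2 hf
  | succ m ih =>
    rw [Nat.cast_succ, contDiffOn_succ_iff_fderiv_of_isOpen hs] at hf ⊢
    obtain ⟨hd, -, hf'⟩ := hf
    have hlift : ∀ x ∈ s, ∃ L : H →L[ℝ] G, ι.comp L = fderiv ℝ (fun x => ι (f x)) x := by
      intro x hx
      have hda := (hd.differentiableAt (hs.mem_nhds hx)).hasFDerivAt
      -- Directional derivatives are limits of difference quotients, which lie in the closed range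
      -- of `ι`.
      have hr : ∀ v, fderiv ℝ (fun x => ι (f x)) x v ∈ LinearMap.range (ι : G →ₗ[ℝ] G') := by
        intro v
        have hl := hda.hasLineDerivAt v
        have hl' := hl.tendsto_slope_zero
        refine (hemb.isClosed_range).mem_of_tendsto hl' (Eventually.of_forall fun t => ?_)
        exact ⟨t⁻¹ • (f (x + t • v) - f (x + (0 : ℝ) • v)), by simp⟩
      let e : G ≃ₗ[ℝ] LinearMap.range (ι : G →ₗ[ℝ] G') :=
        LinearEquiv.ofInjective (ι : G →ₗ[ℝ] G') hemb.injective
      let L₀ : H →ₗ[ℝ] G := e.symm.toLinearMap.comp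
        (LinearMap.codRestrict _ (fderiv ℝ (fun x => ι (f x)) x : H →ₗ[ℝ] G') hr)
      have hL₀ : ∀ v, ι (L₀ v) = fderiv ℝ (fun x => ι (f x)) x v := by
        intro v
        have : (e (L₀ v) : G') = ι (L₀ v) := rfl
        rw [← this]
        simp [L₀]
      refine ⟨L₀.mkContinuous ‖fderiv ℝ (fun x => ι (f x)) x‖ fun v => ?_, ?_⟩
      · exact (hι _).trans (by rw [hL₀]; exact ContinuousLinearMap.le_opNorm _ _)
      · ext v; simpa using hL₀ v
    have hder : ∀ x ∈ s, ∃ L : H →L[ℝ] G, ι.comp L = fderiv ℝ (fun x => ι (f x)) x ∧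
        HasFDerivAt f L x := by
      intro x hx
      obtain ⟨L, hL⟩ := hlift x hx
      refine ⟨L, hL, ?_⟩
      have hda := (hd.differentiableAt (hs.mem_nhds hx)).hasFDerivAt
      rw [hasFDerivAt_iff_isLittleO] at hda ⊢
      refine (Asymptotics.isBigO_of_le _ fun y => ?_).trans_isLittleO hda
      rw [← hL]
      simpa using hι (f y - f x - L (y - x))
    refine ⟨fun x hx => ?_, by simp, ?_⟩
    · obtain ⟨L, -, h⟩ := hder x hx
      exact h.differentiableAt.differentiableWithinAt
    · have h1 : ContDiffOn ℝ m (fun x => (ContinuousLinearMap.compL ℝ H G G' ι) (fderiv ℝ f x)) s :=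
        hf'.congr fun x hx => by
          obtain ⟨L, hL, h⟩ := hder x hx
          rw [h.fderiv]
          exact hL
      have h2 : ∀ L : H →L[ℝ] G, ‖L‖ ≤ ‖ContinuousLinearMap.compL ℝ H G G' ι L‖ := fun L =>
        L.opNorm_le_bound (norm_nonneg _) fun v => (hι _).trans
          (((ContinuousLinearMap.compL ℝ H G G' ι) L).le_opNorm v)
      have hanti' : AntilipschitzWith 1 (ContinuousLinearMap.compL ℝ H G G' ι) :=
        AddMonoidHomClass.antilipschitz_of_bound _ fun x => by simpa using h2 x
      exact ih _ h2 h1 hanti' (hanti'.isClosedEmbedding (ContinuousLinearMap.uniformContinuous _))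

/-- A map into a Banach space is smooth if its composition with a bounded below linear map is. -/
theorem contDiffOn_of_comp_antilipschitz.{u} {H : Type u} [NormedAddCommGroup H]
    [NormedSpace ℝ H] {s : Set H} (hs : IsOpen s) {G G' : Type u} [NormedAddCommGroup G]
    [NormedSpace ℝ G] [CompleteSpace G] [NormedAddCommGroup G'] [NormedSpace ℝ G']
    (ι : G →L[ℝ] G') (hι : ∀ x, ‖x‖ ≤ ‖ι x‖) {f : H → G}
    (hf : ContDiffOn ℝ ∞ (fun x => ι (f x)) s) : ContDiffOn ℝ ∞ f s := by
  rw [contDiffOn_infty] at hf ⊢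
  exact fun m => contDiffOn_nat_of_comp_antilipschitz hs m ι hι (hf m)

end Banach

end Kuranishi

end

noncomputable section

namespace Kuranishi

open Set Filter Topology Metric unitInterval

/-! ### Weighted averages along rays -/

section Average

variable {ℓ : ℕ} {Y : Fin (ℓ + 1) → Type*} [∀ k, NormedAddCommGroup (Y k)]
  [∀ k, NormedSpace ℝ (Y k)]

/-- Multiplication of the `k`-th component by `τ ^ k`. -/
def weight (Y : Fin (ℓ + 1) → Type*) [∀ k, NormedAddCommGroup (Y k)] [∀ k, NormedSpace ℝ (Y k)]
    (τ : ℝ) : (∀ k, Y k) →L[ℝ] (∀ k, Y k) :=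
  ContinuousLinearMap.pi fun k => τ ^ (k : ℕ) • ContinuousLinearMap.proj k

@[simp]
theorem weight_apply (τ : ℝ) (y : ∀ k, Y k) (k : Fin (ℓ + 1)) :
    weight Y τ y k = τ ^ (k : ℕ) • y k := rfl

theorem norm_weight_apply_le {τ : ℝ} (hτ : τ ∈ I) (y : ∀ k, Y k) : ‖weight Y τ y‖ ≤ ‖y‖ := by
  refine (pi_norm_le_iff_of_nonneg (norm_nonneg _)).2 fun k => ?_
  rw [weight_apply, norm_smul, norm_pow, Real.norm_of_nonneg hτ.1]
  calc τ ^ (k : ℕ) * ‖y k‖ ≤ 1 * ‖y k‖ := by gcongr; exact pow_le_one₀ hτ.1 hτ.2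
    _ ≤ ‖y‖ := by rw [one_mul]; exact norm_le_pi_norm y k

/-- The extension of a map on `[0, 1]` to the real line by constants. -/
abbrev extend {X : Type*} [TopologicalSpace X] (w : C(I, X)) : ℝ → X :=
  IccExtend zero_le_one w

theorem continuous_extend {X : Type*} [TopologicalSpace X] (w : C(I, X)) :
    Continuous (extend w) := w.continuous.Icc_extend'

theorem extend_coe {X : Type*} [TopologicalSpace X] (w : C(I, X)) (t : I) :
    extend w t = w t := IccExtend_val _ _ _

theorem extend_mul {X : Type*} [TopologicalSpace X] (w : C(I, X)) {τ : ℝ} (hτ : τ ∈ I) (t : I) :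
    extend w (τ * t) = w (⟨τ, hτ⟩ * t) := extend_coe w (⟨τ, hτ⟩ * t)

theorem continuous_average_integrand (w : C(I, ∀ k, Y k)) :
    Continuous fun p : ℝ × ℝ => weight Y p.2 (extend w (p.2 * p.1)) := by
  have := continuous_extend w
  refine continuous_pi fun k => ?_
  simp only [weight_apply]
  fun_prop

theorem intervalIntegrable_average (w : C(I, ∀ k, Y k)) (t a b : ℝ) :
    IntervalIntegrable (fun τ => weight Y τ (extend w (τ * t))) MeasureTheory.volume a b :=
  ((continuous_average_integrand w).comp (Continuous.prodMk_right t)).intervalIntegrable _ _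

/-- The factor `1 / (m + 1)` is `∫₀¹ τ ^ m dτ`; repeated use of it produces the factorials in the
Volterra estimates. -/
theorem norm_average_le (w : C(I, ∀ k, Y k)) (t : I) {c : ℝ} {m : ℕ}
    (h : ∀ t : I, ‖w t‖ ≤ c * (t : ℝ) ^ m) :
    ‖∫ τ in (0 : ℝ)..1, weight Y τ (extend w (τ * t))‖ ≤ c * (t : ℝ) ^ m / (m + 1) := by
  have h1 : ∀ τ ∈ Set.Ioc (0 : ℝ) 1,
      ‖weight Y τ (extend w (τ * t))‖ ≤ c * (t : ℝ) ^ m * τ ^ m := by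
    intro τ hτ
    have hτ' : τ ∈ I := ⟨hτ.1.le, hτ.2⟩
    refine (norm_weight_apply_le hτ' _).trans ?_
    rw [extend_mul w hτ']
    refine (h _).trans (le_of_eq ?_)
    rw [Set.Icc.coe_mul, mul_pow]
    ring
  have h2 := intervalIntegral.norm_integral_le_of_norm_le zero_le_one
    (MeasureTheory.ae_of_all MeasureTheory.volume h1)
    (by apply Continuous.intervalIntegrable; fun_prop)
  refine h2.trans (le_of_eq ?_)
  rw [intervalIntegral.integral_const_mul, integral_pow]
  simp [div_eq_mul_inv]

/-- The operator `w ↦ (t ↦ ∫₀¹ τ ^ k w_k(τ t) dτ)_k`. -/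
def average (Y : Fin (ℓ + 1) → Type*) [∀ k, NormedAddCommGroup (Y k)] [∀ k, NormedSpace ℝ (Y k)] :
    C(I, ∀ k, Y k) →L[ℝ] C(I, ∀ k, Y k) :=
  LinearMap.mkContinuous
    { toFun := fun w => ⟨fun t : I => ∫ τ in (0 : ℝ)..1, weight Y τ (extend w (τ * t)), by
        have := intervalIntegral.continuous_parametric_intervalIntegral_of_continuous'
          (μ := MeasureTheory.volume) (f := fun t τ => weight Y τ (extend w (τ * t)))
          (continuous_average_integrand w) 0 1
        exact this.comp continuous_subtype_val⟩
      map_add' := fun w w' => by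
        ext1 t
        simp only [ContinuousMap.coe_mk, ContinuousMap.add_apply]
        rw [← intervalIntegral.integral_add (intervalIntegrable_average w _ _ _)
          (intervalIntegrable_average w' _ _ _)]
        simp [IccExtend]
      map_smul' := fun c w => by
        ext1 t
        simp only [ContinuousMap.coe_mk, ContinuousMap.smul_apply, RingHom.id_apply]
        rw [← intervalIntegral.integral_smul]
        simp [IccExtend] } 1 (fun w => by
    refine (ContinuousMap.norm_le _ (by positivity)).2 fun t => ?_
    have := norm_average_le w t (c := ‖w‖) (m := 0)
      (fun t => by simpa using w.norm_coe_le_norm t)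
    simpa using this)

theorem average_apply (w : C(I, ∀ k, Y k)) (t : I) :
    average Y w t = ∫ τ in (0 : ℝ)..1, weight Y τ (extend w (τ * t)) := rfl

theorem norm_average_apply_le (w : C(I, ∀ k, Y k)) (t : I) {c : ℝ} {m : ℕ}
    (h : ∀ t : I, ‖w t‖ ≤ c * (t : ℝ) ^ m) : ‖average Y w t‖ ≤ c * (t : ℝ) ^ m / (m + 1) :=
  norm_average_le w t h

/-- Averaging is compatible with passing to a shorter piece of the same ray. This makes the
solutions attached to the points of one ray fit together. -/
theorem average_comp_mul (w : C(I, ∀ k, Y k)) (s t : I) :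
    average Y (w.comp ⟨fun t => s * t, by fun_prop⟩) t = average Y w (s * t) := by
  rw [average_apply, average_apply]
  refine intervalIntegral.integral_congr fun τ hτ => ?_
  rw [uIcc_of_le zero_le_one] at hτ
  rw [extend_mul _ hτ, extend_mul _ hτ]
  simp [mul_left_comm]

variable [∀ k, CompleteSpace (Y k)]

theorem average_apply_apply (w : C(I, ∀ k, Y k)) (t : I) (k : Fin (ℓ + 1)) :
    average Y w t k = ∫ τ in (0 : ℝ)..1, τ ^ (k : ℕ) • extend w (τ * t) k := by
  rw [average_apply]
  exact ((ContinuousLinearMap.proj (R := ℝ) (φ := Y) k).intervalIntegral_comp_comm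
    (intervalIntegrable_average w t 0 1)).symm

/-- Substitute `r = τ t`: up to the factor `t ^ (k + 1)`, the average is an ordinary primitive. -/
theorem pow_smul_average (w : C(I, ∀ k, Y k)) (t : I) (k : Fin (ℓ + 1)) :
    (t : ℝ) ^ ((k : ℕ) + 1) • average Y w t k =
      ∫ r in (0 : ℝ)..t, r ^ (k : ℕ) • extend w r k := by
  have := intervalIntegral.smul_integral_comp_mul_right (a := 0) (b := 1)
    (fun r : ℝ => r ^ (k : ℕ) • extend w r k) (t : ℝ)
  rw [zero_mul, one_mul] at this
  rw [← this, average_apply_apply, pow_succ', mul_smul, ← intervalIntegral.integral_smul]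
  simp only [mul_pow, mul_smul]
  congr 2
  funext τ
  rw [smul_comm]

theorem average_zero_apply (w : C(I, ∀ k, Y k)) (k : Fin (ℓ + 1)) :
    average Y w 0 k = ((k : ℝ) + 1)⁻¹ • w 0 k := by
  rw [average_apply_apply]
  have : ∀ τ : ℝ, extend w (τ * (0 : I)) = w 0 := fun τ => by
    rw [Set.Icc.coe_zero, mul_zero]; exact extend_coe w 0
  simp only [this]
  rw [intervalIntegral.integral_smul_const, integral_pow]
  simp

/-- The average solves the Euler equation along the curve `s ↦ eˢ`. -/
theorem hasDerivWithinAt_average_exp (w : C(I, ∀ k, Y k)) (k : Fin (ℓ + 1)) {s : ℝ} (hs : s ≤ 0) :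
    HasDerivWithinAt (fun s => extend (average Y w) (Real.exp s) k)
      (-((k : ℝ) + 1) • extend (average Y w) (Real.exp s) k + extend w (Real.exp s) k)
      (Iic 0) s := by
  have hmem : ∀ s : ℝ, s ≤ 0 → Real.exp s ∈ I := fun s hs =>
    ⟨(Real.exp_pos s).le, Real.exp_le_one_iff.2 hs⟩
  -- The factor `e^{-(k+1)s}` undoes `t ^ (k + 1)` at `t = e^s`; differentiating it gives the linear
  -- term, and differentiating the primitive gives the inhomogeneous one.
  have heq : ∀ s : ℝ, s ≤ 0 → extend (average Y w) (Real.exp s) k =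
      Real.exp (-((k : ℝ) + 1) * s) • ∫ r in (0 : ℝ)..Real.exp s, r ^ (k : ℕ) • extend w r k := by
    intro s hs
    have := pow_smul_average w ⟨Real.exp s, hmem s hs⟩ k
    simp only at this
    rw [← this, smul_smul, ← Real.exp_nat_mul, ← Real.exp_add]
    have e : -((k : ℝ) + 1) * s + ((k : ℕ) + 1 : ℕ) * s = 0 := by push_cast; ring
    rw [e, Real.exp_zero, one_smul]
    exact congrFun (extend_coe (average Y w) ⟨Real.exp s, hmem s hs⟩) k
  have hc : Continuous fun r : ℝ => r ^ (k : ℕ) • extend w r k := by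
    have := continuous_extend w
    fun_prop
  have h1 : HasDerivAt (fun u : ℝ => ∫ r in (0 : ℝ)..u, r ^ (k : ℕ) • extend w r k)
      (Real.exp s ^ (k : ℕ) • extend w (Real.exp s) k) (Real.exp s) :=
    intervalIntegral.integral_hasDerivAt_right (hc.intervalIntegrable _ _)
      (hc.stronglyMeasurableAtFilter _ _) hc.continuousAt
  have h2 := h1.scomp s (Real.hasDerivAt_exp s)
  have h3 : HasDerivAt (fun s : ℝ => Real.exp (-((k : ℝ) + 1) * s))
      (Real.exp (-((k : ℝ) + 1) * s) * -((k : ℝ) + 1)) s := by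
    simpa using ((hasDerivAt_id s).const_mul (-((k : ℝ) + 1))).exp
  have h4 := (h3.smul h2).hasDerivWithinAt (s := Iic 0)
  refine (h4.congr (fun s hs => heq s hs) (heq s hs)).congr_deriv ?_
  rw [heq s hs, add_comm]
  congr 1
  · rw [smul_smul]
    congr 1
    ring
  · rw [smul_smul, smul_smul, ← Real.exp_nat_mul, ← Real.exp_add, ← Real.exp_add]
    have : -((k : ℝ) + 1) * s + s + (k : ℕ) * s = 0 := by ring
    rw [this, Real.exp_zero, one_smul]

/-- Bounded solutions of the Euler equation along a ray are averages. -/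
theorem eq_average_of_hasDerivAt (v w : C(I, ∀ k, Y k))
    (h : ∀ k : Fin (ℓ + 1), ∀ t ∈ Ioo (0 : ℝ) 1,
      HasDerivAt (fun t => t ^ ((k : ℕ) + 1) • extend v t k)
      (t ^ (k : ℕ) • extend w t k) t) : v = average Y w := by
  have hv := continuous_extend v
  have hw := continuous_extend w
  have hpos : ∀ t : I, 0 < t → v t = average Y w t := by
    intro t ht
    have ht' : (0 : ℝ) < t := ht
    funext k
    have hftc := intervalIntegral.integral_eq_sub_of_hasDeriv_right_of_le
      (f := fun t => t ^ ((k : ℕ) + 1) • extend v t k)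
      (f' := fun t => t ^ (k : ℕ) • extend w t k) ht'.le
      (Continuous.continuousOn (by fun_prop))
      (fun s hs => (h k s ⟨hs.1, hs.2.trans_le t.2.2⟩).hasDerivWithinAt)
      (Continuous.intervalIntegrable (by fun_prop) _ _)
    rw [← pow_smul_average] at hftc
    simp only [ne_eq, Nat.add_eq_zero_iff, one_ne_zero, and_false, not_false_eq_true, zero_pow,
      zero_smul, sub_zero, extend_coe] at hftc
    exact (smul_right_injective (Y k) (pow_pos ht' ((k : ℕ) + 1)).ne' hftc).symm
  -- The factor `t ^ (k + 1)` cancels only for `t > 0`; the value at `0` follows from continuity and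
  -- density.
  refine ContinuousMap.ext fun t => congrFun (Continuous.ext_on (s := Ioi (0 : I)) ?_
    v.continuous (average Y w).continuous fun t ht => hpos t ht) t
  rw [dense_iff_closure_eq, closure_Ioi' ⟨1, zero_lt_one⟩]
  exact eq_univ_of_forall fun t => t.2.1

end Average

/-! ### Volterra operators -/

section Volterra

variable {ℓ : ℕ} {Y : Fin (ℓ + 1) → Type*} [∀ k, NormedAddCommGroup (Y k)]
  [∀ k, NormedSpace ℝ (Y k)] {X : Type*} [NormedAddCommGroup X] [NormedSpace ℝ X]
  {E : Type*} [NormedAddCommGroup E] [NormedSpace ℝ E]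

/-- Pointwise application of a continuous family of operators. -/
abbrev applyC {K : Type*} [TopologicalSpace K] [CompactSpace K] {F G : Type*}
    [NormedAddCommGroup F] [NormedSpace ℝ F] [NormedAddCommGroup G] [NormedSpace ℝ G] :
    C(K, F →L[ℝ] G) →L[ℝ] C(K, F) →L[ℝ] C(K, G) :=
  pointwise K (.id ℝ (F →L[ℝ] G))

/-- The ray `t ↦ t x`. -/
def ray (E : Type*) [NormedAddCommGroup E] [NormedSpace ℝ E] : E →L[ℝ] C(I, E) :=
  (pointwise I (ContinuousLinearMap.lsmul ℝ ℝ) ⟨((↑) : I → ℝ), continuous_subtype_val⟩).comp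
    (ContinuousLinearMap.const ℝ I)

@[simp]
theorem ray_apply (x : E) (t : I) : ray E x t = (t : ℝ) • x := rfl

/-- The family of operators `t ↦ t J_x`. -/
def rayOp (J : E →L[ℝ] (∀ k, Y k) →L[ℝ] X) : E →L[ℝ] C(I, (∀ k, Y k) →L[ℝ] X) :=
  (ray _).comp J

@[simp]
theorem rayOp_apply (J : E →L[ℝ] (∀ k, Y k) →L[ℝ] X) (x : E) (t : I) :
    rayOp J x t = (t : ℝ) • J x := rfl

/-- One Volterra step raises the power of `t` by one and divides by `m + 1`. It is used with `H' =
H` for uniqueness, and with `H' = V ^ m H` to bound powers of the operator. -/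
theorem norm_le_pow_of_volterra (T : (∀ k, Y k) →L[ℝ] X) {L c : ℝ} (hL : 0 ≤ L) {m : ℕ}
    {H H' : C(I, X)} {w : C(I, ∀ k, Y k)} (hH : ∀ t, H t = (t : ℝ) • T (average Y w t))
    (hw : ∀ t, ‖w t‖ ≤ L * ‖H' t‖) (hH' : ∀ t : I, ‖H' t‖ ≤ c * (t : ℝ) ^ m) (t : I) :
    ‖H t‖ ≤ (‖T‖ * L) * c / (m + 1) * (t : ℝ) ^ (m + 1) := by
  have h1 := norm_average_apply_le w t (c := L * c) (m := m) (fun t => by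
    rw [mul_assoc]; exact (hw t).trans (by gcongr; exact hH' t))
  have ht : (0 : ℝ) ≤ t := t.2.1
  rw [hH, norm_smul, Real.norm_of_nonneg ht]
  calc (t : ℝ) * ‖T (average Y w t)‖ ≤ t * (‖T‖ * (L * c * (t : ℝ) ^ m / (m + 1))) := by
        gcongr; exact (T.le_opNorm _).trans (by gcongr)
    _ = _ := by rw [pow_succ]; ring

/-- Feeding the bound on `H` back into itself gives `(‖T‖ L)^m / m!` for every `m`. Only a pointwise
bound on `w` is required, so differences of nonlinear terms are covered. -/
theorem eq_zero_of_volterra (T : (∀ k, Y k) →L[ℝ] X) {L : ℝ} (hL : 0 ≤ L)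
    {H : C(I, X)} {w : C(I, ∀ k, Y k)} (hH : ∀ t, H t = (t : ℝ) • T (average Y w t))
    (hw : ∀ t, ‖w t‖ ≤ L * ‖H t‖) : H = 0 := by
  have key : ∀ m : ℕ, ∀ t : I, ‖H t‖ ≤ (‖T‖ * L) ^ m / m.factorial * ‖H‖ * (t : ℝ) ^ m := by
    intro m
    induction m with
    | zero => intro t; simpa using H.norm_coe_le_norm t
    | succ m ih =>
      intro t
      refine (norm_le_pow_of_volterra T hL hH hw ih t).trans (le_of_eq ?_)
      rw [Nat.factorial_succ, pow_succ (‖T‖ * L)]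
      push_cast
      field_simp
  ext1 t
  have hlim : Tendsto (fun m : ℕ => (‖T‖ * L) ^ m / m.factorial * ‖H‖) atTop (𝓝 (0 * ‖H‖)) :=
    (FloorSemiring.tendsto_pow_div_factorial_atTop (‖T‖ * L)).mul_const _
  rw [zero_mul] at hlim
  have : ‖H t‖ ≤ 0 := ge_of_tendsto' hlim fun m => (key m t).trans (by
    have : (t : ℝ) ^ m ≤ 1 := pow_le_one₀ t.2.1 t.2.2
    exact mul_le_of_le_one_right (by positivity) this)
  simpa using this

/-- The Volterra operator `H ↦ (t ↦ t J_x ∫₀¹ τ ^ k (M H)_k(τ t) dτ)`. -/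
def volterra (J : E →L[ℝ] (∀ k, Y k) →L[ℝ] X) (x : E) (M : C(I, X →L[ℝ] ∀ k, Y k)) :
    C(I, X) →L[ℝ] C(I, X) :=
  (applyC (rayOp J x)).comp ((average Y).comp (applyC M))

theorem volterra_apply (J : E →L[ℝ] (∀ k, Y k) →L[ℝ] X) (x : E) (M : C(I, X →L[ℝ] ∀ k, Y k))
    (H : C(I, X)) (t : I) :
    volterra J x M H t = (t : ℝ) • J x (average Y (applyC M H) t) := rfl

/-- The powers of `V` decay factorially, so `‖V ^ m‖ < 1` for some `m`. Then `1 - V ^ m` is a unit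
and is the product of `1 - V` with a geometric sum commuting with it, which makes `1 - V` a unit
without any smallness assumption. -/
theorem isUnit_one_sub_volterra [CompleteSpace X] (J : E →L[ℝ] (∀ k, Y k) →L[ℝ] X) (x : E)
    (M : C(I, X →L[ℝ] ∀ k, Y k)) : IsUnit (1 - volterra J x M) := by
  set V := volterra J x M with hV
  have key : ∀ m : ℕ, ∀ H : C(I, X), ∀ t : I,
      ‖(V ^ m) H t‖ ≤ (‖J x‖ * ‖M‖) ^ m / m.factorial * ‖H‖ * (t : ℝ) ^ m := by
    intro m
    induction m with
    | zero => intro H t; simpa using H.norm_coe_le_norm t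
    | succ m ih =>
      intro H t
      have h1 : ∀ t, (V ^ (m + 1)) H t = (t : ℝ) • J x (average Y (applyC M ((V ^ m) H)) t) := by
        intro t
        rw [pow_succ']
        exact volterra_apply J x M _ t
      refine (norm_le_pow_of_volterra (J x) (norm_nonneg M) h1 (fun t => ?_)
        (ih H) t).trans (le_of_eq ?_)
      · exact ((M t).le_opNorm _).trans (by gcongr; exact M.norm_coe_le_norm t)
      · rw [Nat.factorial_succ, pow_succ (‖J x‖ * ‖M‖)]
        push_cast
        field_simp
  have hnorm : ∀ m : ℕ, ‖V ^ m‖ ≤ (‖J x‖ * ‖M‖) ^ m / m.factorial := by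
    intro m
    refine ContinuousLinearMap.opNorm_le_bound _ (by positivity) fun H => ?_
    refine (ContinuousMap.norm_le _ (by positivity)).2 fun t => (key m H t).trans ?_
    have : (t : ℝ) ^ m ≤ 1 := pow_le_one₀ t.2.1 t.2.2
    exact mul_le_of_le_one_right (by positivity) this
  obtain ⟨m, hm⟩ := ((FloorSemiring.tendsto_pow_div_factorial_atTop
    (‖J x‖ * ‖M‖)).eventually (gt_mem_nhds zero_lt_one)).exists
  have hu : IsUnit (1 - V ^ m) :=
    isUnit_one_sub_of_norm_lt_one (R := C(I, X) →L[ℝ] C(I, X)) ((hnorm m).trans_lt hm)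
  rw [← mul_neg_geom_sum V m] at hu
  have hcomm : Commute (1 - V) (∑ i ∈ Finset.range m, V ^ i) :=
    Commute.sum_right _ _ _ fun i _ => ((Commute.one_left V).sub_left (Commute.refl V)).pow_right i
  exact (hcomm.isUnit_mul_iff.1 hu).1

theorem volterra_eq_zero [CompleteSpace X] (J : E →L[ℝ] (∀ k, Y k) →L[ℝ] X) (x : E)
    (M : C(I, X →L[ℝ] ∀ k, Y k)) {H : C(I, X)} (h : H = volterra J x M H) : H = 0 :=
  eq_zero_of_volterra (J x) (norm_nonneg M) (w := applyC M H)
    (fun t => by conv_lhs => rw [h, volterra_apply])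
    (fun t => ((M t).le_opNorm _).trans (by gcongr; exact M.norm_coe_le_norm t))

end Volterra

end Kuranishi

end

noncomputable section

namespace Kuranishi

open Set Filter Topology Metric unitInterval

/-! ### The equation along rays -/

section Rays

universe u

variable {ℓ : ℕ} {Y : Fin (ℓ + 1) → Type u} [∀ k, NormedAddCommGroup (Y k)]
  [∀ k, NormedSpace ℝ (Y k)] {X : Type u} [NormedAddCommGroup X] [NormedSpace ℝ X]
  {E : Type} [NormedAddCommGroup E] [NormedSpace ℝ E]

/-- `A` solves `A(t) = B(t x) + t J_x ∫₀¹ τ ^ k f_k(A(τ t)) dτ`, with values in `D`. -/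
structure RaySol (J : E →L[ℝ] (∀ k, Y k) →L[ℝ] X) (f : X → ∀ k, Y k) (D : Set X) (B : E → X)
    (x : E) (A : C(I, X)) : Prop where
  mem : ∀ t, A t ∈ D
  eqn : ∀ t : I, A t = B ((t : ℝ) • x) + (t : ℝ) • J x (average Y (nem f A) t)

variable {J : E →L[ℝ] (∀ k, Y k) →L[ℝ] X} {f : X → ∀ k, Y k} {D : Set X} {B : E → X}

/-- `f` is locally Lipschitz on `D`; compactness of the two ranges gives one constant, although `D`
need not be convex. -/
theorem exists_lipschitz_bound (hD : IsOpen D) (hf : ContDiffOn ℝ ∞ f D) {A A' : C(I, X)}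
    (hA : ∀ t, A t ∈ D) (hA' : ∀ t, A' t ∈ D) :
    ∃ L : ℝ, 0 ≤ L ∧ ∀ t, ‖f (A t) - f (A' t)‖ ≤ L * ‖A t - A' t‖ := by
  have hloc : LocallyLipschitzOn (range A ∪ range A') f := by
    rintro x hx
    have hxD : x ∈ D := by
      rcases hx with ⟨t, rfl⟩ | ⟨t, rfl⟩
      exacts [hA t, hA' t]
    obtain ⟨K, t, ht, h⟩ := ((hf.contDiffAt (hD.mem_nhds hxD)).of_le
      (show (1 : WithTop ℕ∞) ≤ ∞ by simp)).exists_lipschitzOnWith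
    exact ⟨K, t, nhdsWithin_le_nhds ht, h⟩
  obtain ⟨L, hL⟩ := hloc.exists_lipschitzOnWith_of_compact
    ((isCompact_range A.continuous).union (isCompact_range A'.continuous))
  exact ⟨L, L.2, fun t => hL.norm_sub_le (Or.inl (mem_range_self t)) (Or.inr (mem_range_self t))⟩

/-- The difference of the two curves satisfies a Volterra inequality. This one statement serves the
uniqueness of ray solutions, the injectivity of `rayChart` and the injectivity of `κ`. -/
theorem eq_of_volterra_eq (hD : IsOpen D) (hf : ContDiffOn ℝ ∞ f D) {A A' : C(I, X)}
    (hA : ∀ t, A t ∈ D) (hA' : ∀ t, A' t ∈ D) (T : (∀ k, Y k) →L[ℝ] X)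
    (h : ∀ t : I, A t - (t : ℝ) • T (average Y (nem f A) t) =
      A' t - (t : ℝ) • T (average Y (nem f A') t)) : A = A' := by
  obtain ⟨L, hL, hLip⟩ := exists_lipschitz_bound hD hf hA hA'
  rw [← sub_eq_zero]
  refine eq_zero_of_volterra T hL (w := nem f A - nem f A') (fun t => ?_) (fun t => ?_)
  · rw [map_sub, ContinuousMap.sub_apply, ContinuousMap.sub_apply, map_sub, smul_sub,
      sub_eq_sub_iff_sub_eq_sub.1 (h t)]
  · simpa [nem_apply hf.continuousOn hA, nem_apply hf.continuousOn hA'] using hLip t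

theorem RaySol.unique (hD : IsOpen D) (hf : ContDiffOn ℝ ∞ f D) {x : E} {A A' : C(I, X)}
    (hA : RaySol J f D B x A) (hA' : RaySol J f D B x A') : A = A' :=
  eq_of_volterra_eq hD hf hA.mem hA'.mem (J x) fun t => by
    conv_lhs => rw [hA.eqn t]
    conv_rhs => rw [hA'.eqn t]
    simp

/-- Multiplication by `s` on `[0, 1]`. -/
def mulI (s : I) : C(I, I) := ⟨fun t => s * t, by fun_prop⟩

@[simp]
theorem mulI_apply (s t : I) : mulI s t = s * t := rfl

theorem nem_comp_mulI (hf : ContinuousOn f D) {A : C(I, X)} (hA : ∀ t, A t ∈ D) (s : I) :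
    nem f (A.comp (mulI s)) = (nem f A).comp (mulI s) := by
  ext1 t
  rw [nem_apply hf (A := A.comp (mulI s)) (fun t => hA _), ContinuousMap.comp_apply,
    ContinuousMap.comp_apply, nem_apply hf hA]

/-- Every initial piece of a ray solution is a ray solution; hence the set of solvable points is
star-shaped. -/
theorem RaySol.scale (hf : ContinuousOn f D) {x : E} {A : C(I, X)} (hA : RaySol J f D B x A)
    (s : I) : RaySol J f D B ((s : ℝ) • x) (A.comp (mulI s)) where
  mem t := hA.mem _
  eqn t := by
    have h1 : average Y (nem f (A.comp (mulI s))) t = average Y (nem f A) (s * t) := by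
      rw [nem_comp_mulI hf hA.mem]
      exact average_comp_mul _ s t
    rw [ContinuousMap.comp_apply, mulI_apply, hA.eqn, h1]
    simp only [Set.Icc.coe_mul, map_smul, _root_.smul_apply, smul_smul]
    rw [mul_comm (s : ℝ)]

theorem RaySol.at_zero (hB : B 0 ∈ D) : RaySol J f D B 0 (ContinuousMap.const I (B 0)) where
  mem _ := hB
  eqn t := by simp

/-- The operators `A ↦ (t ↦ t J_x A(t))`. -/
def rayApply (J : E →L[ℝ] (∀ k, Y k) →L[ℝ] X) : E →L[ℝ] C(I, ∀ k, Y k) →L[ℝ] C(I, X) :=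
  applyC.comp (rayOp J)

theorem hasFDerivAt_rayApply (J : E →L[ℝ] (∀ k, Y k) →L[ℝ] X) (x : E) :
    HasFDerivAt (fun x => applyC (rayOp J x)) (rayApply J) x :=
  ContinuousLinearMap.hasFDerivAt (F := C(I, ∀ k, Y k) →L[ℝ] C(I, X)) (rayApply J)

theorem contDiff_rayApply (J : E →L[ℝ] (∀ k, Y k) →L[ℝ] X) {m : WithTop ℕ∞} :
    ContDiff ℝ m fun x => applyC (rayOp J x) := by
  have h := ContinuousLinearMap.contDiff (𝕜 := ℝ) (E := E)
    (F := C(I, ∀ k, Y k) →L[ℝ] C(I, X)) (n := m) (rayApply J)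
  exact h

theorem contDiff_applyC {K : Type*} [TopologicalSpace K] [CompactSpace K] {F G : Type*}
    [NormedAddCommGroup F] [NormedSpace ℝ F] [NormedAddCommGroup G] [NormedSpace ℝ G]
    {m : WithTop ℕ∞} : ContDiff ℝ m fun M : C(K, F →L[ℝ] G) => applyC M := by
  have h := ContinuousLinearMap.contDiff (𝕜 := ℝ) (E := C(K, F →L[ℝ] G))
    (F := C(K, F) →L[ℝ] C(K, G))
    (n := m) applyC
  exact h

theorem contDiff_eval {K : Type*} [TopologicalSpace K] [CompactSpace K] (t : K)
    {m : WithTop ℕ∞} : ContDiff ℝ m fun A : C(K, X) => A t :=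
  (ContinuousMap.evalCLM ℝ t : C(K, X) →L[ℝ] X).contDiff

/-- The map `(x, A) ↦ (x, A - t J_x ∫₀¹ τ ^ k f_k(A(τ t)) dτ)`. -/
def rayChart (J : E →L[ℝ] (∀ k, Y k) →L[ℝ] X) (f : X → ∀ k, Y k) (p : E × C(I, X)) :
    E × C(I, X) :=
  (p.1, p.2 - applyC (rayOp J p.1) (average Y (nem f p.2)))

theorem isOpen_setOf_mem {K : Type*} [TopologicalSpace K] [CompactSpace K] (hD : IsOpen D) :
    IsOpen {A : C(K, X) | ∀ t, A t ∈ D} := by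
  have := ContinuousMap.isOpen_setOfPred_mapsTo (X := K) isCompact_univ hD
  simpa [MapsTo] using this

theorem hasFDerivAt_nem {K : Type*} [TopologicalSpace K] [CompactSpace K] (hD : IsOpen D)
    (hf : ContDiffOn ℝ ∞ f D) {A : C(K, X)} (hA : ∀ t, A t ∈ D) :
    HasFDerivAt (nem f : C(K, X) → C(K, ∀ k, Y k)) (applyC (nem (fderiv ℝ f) A)) A :=
  (hasFDerivWithinAt_nem (IsOpen.locallyQuasiconvex hD)
    (fun x hx => ((hf.differentiableOn (by simp)).differentiableAt
      (hD.mem_nhds hx)).hasFDerivAt.hasFDerivWithinAt)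
    (hf.continuousOn_fderiv_of_isOpen hD (by simp)) hA).hasFDerivAt
    ((isOpen_setOf_mem hD).mem_nhds hA)

theorem contDiffOn_nem_of_isOpen {K : Type*} [TopologicalSpace K] [CompactSpace K] (hD : IsOpen D)
    (hf : ContDiffOn ℝ ∞ f D) :
    ContDiffOn ℝ ∞ (nem f : C(K, X) → C(K, ∀ k, Y k)) {A | ∀ t, A t ∈ D} :=
  contDiffOn_nem.{u, u} (ρ := ⊤) (IsOpen.locallyQuasiconvex hD) hD.uniqueDiffOn hf

variable {N : Set E}

theorem ray_mem (hstar : StarConvex ℝ 0 N) {x : E} (hx : x ∈ N) (t : I) : ray E x t ∈ N :=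
  hstar.smul_mem hx t.2.1 t.2.2

variable [CompleteSpace X]

/-- The base point is kept as a variable, so that a single application of the inverse function
theorem yields openness of the solvable set and smooth dependence of the solution on `x`. -/
theorem exists_rayChart [CompleteSpace E] (J : E →L[ℝ] (∀ k, Y k) →L[ℝ] X) (hD : IsOpen D)
    (hf : ContDiffOn ℝ ∞ f D) :
    ∃ Φ : OpenPartialHomeomorph (E × C(I, X)) (E × C(I, X)), Φ.source = {p | ∀ t, p.2 t ∈ D} ∧
      (Φ : E × C(I, X) → E × C(I, X)) = rayChart J f ∧ ContDiffOn ℝ ∞ Φ.symm Φ.target := by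
  have hs : IsOpen {p : E × C(I, X) | ∀ t, p.2 t ∈ D} :=
    (isOpen_setOf_mem hD).preimage continuous_snd
  refine exists_openPartialHomeomorph hs ?_ ?_ ?_
  · have h1 : ContDiffOn ℝ ∞ (fun p : E × C(I, X) => nem f p.2) {p | ∀ t, p.2 t ∈ D} :=
      (contDiffOn_nem_of_isOpen hD hf).comp contDiffOn_snd fun p hp => hp
    have h2 : ContDiffOn ℝ ∞ (fun p : E × C(I, X) => applyC (rayOp J p.1)
        (average Y (nem f p.2))) {p | ∀ t, p.2 t ∈ D} := by
      refine ContDiffOn.clm_apply ?_ ((average Y).contDiff.comp_contDiffOn h1)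
      exact ((contDiff_rayApply J).comp contDiff_fst).contDiffOn
    exact contDiffOn_fst.prodMk (contDiffOn_snd.sub h2)
  · rintro ⟨x, A⟩ hA ⟨x', A'⟩ hA' h
    obtain ⟨rfl, h⟩ := Prod.mk.inj h
    rw [Prod.mk.injEq]
    refine ⟨rfl, eq_of_volterra_eq hD hf hA hA' (J x) fun t => ?_⟩
    exact DFunLike.congr_fun h t
  · rintro ⟨x, A⟩ hA
    set M := nem (fderiv ℝ f) A
    have h1 : HasFDerivAt (fun p : E × C(I, X) => average Y (nem f p.2))
        ((average Y).comp ((applyC M).comp (.snd ℝ E C(I, X)))) (x, A) :=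
      (average Y).hasFDerivAt.comp (x, A)
        ((hasFDerivAt_nem hD hf hA).comp (x, A) hasFDerivAt_snd)
    have h2 : HasFDerivAt (fun p : E × C(I, X) => applyC (rayOp J p.1))
        ((rayApply J).comp (.fst ℝ E C(I, X))) (x, A) :=
      HasFDerivAt.comp (𝕜 := ℝ) (E := E × C(I, X)) (F := E)
        (G := C(I, ∀ k, Y k) →L[ℝ] C(I, X)) (f := Prod.fst) (f' := .fst ℝ E C(I, X)) (x, A)
        (hasFDerivAt_rayApply J x) hasFDerivAt_fst
    have h3 : HasFDerivAt (rayChart J f) _ (x, A) :=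
      hasFDerivAt_fst.prodMk (hasFDerivAt_snd.sub (h2.clm_apply h1))
    rw [h3.fderiv]
    obtain ⟨e, he⟩ := isUnit_one_sub_volterra J x M
    -- The derivative is triangular: the identity on the base, and `1 - volterra J x M` with `M = f'
    -- ∘ A` on curves.
    have hval : ∀ v : E × C(I, X), ((ContinuousLinearMap.fst ℝ E C(I, X)).prod
        (ContinuousLinearMap.snd ℝ E C(I, X) - ((applyC (rayOp J (x, A).1)).comp
          ((average Y).comp ((applyC M).comp (.snd ℝ E C(I, X)))) +
          ((rayApply J).comp (.fst ℝ E C(I, X))).flip (average Y (nem f (x, A).2))))) v =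
        (v.1, (1 - volterra J x M) v.2 - applyC (rayOp J v.1) (average Y (nem f A))) := by
      intro v
      simp [volterra, rayApply, sub_sub]
    constructor
    · rw [injective_iff_map_eq_zero]
      rintro ⟨ξ, H⟩ h
      rw [hval] at h
      obtain ⟨rfl, h⟩ := Prod.mk.inj h
      rw [map_zero, map_zero, _root_.zero_apply, sub_zero] at h
      have : H = volterra J x M H := by
        simpa [sub_eq_zero] using h
      rw [volterra_eq_zero J x M this]
      rfl
    · rintro ⟨η, K⟩
      refine ⟨(η, (↑e⁻¹ : C(I, X) →L[ℝ] C(I, X))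
        (K + applyC (rayOp J η) (average Y (nem f A)))), ?_⟩
      rw [hval, ← he]
      have : ∀ K, (e : C(I, X) →L[ℝ] C(I, X)) ((↑e⁻¹ : C(I, X) →L[ℝ] C(I, X)) K) = K := fun K => by
        rw [← mul_apply_eq_comp, Units.mul_inv]; rfl
      simp [this]

/-- Superposition with `B`, taken on curves in `N`, is composed with the linear map `x ↦ ray_x`.
Curves in `N` form a set that need not be open, which is why superposition was treated on
quasiconvex sets. -/
theorem contDiffOn_ray {Z : Type u} [NormedAddCommGroup Z] [NormedSpace ℝ Z] {B : E → Z}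
    (hq : LocallyQuasiconvex N) (hu : UniqueDiffOn ℝ N) (hstar : StarConvex ℝ 0 N)
    {ρ : ℕ∞} (hB : ContDiffOn ℝ ρ B N) : ContDiffOn ℝ ρ (fun x => nem B (ray E x)) N :=
  (contDiffOn_nem.{u, 0} hq hu hB).comp (ray E).contDiff.contDiffOn
    fun _ hx t => ray_mem hstar hx t

/-- `A` solves the ray equation at `x` exactly when `rayChart` sends `(x, A)` to `(x, B ∘ ray_x)`.
Solvability is thus membership of the latter in the open target, and the solution is read off from
the inverse chart. -/
theorem exists_raySol [CompleteSpace E] (hD : IsOpen D) (hf : ContDiffOn ℝ ∞ f D)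
    (hq : LocallyQuasiconvex N) (hu : UniqueDiffOn ℝ N) (hstar : StarConvex ℝ 0 N)
    {ρ : ℕ∞} (hB : ContDiffOn ℝ ρ B N) :
    ∃ V : E → C(I, X), (∃ O, IsOpen O ∧ {x ∈ N | ∃ A, RaySol J f D B x A} = N ∩ O) ∧
      ContDiffOn ℝ ρ V {x ∈ N | ∃ A, RaySol J f D B x A} ∧
      ∀ x ∈ N, (∃ A, RaySol J f D B x A) → RaySol J f D B x (V x) := by
  obtain ⟨Φ, hsrc, hΦ, hsymm⟩ := exists_rayChart J hD hf
  set g : E → E × C(I, X) := fun x => (x, nem B (ray E x)) with hg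
  have hgc : ContDiffOn ℝ ρ g N := contDiffOn_id.prodMk (contDiffOn_ray hq hu hstar hB)
  have hnem : ∀ x ∈ N, ∀ t : I, nem B (ray E x) t = B ((t : ℝ) • x) := fun x hx t =>
    nem_apply hB.continuousOn (ray_mem hstar hx) t
  have hiff : ∀ x ∈ N, ∀ A, RaySol J f D B x A ↔ (x, A) ∈ Φ.source ∧ Φ (x, A) = g x := by
    intro x hx A
    rw [hsrc, hΦ, hg, rayChart]
    simp only [mem_ofPred_eq, Prod.mk.injEq, true_and]
    refine ⟨fun h => ⟨h.mem, ?_⟩, fun h => ⟨h.1, fun t => ?_⟩⟩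
    · ext1 t
      rw [hnem x hx, ContinuousMap.sub_apply, h.eqn t]
      simp
    · rw [← hnem x hx, ← h.2]
      simp
  have hset : {x ∈ N | ∃ A, RaySol J f D B x A} = N ∩ g ⁻¹' Φ.target := by
    ext x
    refine and_congr_right fun hx => ⟨fun ⟨A, hA⟩ => ?_, fun h => ⟨(Φ.symm (g x)).2, ?_⟩⟩
    · obtain ⟨h1, h2⟩ := (hiff x hx A).1 hA
      rw [mem_preimage, ← h2]
      exact Φ.map_source h1
    · have h1 := Φ.map_target h
      have h2 := Φ.right_inv h
      have h3 : (Φ.symm (g x)).1 = x := by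
        have := congrArg Prod.fst h2
        rw [hΦ] at this
        exact this
      have h4 : (x, (Φ.symm (g x)).2) = Φ.symm (g x) := Prod.ext h3.symm rfl
      rw [hiff x hx, h4]
      exact ⟨h1, h2⟩
  refine ⟨fun x => (Φ.symm (g x)).2, ?_, ?_, ?_⟩
  · obtain ⟨O, hO, h⟩ := continuousOn_iff'.1 hgc.continuousOn _ Φ.open_target
    exact ⟨O, hO, by rw [hset, inter_comm, h, inter_comm]⟩
  · rw [hset]
    exact contDiff_snd.comp_contDiffOn ((hsymm.of_le (by exact_mod_cast le_top)).comp
      (hgc.mono inter_subset_left) fun x hx => hx.2)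
  · rintro x hx ⟨A, hA⟩
    obtain ⟨h1, h2⟩ := (hiff x hx A).1 hA
    simp only
    rwa [← h2, Φ.left_inv h1]

/-- On each ray the solution is `S_x = (1 - V_x)⁻¹ (K ∘ ray_x)`, which is `C^ρ` in `x` because
inversion of operators is smooth. By uniqueness `S_{s x}(t) = S_x(s t)`, so `x ↦ S_x(1)` restricts
to `S_x` on the ray. This provides surjectivity of the derivative of `κ`. -/
theorem exists_linear_solution (J : E →L[ℝ] (∀ k, Y k) →L[ℝ] X) (hq : LocallyQuasiconvex N)
    (hu : UniqueDiffOn ℝ N) (hstar : StarConvex ℝ 0 N) {ρ : ℕ∞} {M : E → X →L[ℝ] ∀ k, Y k}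
    (hM : ContDiffOn ℝ ρ M N) {K : E → X} (hK : ContDiffOn ℝ ρ K N) :
    ∃ H : E → X, ContDiffOn ℝ ρ H N ∧ ∀ x ∈ N, H x =
      K x + J x (average Y (nem (fun y => M y (H y)) (ray E x)) 1) := by
  set S : E → C(I, X) := fun x =>
    Ring.inverse (1 - volterra J x (nem M (ray E x))) (nem K (ray E x)) with hS
  have hSc : ContDiffOn ℝ ρ S N := by
    have h1 : ContDiffOn ℝ ρ (fun x => 1 - volterra J x (nem M (ray E x))) N := by
      refine contDiffOn_const.sub (ContDiffOn.clm_comp ?_ (contDiffOn_const.clm_comp ?_))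
      · exact (contDiff_rayApply J).contDiffOn
      · exact contDiff_applyC.comp_contDiffOn (contDiffOn_ray hq hu hstar hM)
    have h2 : ContDiffOn ℝ ρ (fun x => Ring.inverse (1 - volterra J x (nem M (ray E x)))) N := by
      intro x hx
      obtain ⟨e, he⟩ := isUnit_one_sub_volterra J x (nem M (ray E x))
      have h3 := contDiffAt_ringInverse ℝ (R := C(I, X) →L[ℝ] C(I, X)) (n := ρ) e
      rw [he] at h3
      exact h3.comp_contDiffWithinAt x (h1 x hx)
    exact h2.clm_apply (contDiffOn_ray hq hu hstar hK)
  have hSeq : ∀ x ∈ N, ∀ t : I, S x t = K ((t : ℝ) • x) +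
      (t : ℝ) • J x (average Y (applyC (nem M (ray E x)) (S x)) t) := by
    intro x hx t
    have h1 : (1 - volterra J x (nem M (ray E x))) (S x) = nem K (ray E x) := by
      rw [hS, ← mul_apply_eq_comp,
        Ring.mul_inverse_cancel _ (isUnit_one_sub_volterra J x _)]
      rfl
    have h2 := DFunLike.congr_fun h1 t
    rw [nem_apply hK.continuousOn (ray_mem hstar hx)] at h2
    rw [← volterra_apply, ← sub_eq_iff_eq_add]
    exact h2
  have hScale : ∀ x ∈ N, ∀ s : I, S ((s : ℝ) • x) 1 = S x s := by
    intro x hx s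
    have hsx : (s : ℝ) • x ∈ N := ray_mem hstar hx s
    set M' := nem M (ray E ((s : ℝ) • x))
    have h1 : applyC M' ((S x).comp (mulI s)) = (applyC (nem M (ray E x)) (S x)).comp (mulI s) := by
      ext1 t
      simp only [pointwise_apply, M', nem_apply hM.continuousOn (ray_mem hstar hsx),
        ContinuousMap.comp_apply, nem_apply hM.continuousOn (ray_mem hstar hx)]
      simp [smul_smul]
    have h2 : S ((s : ℝ) • x) - (S x).comp (mulI s) = 0 := by
      refine volterra_eq_zero J ((s : ℝ) • x) M' ?_
      ext1 t
      rw [map_sub, ContinuousMap.sub_apply, ContinuousMap.sub_apply, hSeq _ hsx, volterra_apply,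
        volterra_apply, h1, ContinuousMap.comp_apply, hSeq x hx]
      have h3 : average Y ((applyC (nem M (ray E x)) (S x)).comp (mulI s)) t =
        average Y (applyC (nem M (ray E x)) (S x)) (s * t) := average_comp_mul _ s t
      rw [h3]
      have hJ : ∀ y, J ((s : ℝ) • x) y = (s : ℝ) • J x y := fun y => by simp
      simp only [mulI_apply, Set.Icc.coe_mul, hJ, smul_smul]
      rw [mul_comm (s : ℝ), add_sub_add_left_eq_sub]
    have h4 := DFunLike.congr_fun (sub_eq_zero.1 h2) 1
    simpa using h4
  have hH : ContDiffOn ℝ ρ (fun x => S x 1) N :=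
    (contDiff_eval 1).comp_contDiffOn hSc
  refine ⟨fun x => S x 1, hH, fun x hx => ?_⟩
  have h1 : nem (fun y => M y (S y 1)) (ray E x) = applyC (nem M (ray E x)) (S x) := by
    ext1 t
    rw [nem_apply (hM.clm_apply hH).continuousOn (ray_mem hstar hx), pointwise_apply,
      nem_apply hM.continuousOn (ray_mem hstar hx)]
    simp only [ray_apply, hScale x hx t]
    rfl
  simp only
  rw [h1, hSeq x hx]
  simp

theorem linear_solution_unique (J : E →L[ℝ] (∀ k, Y k) →L[ℝ] X) (hstar : StarConvex ℝ 0 N)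
    {M : E → X →L[ℝ] ∀ k, Y k} (hM : ContinuousOn M N) {H : E → X} (hH : ContinuousOn H N)
    (h : ∀ x ∈ N, H x = J x (average Y (nem (fun y => M y (H y)) (ray E x)) 1)) :
    ∀ x ∈ N, H x = 0 := by
  intro x hx
  have h1 : nem H (ray E x) = volterra J x (nem M (ray E x)) (nem H (ray E x)) := by
    ext1 t
    have htx := ray_mem hstar hx t
    have h2 : nem (fun y => M y (H y)) (ray E (ray E x t)) =
        (applyC (nem M (ray E x)) (nem H (ray E x))).comp (mulI t) := by
      ext1 s
      rw [nem_apply (hM.clm_apply hH) (ray_mem hstar htx), ContinuousMap.comp_apply,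
        pointwise_apply, nem_apply hM (ray_mem hstar hx), nem_apply hH (ray_mem hstar hx)]
      simp [smul_smul]
    rw [nem_apply hH (ray_mem hstar hx), h _ htx, volterra_apply, h2]
    have h3 : average Y ((applyC (nem M (ray E x)) (nem H (ray E x))).comp (mulI t)) 1 =
      average Y (applyC (nem M (ray E x)) (nem H (ray E x))) (t * 1) := average_comp_mul _ t 1
    rw [h3]
    simp
  have h4 := DFunLike.congr_fun (volterra_eq_zero J x _ h1) 1
  rw [nem_apply hH (ray_mem hstar hx)] at h4
  simpa using h4

end Rays

end Kuranishi

end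

noncomputable section

namespace Kuranishi

open Set Filter Topology Metric unitInterval

/-! ### The greatest solution of the Euler equation -/

section Euler

universe u

variable {ℓ : ℕ} {Y : Fin (ℓ + 1) → Type u} [∀ k, NormedAddCommGroup (Y k)]
  [∀ k, NormedSpace ℝ (Y k)] {X : Type u} [NormedAddCommGroup X] [NormedSpace ℝ X]
  {E : Type} [NormedAddCommGroup E] [NormedSpace ℝ E]
  {J : E →L[ℝ] (∀ k, Y k) →L[ℝ] X} {f : X → ∀ k, Y k} {D : Set X} {B : E → X} {N : Set E}

/-- The right hand side of the Euler equation. -/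
def eulerField (J : E →L[ℝ] (∀ k, Y k) →L[ℝ] X) (f : X → ∀ k, Y k) (B : E → X) (x : E)
    (y : ∀ k, Y k) : ∀ k, Y k :=
  (fun k : Fin (ℓ + 1) => -((k : ℝ) + 1) • y k) + f (B x + J x y)

/-- The equation `t v' = -(k+1) v_k + f_k` is `(t^{k+1} v_k)' = t^k f_k`. It is imposed on the open
interval only; continuity of `v` on `[0, 1]` selects the solution that is regular at `0`. -/
theorem raySol_of_hasDerivAt [∀ k, CompleteSpace (Y k)] (hf : ContinuousOn f D)
    (hstar : StarConvex ℝ 0 N) (hB : ContinuousOn B N) {x : E} (hx : x ∈ N)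
    (v : C(I, ∀ k, Y k)) (hmem : ∀ t : I, B ((t : ℝ) • x) + (t : ℝ) • J x (v t) ∈ D)
    (hv : ∀ t ∈ Ioo (0 : ℝ) 1, ∃ d, HasDerivAt (extend v) d t ∧
      t • d = eulerField J f B (t • x) (extend v t)) :
    ∃ A, RaySol J f D B x A ∧ v = average Y (nem f A) ∧
      ∀ t : I, A t = B ((t : ℝ) • x) + (t : ℝ) • J x (v t) := by
  have hA : ∀ t : I, (nem B (ray E x) + rayApply J x v) t =
      B ((t : ℝ) • x) + (t : ℝ) • J x (v t) := by
    intro t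
    rw [ContinuousMap.add_apply, nem_apply hB (ray_mem hstar hx)]
    rfl
  have hAD : ∀ t : I, (nem B (ray E x) + rayApply J x v) t ∈ D := fun t => by
    rw [hA]; exact hmem t
  have hav : v = average Y (nem f (nem B (ray E x) + rayApply J x v)) := by
    refine eq_average_of_hasDerivAt v _ fun k t ht => ?_
    obtain ⟨d, hd, he⟩ := hv t ht
    have h1 : HasDerivAt (fun t => extend v t k) (d k) t := hasDerivAt_pi.1 hd k
    have h2 := (hasDerivAt_pow ((k : ℕ) + 1) t).smul h1
    refine h2.congr_deriv ?_
    have h3 : extend (nem f (nem B (ray E x) + rayApply J x v)) t k =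
        f (B (t • x) + J (t • x) (extend v t)) k := by
      have e1 := extend_coe (nem f (nem B (ray E x) + rayApply J x v)) ⟨t, ht.1.le, ht.2.le⟩
      have e2 := extend_coe v ⟨t, ht.1.le, ht.2.le⟩
      simp only at e1 e2
      rw [e1, nem_apply hf hAD, hA, e2]
      simp
    have h4 : t • d k = -((k : ℝ) + 1) • extend v t k + f (B (t • x) + J (t • x) (extend v t)) k :=
      congrFun he k
    rw [h3, pow_succ, mul_smul, h4, smul_add, smul_smul]
    simp only [Nat.add_sub_cancel, Nat.cast_add, Nat.cast_one]
    have : t ^ (k : ℕ) * -((k : ℝ) + 1) = -(((k : ℝ) + 1) * t ^ (k : ℕ)) := by ring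
    rw [this, neg_smul]
    abel
  refine ⟨_, ⟨hAD, fun t => ?_⟩, hav, hA⟩
  rw [← hav, hA]

/-- The data of the greatest solution. -/
structure IsGreatestSolution (J : E →L[ℝ] (∀ k, Y k) →L[ℝ] X) (f : X → ∀ k, Y k) (D : Set X)
    (B : E → X) (N : Set E) (ρ : ℕ∞) (N' : Set E) (a : E → ∀ k, Y k) : Prop where
  zero_mem : (0 : E) ∈ N'
  starConvex : StarConvex ℝ 0 N'
  isOpen : ∃ O : Set E, IsOpen O ∧ N' = N ∩ O
  contDiffOn : ContDiffOn ℝ ρ a N'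
  mem : ∀ x ∈ N', B x + J x (a x) ∈ D
  deriv : ∀ x ∈ N', ∀ s ≤ 0, HasDerivWithinAt (fun s : ℝ => a (Real.exp s • x))
    (eulerField J f B (Real.exp s • x) (a (Real.exp s • x))) (Iic 0) s
  greatest : ∀ x ∈ N, ∀ v : C(I, ∀ k, Y k),
    (∀ t : I, B ((t : ℝ) • x) + (t : ℝ) • J x (v t) ∈ D) →
    (∀ t ∈ Ioo (0 : ℝ) 1, ∃ d, HasDerivAt (extend v) d t ∧
      t • d = eulerField J f B (t • x) (extend v t)) → x ∈ N' ∧ a x = v 1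
  integral : ∀ x ∈ N', a x = average Y (nem (fun y => f (B y + J y (a y))) (ray E x)) 1
  of_integral : ∀ A : E → X, ContinuousOn A N → (∀ x ∈ N, A x ∈ D) →
    (∀ x ∈ N, A x = B x + J x (average Y (nem (fun y => f (A y)) (ray E x)) 1)) →
      ∀ x ∈ N, x ∈ N' ∧ A x = B x + J x (a x)
  at_zero : ∀ k : Fin (ℓ + 1), a 0 k = ((k : ℝ) + 1)⁻¹ • f (B 0) k

/-- `N'` is the set of solvable points and `a x` the value at `1` of the averaged right hand side.
The identity `a (s x) = average (f ∘ V_x) s` turns statements about `a` into statements about a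
single ray. -/
theorem exists_isGreatestSolution [CompleteSpace E] [CompleteSpace X] [∀ k, CompleteSpace (Y k)]
    (J : E →L[ℝ] (∀ k, Y k) →L[ℝ] X) (hD : IsOpen D) (hf : ContDiffOn ℝ ∞ f D)
    (hq : LocallyQuasiconvex N) (hu : UniqueDiffOn ℝ N) (h0 : (0 : E) ∈ N)
    (hstar : StarConvex ℝ 0 N) {ρ : ℕ∞} (hB : ContDiffOn ℝ ρ B N) (hB0 : B 0 ∈ D) :
    ∃ N' a, IsGreatestSolution J f D B N ρ N' a := by
  obtain ⟨V, hopen, hVc, hV⟩ := exists_raySol (J := J) hD hf hq hu hstar hB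
  set N' : Set E := {x ∈ N | ∃ A, RaySol J f D B x A} with hN'
  set a : E → ∀ k, Y k := fun x => average Y (nem f (V x)) 1 with ha
  have hfc := hf.continuousOn
  have hVsol : ∀ x ∈ N', RaySol J f D B x (V x) := fun x hx => hV x hx.1 hx.2
  have hVeq : ∀ x ∈ N', ∀ A, RaySol J f D B x A → V x = A := fun x hx A hA =>
    (hVsol x hx).unique hD hf hA
  have hstarN' : ∀ x ∈ N', ∀ s : I, (s : ℝ) • x ∈ N' := fun x hx s =>
    ⟨ray_mem hstar hx.1 s, _, (hVsol x hx).scale hfc s⟩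
  have hstar' : StarConvex ℝ 0 N' := by
    rw [starConvex_zero_iff]
    exact fun x hx s h0 h1 => hstarN' x hx ⟨s, h0, h1⟩
  have hVscale : ∀ x ∈ N', ∀ s : I, V ((s : ℝ) • x) = (V x).comp (mulI s) := fun x hx s =>
    hVeq _ (hstarN' x hx s) _ ((hVsol x hx).scale hfc s)
  have hascale : ∀ x ∈ N', ∀ s : I, a ((s : ℝ) • x) = average Y (nem f (V x)) s := by
    intro x hx s
    rw [ha]
    simp only
    rw [hVscale x hx, nem_comp_mulI hfc (hVsol x hx).mem]
    refine (average_comp_mul _ s 1).trans ?_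
    rw [mul_one]
  have hV1 : ∀ x ∈ N', V x 1 = B x + J x (a x) := by
    intro x hx
    have := (hVsol x hx).eqn 1
    simpa using this
  have hVt : ∀ x ∈ N', ∀ t : I, V x t = B ((t : ℝ) • x) + J ((t : ℝ) • x) (a ((t : ℝ) • x)) := by
    intro x hx t
    rw [hascale x hx, (hVsol x hx).eqn]
    simp
  have hzero : (0 : E) ∈ N' := ⟨h0, _, RaySol.at_zero hB0⟩
  have hac : ContDiffOn ℝ ρ a N' := by
    refine (contDiff_eval 1).comp_contDiffOn ((average Y).contDiff.comp_contDiffOn ?_)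
    exact ((contDiffOn_nem_of_isOpen hD hf).of_le (by exact_mod_cast le_top)).comp hVc
      fun x hx => (hVsol x hx).mem
  refine ⟨N', a, hzero, hstar', hopen, hac, fun x hx => ?_, fun x hx s hs => ?_,
    fun x hx v hmem hv => ?_, fun x hx => ?_, fun A hAc hAD hA x hx => ?_, fun k => ?_⟩
  · rw [← hV1 x hx]
    exact (hVsol x hx).mem 1
  · have hexp : ∀ s : ℝ, s ≤ 0 → Real.exp s ∈ I := fun s hs =>
      ⟨(Real.exp_pos s).le, Real.exp_le_one_iff.2 hs⟩
    have heq : ∀ s : ℝ, s ≤ 0 →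
        a (Real.exp s • x) = extend (average Y (nem f (V x))) (Real.exp s) := fun s hs =>
      (hascale x hx ⟨Real.exp s, hexp s hs⟩).trans (extend_coe _ ⟨Real.exp s, hexp s hs⟩).symm
    have h1 : HasDerivWithinAt (fun s : ℝ => extend (average Y (nem f (V x))) (Real.exp s))
        (fun k => -((k : ℝ) + 1) • extend (average Y (nem f (V x))) (Real.exp s) k +
          extend (nem f (V x)) (Real.exp s) k) (Iic 0) s :=
      hasDerivWithinAt_pi.2 fun k => hasDerivWithinAt_average_exp (nem f (V x)) k hs
    refine (h1.congr (fun s hs => heq s hs) (heq s hs)).congr_deriv ?_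
    have h2 : extend (nem f (V x)) (Real.exp s) =
        f (B (Real.exp s • x) + J (Real.exp s • x) (a (Real.exp s • x))) := by
      refine (extend_coe (nem f (V x)) ⟨Real.exp s, hexp s hs⟩).trans ?_
      rw [nem_apply hfc (hVsol x hx).mem, hVt x hx]
    rw [← heq s hs, h2]
    rfl
  · obtain ⟨A, hA, hvA, -⟩ := raySol_of_hasDerivAt hfc hstar hB.continuousOn hx v hmem hv
    have hxN : x ∈ N' := ⟨hx, A, hA⟩
    refine ⟨hxN, ?_⟩
    rw [ha]
    simp only
    rw [hVeq x hxN A hA, ← hvA]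
  · have hcont : ContinuousOn (fun y => f (B y + J y (a y))) N' := by
      refine hfc.comp ((hB.continuousOn.mono fun y hy => hy.1).add
        (J.continuous.continuousOn.clm_apply hac.continuousOn)) fun y hy => ?_
      simp only [← hV1 y hy]
      exact (hVsol y hy).mem 1
    have h1 : nem (fun y => f (B y + J y (a y))) (ray E x) = nem f (V x) := by
      ext1 t
      rw [nem_apply hcont (ray_mem hstar' hx), nem_apply hfc (hVsol x hx).mem, hVt x hx]
      rfl
    rw [h1]
  · have hfA : ContinuousOn (fun y => f (A y)) N := hfc.comp hAc hAD
    have hnem : ∀ t, nem A (ray E x) t = A ((t : ℝ) • x) := nem_apply hAc (ray_mem hstar hx)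
    have hnem2 : ∀ x ∈ N, nem (fun y => f (A y)) (ray E x) = nem f (nem A (ray E x)) := by
      intro x hx
      ext1 t
      rw [nem_apply hfA (ray_mem hstar hx), nem_apply hfc (fun t => ?_),
        nem_apply hAc (ray_mem hstar hx)]
      rw [nem_apply hAc (ray_mem hstar hx)]
      exact hAD _ (ray_mem hstar hx t)
    have hD' : ∀ t, nem A (ray E x) t ∈ D := fun t => by
      rw [hnem]; exact hAD _ (ray_mem hstar hx t)
    -- The integral equation at `t x` lives on the shorter ray; scaling the average turns it into
    -- the ray equation for `x` at time `t`.
    have hsol : RaySol J f D B x (nem A (ray E x)) := by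
      refine ⟨hD', fun t => ?_⟩
      have htx : (t : ℝ) • x ∈ N := ray_mem hstar hx t
      have h2 : nem A (ray E ((t : ℝ) • x)) = (nem A (ray E x)).comp (mulI t) := by
        ext1 s
        rw [nem_apply hAc (ray_mem hstar htx), ContinuousMap.comp_apply, hnem]
        simp [smul_smul]
      have h3 : average Y ((nem f (nem A (ray E x))).comp (mulI t)) 1 =
        average Y (nem f (nem A (ray E x))) (t * 1) := average_comp_mul _ t 1
      rw [hnem, hA _ htx, hnem2 _ htx, h2, nem_comp_mulI hfc hD', h3]
      simp
    have hxN : x ∈ N' := ⟨hx, _, hsol⟩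
    refine ⟨hxN, ?_⟩
    rw [← hV1 x hxN, hVeq x hxN _ hsol, hnem]
    simp
  · have h1 := hascale 0 hzero 0
    rw [smul_zero] at h1
    rw [h1, average_zero_apply, nem_apply hfc (hVsol 0 hzero).mem, hVt 0 hzero]
    simp

end Euler

end Kuranishi

end

noncomputable section

namespace Kuranishi

open Set Filter Topology Metric

/-! ### Smoothness of `F_Q` -/

section Smooth

variable {n ℓ : ℕ} {W : Fin (ℓ + 1) → Type*} [∀ k, NormedAddCommGroup (W k)]
  [∀ k, NormedSpace ℝ (W k)] {U : TopologicalSpace.Opens (W 0)}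

theorem contDiff_fiber_apply {m : ℕ} (k : Fin (ℓ + 1)) (v : Fin ((k : ℕ) + m) → Euc n) :
    ContDiff ℝ ∞ fun α : Fiber W n m => α k v :=
  ((ContinuousAlternatingMap.apply ℝ (Euc n) (W k) v).comp
    (ContinuousLinearMap.proj (R := ℝ)
      (φ := fun k : Fin (ℓ + 1) => Euc n [⋀^Fin ((k : ℕ) + m)]→L[ℝ] W k) k)).contDiff

theorem contDiff_zeroPart : ContDiff ℝ ∞ (zeroPart : Fiber W n 0 → W 0) :=
  contDiff_fiber_apply 0 0

theorem isOpen_zeroPart_mem (U : TopologicalSpace.Opens (W 0)) :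
    IsOpen {α : Fiber W n 0 | zeroPart α ∈ U} :=
  U.isOpen.preimage contDiff_zeroPart.continuous

theorem exists_contDiffOn_extension (f : SmoothFn W U) :
    ∃ g : W 0 → ℝ, ContDiffOn ℝ ∞ g U ∧ ∀ u : U, f u = g u := by
  classical
  set g : W 0 → ℝ := fun u => if h : u ∈ U then f ⟨u, h⟩ else 0 with hg
  have hfg : ∀ u : U, f u = g u := fun u => by simp [hg]
  refine ⟨g, fun u hu => ?_, hfg⟩
  have h1 : ContMDiffAt 𝓘(ℝ, W 0) 𝓘(ℝ, ℝ) ∞ (fun u : U => g u) ⟨u, hu⟩ :=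
    (f.contMDiff ⟨u, hu⟩).congr_of_eventuallyEq (Eventually.of_forall fun v => (hfg v).symm)
  exact ((contMDiffAt_subtype_iff (I := 𝓘(ℝ, W 0)) (I' := 𝓘(ℝ, ℝ)) (f := g)
    (x := ⟨u, hu⟩)).1 h1).contDiffAt.contDiffWithinAt

theorem subst_algebraMap (α : Fiber W n 0) (hα : zeroPart α ∈ U) (f : SmoothFn W U) :
    subst α hα (algebraMap (SmoothFn W U) (FnAlg W U) f) =
      algebraMap ℝ (Ext n) (f ⟨zeroPart α, hα⟩) := by
  let _ : Algebra (SmoothFn W U) (Ext n) := (evalFn n ⟨zeroPart α, hα⟩).toAlgebra' (by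
    intro c x
    exact Algebra.commutes (R := ℝ) (A := Ext n) (c ⟨zeroPart α, hα⟩) x)
  exact AlgHom.commutes (RingQuot.liftAlgHom (SmoothFn W U) _) f

theorem subst_coordFn (α : Fiber W n 0) (hα : zeroPart α ∈ U) (g : Coord W) :
    subst α hα (coordFn U g) = pairing α g := by
  let _ : Algebra (SmoothFn W U) (Ext n) := (evalFn n ⟨zeroPart α, hα⟩).toAlgebra' (by
    intro c x
    exact Algebra.commutes (R := ℝ) (A := Ext n) (c ⟨zeroPart α, hα⟩) x)
  refine (RingQuot.liftAlgHom_mkAlgHom_apply (SmoothFn W U) _ _ _).trans ?_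
  exact FreeAlgebra.lift_ι_apply _ _

/-- The element `p` depends smoothly on the substituted coordinates. -/
def SmoothSubst (n : ℕ) (p : FnAlg W U) : Prop :=
  ∃ (ι : Type) (_ : Fintype ι) (f : ι → Fiber W n 0 → ℝ) (e : ι → Ext n),
    (∀ i, ContDiffOn ℝ ∞ (f i) {α | zeroPart α ∈ U}) ∧
      ∀ (α : Fiber W n 0) (hα : zeroPart α ∈ U), subst α hα p = ∑ i, f i α • e i

/-- Induction on a representative in the free algebra. Smoothness is expressed by finitely many real
coefficients against fixed vectors, so no norm on the exterior algebra is involved. -/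
theorem smoothSubst (n : ℕ) (p : FnAlg W U) : SmoothSubst n p := by
  obtain ⟨p, rfl⟩ := RingQuot.mkAlgHom_surjective (SmoothFn W U) (AlgRel W U) p
  induction p with
  | grade0 f =>
    obtain ⟨g, hg, hfg⟩ := exists_contDiffOn_extension f
    refine ⟨Unit, inferInstance, fun _ α => g (zeroPart α), fun _ => 1, fun _ =>
      hg.comp contDiff_zeroPart.contDiffOn fun α hα => hα, fun α hα => ?_⟩
    rw [AlgHom.commutes, subst_algebraMap, hfg]
    simp [Algebra.algebraMap_eq_smul_one]
  | grade1 g =>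
    refine ⟨Fin g.1 → Fin n, inferInstance, fun i α => ((g.1 : ℕ).factorial : ℝ)⁻¹ *
        g.2 (α g.1 fun j => EuclideanSpace.basisFun (Fin n) ℝ (i j)),
      fun i => ExteriorAlgebra.ιMulti ℝ g.1 (fun j => dx (i j)), fun i => ?_, fun α hα => ?_⟩
    · exact (contDiff_const.mul (g.2.contDiff.comp (contDiff_fiber_apply g.1 _))).contDiffOn
    · refine (subst_coordFn α hα g).trans ?_
      simp only [pairing, toExt, LinearMap.smul_apply, LinearMap.sum_apply, LinearMap.coe_mk,
        AddHom.coe_mk, Finset.smul_sum, smul_smul]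
      rfl
  | mul p q hp hq =>
    obtain ⟨ι, _, f, e, hf, he⟩ := hp
    obtain ⟨ι', _, f', e', hf', he'⟩ := hq
    refine ⟨ι × ι', inferInstance, fun i α => f i.1 α * f' i.2 α, fun i => e i.1 * e' i.2,
      fun i => (hf i.1).mul (hf' i.2), fun α hα => ?_⟩
    rw [map_mul, map_mul, he, he', Finset.sum_mul_sum, Fintype.sum_prod_type]
    simp [smul_smul, mul_comm]
  | add p q hp hq =>
    obtain ⟨ι, _, f, e, hf, he⟩ := hp
    obtain ⟨ι', _, f', e', hf', he'⟩ := hq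
    refine ⟨ι ⊕ ι', inferInstance, Sum.elim f f', Sum.elim e e', ?_, fun α hα => ?_⟩
    · rintro (i | i)
      exacts [hf i, hf' i]
    · rw [map_add, map_add, he, he']
      simp

theorem ofExt_apply {k : ℕ} (w : Ext n) (v : Fin k → Euc n) : ofExt k w v =
    ExteriorAlgebra.liftAlternating (Function.update 0 k
      (exteriorPower.alternatingMapToDual ℝ (Euc n) k)) w (exteriorPower.ιMulti ℝ k v) := rfl

/-- The degree `k` part of an element of the exterior algebra, as a linear map. -/
def ofExtₗ (n k : ℕ) : Ext n →ₗ[ℝ] (Euc n [⋀^Fin k]→L[ℝ] ℝ) where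
  toFun := ofExt k
  map_add' x y := by ext v; simp [ofExt_apply]
  map_smul' c x := by ext v; simp [ofExt_apply]

variable [∀ k, FiniteDimensional ℝ (W k)]

theorem contDiffOn_FQ (Q : Differential W U) :
    ContDiffOn ℝ ∞ (FQ Q : Fiber W n 0 → Fiber W n 1) {α | zeroPart α ∈ U} := by
  classical
  refine contDiffOn_pi.2 fun k => ?_
  have key : ∀ i, ContDiffOn ℝ ∞ (fun α : Fiber W n 0 => if hα : zeroPart α ∈ U then
      (ofExt ((k : ℕ) + 1) (subst α hα (Q.toLinearMap (coordFn U
        ⟨k, LinearMap.toContinuousLinearMap ((Module.finBasis ℝ (W k)).coord i)⟩)))).smulRight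
        (Module.finBasis ℝ (W k) i) else 0) {α | zeroPart α ∈ U} := by
    intro i
    obtain ⟨ι, _, f, e, hf, he⟩ := smoothSubst n (Q.toLinearMap (coordFn U
        ⟨k, LinearMap.toContinuousLinearMap ((Module.finBasis ℝ (W k)).coord i)⟩))
    have h1 : ContDiffOn ℝ ∞ (fun α : Fiber W n 0 => ∑ j, f j α •
        (ofExtₗ n ((k : ℕ) + 1) (e j)).smulRight (Module.finBasis ℝ (W k) i))
        {α | zeroPart α ∈ U} :=
      ContDiffOn.sum fun j _ => (hf j).smul contDiffOn_const
    refine h1.congr fun α (hα : zeroPart α ∈ U) => ?_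
    rw [dif_pos hα, he]
    change (ofExtₗ n ((k : ℕ) + 1) (∑ j, f j α • e j)).smulRight _ = _
    ext v
    simp [Finset.sum_smul, mul_smul]
  refine (ContDiffOn.sum fun i (_ : i ∈ Finset.univ) => key i).congr
    fun α (hα : zeroPart α ∈ U) => ?_
  rw [FQ, dif_pos hα]
  refine Finset.sum_congr rfl fun i _ => ?_
  rw [dif_pos hα]

end Smooth

/-! ### Operations on forms in terms of rays -/

section Operations

open unitInterval

variable {n ℓ : ℕ} {W : Fin (ℓ + 1) → Type*} [∀ k, NormedAddCommGroup (W k)]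
  [∀ k, NormedSpace ℝ (W k)]

/-- The components of the fibre of degree `1`. -/
abbrev Comp (W : Fin (ℓ + 1) → Type*) [∀ k, NormedAddCommGroup (W k)]
    [∀ k, NormedSpace ℝ (W k)] (n : ℕ) (k : Fin (ℓ + 1)) : Type _ :=
  Euc n [⋀^Fin ((k : ℕ) + 1)]→L[ℝ] W k

/-- Contraction, as a continuous bilinear map. -/
def contraction (W : Fin (ℓ + 1) → Type*) [∀ k, NormedAddCommGroup (W k)]
    [∀ k, NormedSpace ℝ (W k)] (n : ℕ) :
    Euc n →L[ℝ] (∀ k, Comp W n k) →L[ℝ] Fiber W n 0 :=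
  LinearMap.mkContinuous₂
    (LinearMap.mk₂ ℝ (fun x y => iE x y)
      (fun x x' y => by funext k; simp [iE]) (fun c x y => by funext k; simp [iE])
      (fun x y y' => by funext k; simp [iE]) (fun c x y => by funext k; simp [iE])) 1
    (fun x y => by
      refine (pi_norm_le_iff_of_nonneg (by positivity)).2 fun k => ?_
      calc ‖(y k).curryLeft x‖ ≤ ‖(y k).curryLeft‖ * ‖x‖ := ContinuousLinearMap.le_opNorm _ _
        _ ≤ ‖y‖ * ‖x‖ := by
          rw [ContinuousAlternatingMap.norm_curryLeft]
          gcongr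
          exact norm_le_pi_norm y k
        _ = 1 * ‖x‖ * ‖y‖ := by ring)

theorem contraction_apply (x : Euc n) (y : Fiber W n 1) : contraction W n x y = iE x y := rfl

theorem compContinuousLinearMap_smul_id {V : Type*} [NormedAddCommGroup V] [NormedSpace ℝ V]
    {k : ℕ} (w : Euc n [⋀^Fin k]→L[ℝ] V) (t : ℝ) :
    w.compContinuousLinearMap (t • ContinuousLinearMap.id ℝ (Euc n)) = t ^ k • w := by
  ext v
  have := w.toContinuousMultilinearMap.map_smul_univ (fun _ => t) v
  simpa [Function.comp_def] using this

/-- Pulling back along `y ↦ τ y` multiplies the remaining `k` arguments by `τ ^ k`, which is the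
weight in `average`; contraction with `x` comes out of the integral. -/
theorem hW_eq [∀ k, CompleteSpace (W k)] {N : Set (Euc n)} (hstar : StarConvex ℝ 0 N)
    {β : Euc n → Fiber W n 1} (hβ : ContinuousOn β N) {x : Euc n} (hx : x ∈ N) :
    hW β x = contraction W n x (average (Comp W n) (nem β (ray (Euc n) x)) 1) := by
  funext k
  rw [contraction_apply]
  simp only [hW, iE, deRhamHomotopy]
  rw [average_apply_apply]
  set w : C(I, ∀ k, Comp W n k) := nem β (ray (Euc n) x)
  have h1 : IntervalIntegrable (fun τ : ℝ => τ ^ (k : ℕ) • extend w (τ * (1 : I)) k)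
      MeasureTheory.volume 0 1 := by
    have := continuous_extend w
    exact Continuous.intervalIntegrable (by fun_prop) _ _
  have h2 := ((ContinuousLinearMap.apply ℝ _ x).comp
    (ContinuousAlternatingMap.curryLeftLI (𝕜 := ℝ) (E := Euc n) (F := W k)
      (n := k)).toContinuousLinearMap).intervalIntegral_comp_comm h1
  refine Eq.trans ?_ h2
  refine intervalIntegral.integral_congr fun τ hτ => ?_
  rw [uIcc_of_le zero_le_one] at hτ
  rw [extend_mul w hτ, nem_apply hβ (ray_mem hstar hx), compContinuousLinearMap_smul_id]
  simp

/-- The pullback of a `(k+1)`-form along the flow carries the factor `e^{(k+1)s}`, and the product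
rule gives the extra term `k + 1`. It cancels the `-(k+1)` of `eulerField`. -/
theorem lieW_eq {a : Euc n → Fiber W n 1} {x : Euc n} {d : Fiber W n 1}
    (h : HasDerivWithinAt (fun s : ℝ => a (Real.exp s • x)) d (Iic 0) 0) :
    lieW a x = (fun k : Fin (ℓ + 1) => ((k : ℝ) + 1) • a x k) + d := by
  funext k
  have h1 : HasDerivWithinAt (fun s : ℝ => a (Real.exp s • x) k) (d k) (Iic 0) 0 :=
    hasDerivWithinAt_pi.1 h k
  have h2 := ((Real.hasDerivAt_exp 0).fun_pow ((k : ℕ) + 1)).hasDerivWithinAt.fun_smul h1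
  simp only [lieW, lieDerivEuler, compContinuousLinearMap_smul_id]
  rw [h2.derivWithin (uniqueDiffWithinAt_convex (convex_Iic 0) (by simp) (by simp))]
  simp [add_comm]

end Operations

end Kuranishi

end

noncomputable section

namespace Kuranishi

open Set Filter Topology Metric

/-! ### Hyperbolicity of the fixed point -/

section Hyperbolic

theorem exp_smul_apply_of_eigenvector {Z : Type*} [NormedAddCommGroup Z] [NormedSpace ℝ Z]
    [CompleteSpace Z] {L : Z →L[ℝ] Z} {v : Z} {c : ℝ} (h : L v = c • v) (t : ℝ) :
    NormedSpace.exp (t • L) v = Real.exp (c * t) • v := by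
  have hpow : ∀ m : ℕ, ((t • L) ^ m) v = (c * t) ^ m • v := by
    intro m
    induction m with
    | zero => simp
    | succ m ih =>
      rw [pow_succ', mul_apply_eq_comp, ih, map_smul, _root_.smul_apply, h, smul_smul, smul_smul,
        pow_succ]
      congr 1
      ring
  have h1 := (NormedSpace.exp_series_hasSum_exp' (𝕂 := ℝ) (t • L)).mapL
    (ContinuousLinearMap.apply ℝ Z v)
  have h2 := (NormedSpace.exp_series_hasSum_exp' (𝕂 := ℝ) (c * t)).smul_const v
  rw [← Real.exp_eq_exp_ℝ] at h2
  refine h1.unique (h2.congr_fun fun m => ?_)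
  simp [hpow, smul_smul]

theorem eq_zero_of_tendsto_smul {V : Type*} [NormedAddCommGroup V] [NormedSpace ℝ V]
    {l : Filter ℝ} [l.NeBot] {r : ℝ → ℝ} {w : V} (hr : ∀ᶠ t in l, 1 ≤ r t)
    (h : Tendsto (fun t => r t • w) l (𝓝 0)) : w = 0 := by
  have h1 : ∀ᶠ t in l, ‖w‖ ≤ ‖r t • w‖ := by
    filter_upwards [hr] with t ht
    rw [norm_smul, Real.norm_of_nonneg (zero_le_one.trans ht)]
    exact le_mul_of_one_le_left (norm_nonneg _) ht
  have h2 := h.norm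
  rw [norm_zero] at h2
  exact norm_le_zero_iff.1 (ge_of_tendsto h2 h1)

variable {ℓ : ℕ} {Y : Fin (ℓ + 1) → Type*} [∀ k, NormedAddCommGroup (Y k)]
  [∀ k, NormedSpace ℝ (Y k)] {E : Type*} [NormedAddCommGroup E] [NormedSpace ℝ E]

/-- Multiplication of the `k`-th component by `-(k + 1)`. -/
def negDegree (Y : Fin (ℓ + 1) → Type*) [∀ k, NormedAddCommGroup (Y k)]
    [∀ k, NormedSpace ℝ (Y k)] : (∀ k, Y k) →L[ℝ] (∀ k, Y k) :=
  ContinuousLinearMap.pi fun k => (-((k : ℝ) + 1)) • ContinuousLinearMap.proj k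

@[simp]
theorem negDegree_apply (y : ∀ k, Y k) (k : Fin (ℓ + 1)) :
    negDegree Y y k = -((k : ℝ) + 1) • y k := rfl

/-- The linearization `(ξ, y) ↦ (ξ, M ξ - (k + 1) y_k)`. -/
def linearization (M : E →L[ℝ] ∀ k, Y k) : (E × ∀ k, Y k) →L[ℝ] (E × ∀ k, Y k) :=
  (ContinuousLinearMap.fst ℝ E _).prod
    (M.comp (.fst ℝ E _) + (negDegree Y).comp (.snd ℝ E _))

theorem linearization_apply (M : E →L[ℝ] ∀ k, Y k) (ξ : E) (y : ∀ k, Y k) :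
    linearization M (ξ, y) = (ξ, M ξ + negDegree Y y) := rfl

/-- The slope of the unstable subspace. -/
def unstableSlope (M : E →L[ℝ] ∀ k, Y k) (ξ : E) : ∀ k, Y k :=
  fun k => ((k : ℝ) + 2)⁻¹ • M ξ k

/-- Solving `-(k+1) y_k + M_k ξ = y_k` gives the factor `1 / (k + 2)`. -/
theorem linearization_slope (M : E →L[ℝ] ∀ k, Y k) (ξ : E) :
    linearization M (ξ, unstableSlope M ξ) = (ξ, unstableSlope M ξ) := by
  rw [linearization_apply, Prod.mk.injEq]
  refine ⟨rfl, funext fun k => ?_⟩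
  have hk : ((k : ℝ) + 2) ≠ 0 := by positivity
  simp only [Pi.add_apply, negDegree_apply, unstableSlope, smul_smul]
  nth_rewrite 1 [← one_smul ℝ (M ξ k)]
  rw [← add_smul]
  congr 1
  field_simp
  ring

variable [CompleteSpace E] [∀ k, CompleteSpace (Y k)]

/-- A vector splits into an eigenvector for `1`, on the graph of the slope, and vertical
eigenvectors for `-(k+1)`; the exponential acts on each by a scalar. -/
theorem exp_linearization (M : E →L[ℝ] ∀ k, Y k) (t : ℝ) (ξ : E) (y : ∀ k, Y k) :
    NormedSpace.exp (t • linearization M) (ξ, y) = (Real.exp t • ξ, fun k : Fin (ℓ + 1) =>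
      Real.exp t • unstableSlope M ξ k +
        Real.exp (-((k : ℝ) + 1) * t) • (y k - unstableSlope M ξ k)) := by
  have hv : ∀ z : ∀ k, Y k, NormedSpace.exp (t • linearization M) ((0, z) : E × ∀ k, Y k) =
      (0, fun k : Fin (ℓ + 1) => Real.exp (-((k : ℝ) + 1) * t) • z k) := by
    intro z
    have hz : ((0, z) : E × ∀ k, Y k) = ∑ k, (0, Pi.single k (z k)) := by
      refine Prod.ext ?_ ?_
      · simp [Prod.fst_sum]
      · simp [Prod.snd_sum, Finset.univ_sum_single]
    have heig : ∀ k : Fin (ℓ + 1), linearization M ((0, Pi.single k (z k)) : E × ∀ k, Y k) =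
        (-((k : ℝ) + 1)) • ((0, Pi.single k (z k)) : E × ∀ k, Y k) := by
      intro k
      rw [linearization_apply, Prod.smul_mk, Prod.mk.injEq]
      refine ⟨by simp, funext fun j => ?_⟩
      rw [map_zero, zero_add, negDegree_apply, Pi.smul_apply]
      rcases eq_or_ne j k with rfl | hjk
      · rfl
      · simp [Pi.single_eq_of_ne hjk]
    rw [hz, map_sum]
    simp only [fun k => exp_smul_apply_of_eigenvector (heig k) t, Prod.smul_mk]
    refine Prod.ext ?_ ?_
    · simp [Prod.fst_sum]
    · funext j
      rw [Prod.snd_sum, Finset.sum_apply, Finset.sum_eq_single j]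
      · simp
      · intro k _ hk
        simp [Pi.single_eq_of_ne hk.symm]
      · simp
  have hsplit : ((ξ, y) : E × ∀ k, Y k) =
      (ξ, unstableSlope M ξ) + (0, y - unstableSlope M ξ) := by simp
  have h1 : linearization M (ξ, unstableSlope M ξ) = (1 : ℝ) • (ξ, unstableSlope M ξ) := by
    rw [one_smul]; exact linearization_slope M ξ
  rw [hsplit, map_add, exp_smul_apply_of_eigenvector h1, hv, one_mul, Prod.smul_mk,
    Prod.mk_add_mk, add_zero]
  rfl

theorem mem_stableSubspace_linearization (M : E →L[ℝ] ∀ k, Y k) (ξ : E) (y : ∀ k, Y k) :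
    (ξ, y) ∈ stableSubspace (linearization M) ↔ ξ = 0 := by
  change Tendsto (fun t : ℝ => NormedSpace.exp (t • linearization M) (ξ, y)) atTop (𝓝 0) ↔ _
  simp only [exp_linearization]
  constructor
  · intro h
    refine eq_zero_of_tendsto_smul (l := atTop) (r := Real.exp) ?_
      ((continuous_fst.tendsto (0 : E × ∀ k, Y k)).comp h)
    filter_upwards [eventually_ge_atTop 0] with t ht
    exact Real.one_le_exp ht
  · rintro rfl
    have hs : unstableSlope M 0 = 0 := by funext k; simp [unstableSlope]
    rw [← Prod.mk_zero_zero]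
    refine Tendsto.prodMk_nhds (by simp) (tendsto_pi_nhds.2 fun k => ?_)
    simp only [hs, Pi.zero_apply, smul_zero, zero_add, sub_zero]
    have : Tendsto (fun t : ℝ => Real.exp (-((k : ℝ) + 1) * t)) atTop (𝓝 0) := by
      refine Real.tendsto_exp_atBot.comp ?_
      exact Tendsto.const_mul_atTop_of_neg (by linarith [Nat.cast_nonneg (α := ℝ) (k : ℕ)])
        tendsto_id
    simpa using this.smul_const (y k)

theorem mem_unstableSubspace_linearization (M : E →L[ℝ] ∀ k, Y k) (ξ : E) (y : ∀ k, Y k) :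
    (ξ, y) ∈ unstableSubspace (linearization M) ↔ y = unstableSlope M ξ := by
  change Tendsto (fun t : ℝ => NormedSpace.exp (t • linearization M) (ξ, y)) atBot (𝓝 0) ↔ _
  simp only [exp_linearization]
  have hexp : ∀ {V : Type _} [NormedAddCommGroup V] [NormedSpace ℝ V] (w : V),
      Tendsto (fun t : ℝ => Real.exp t • w) atBot (𝓝 0) := fun w => by
    simpa using Real.tendsto_exp_atBot.smul_const w
  constructor
  · intro h
    funext k
    rw [← sub_eq_zero]
    have h1 : Tendsto (fun t : ℝ => Real.exp t • unstableSlope M ξ k +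
        Real.exp (-((k : ℝ) + 1) * t) • (y k - unstableSlope M ξ k)) atBot (𝓝 0) :=
      tendsto_pi_nhds.1 ((continuous_snd.tendsto (0 : E × ∀ k, Y k)).comp h) k
    have h2 := h1.sub (hexp (unstableSlope M ξ k))
    simp only [add_sub_cancel_left, sub_zero] at h2
    refine eq_zero_of_tendsto_smul (l := atBot) ?_ h2
    filter_upwards [eventually_le_atBot 0] with t ht
    refine Real.one_le_exp ?_
    have : (0 : ℝ) ≤ (k : ℝ) + 1 := by positivity
    nlinarith
  · rintro rfl
    rw [← Prod.mk_zero_zero]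
    refine Tendsto.prodMk_nhds ?_ (tendsto_pi_nhds.2 fun k => ?_)
    · simpa using Real.tendsto_exp_atBot.smul_const ξ
    · simpa using Real.tendsto_exp_atBot.smul_const (unstableSlope M ξ k)

theorem isCompl_linearization (M : E →L[ℝ] ∀ k, Y k) :
    IsCompl (stableSubspace (linearization M)) (unstableSubspace (linearization M)) := by
  constructor
  · rw [Submodule.disjoint_def]
    rintro ⟨ξ, y⟩ h1 h2
    rw [mem_stableSubspace_linearization] at h1
    rw [mem_unstableSubspace_linearization] at h2
    subst h1
    rw [h2]
    refine Prod.ext rfl (funext fun k => ?_)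
    simp [unstableSlope]
  · rw [Submodule.codisjoint_iff_exists_add_eq]
    rintro ⟨ξ, y⟩
    exact ⟨(0, y - unstableSlope M ξ), (ξ, unstableSlope M ξ),
      (mem_stableSubspace_linearization M _ _).2 rfl,
      (mem_unstableSubspace_linearization M _ _).2 rfl, by simp⟩

theorem bijective_fst_unstableSubspace (M : E →L[ℝ] ∀ k, Y k) : Function.Bijective
    (fun v : unstableSubspace (linearization M) => (v : E × ∀ k, Y k).1) := by
  constructor
  · rintro ⟨⟨ξ, y⟩, h⟩ ⟨⟨ξ', y'⟩, h'⟩ (rfl : ξ = ξ')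
    rw [mem_unstableSubspace_linearization] at h h'
    subst h
    subst h'
    rfl
  · exact fun ξ => ⟨⟨(ξ, unstableSlope M ξ), (mem_unstableSubspace_linearization M _ _).2 rfl⟩, rfl⟩

end Hyperbolic

/-! ### The fixed point of the lifted Euler field -/

section FixedPoint

universe u

/-- At `x = 0` the bilinear term `J_x y` varies only through `x`, so the nonlinearity contributes
nothing to the vertical block, whatever `f` is. -/
theorem hasFDerivWithinAt_eulerField {ℓ : ℕ} {Y : Fin (ℓ + 1) → Type u}
    [∀ k, NormedAddCommGroup (Y k)] [∀ k, NormedSpace ℝ (Y k)] {X : Type u} [NormedAddCommGroup X]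
    [NormedSpace ℝ X] {E : Type} [NormedAddCommGroup E] [NormedSpace ℝ E]
    {J : E →L[ℝ] (∀ k, Y k) →L[ℝ] X} {f : X → ∀ k, Y k} {B : E → X} {N : Set E}
    (hB : DifferentiableWithinAt ℝ B N 0) (hf : DifferentiableAt ℝ f (B 0)) (y : ∀ k, Y k)
    {T : Set (E × ∀ k, Y k)} (hT : ∀ p ∈ T, p.1 ∈ N) :
    ∃ M : E →L[ℝ] ∀ k, Y k, HasFDerivWithinAt
      (fun p : E × ∀ k, Y k => (p.1, eulerField J f B p.1 p.2)) (linearization M) T (0, y) := by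
  refine ⟨(fderiv ℝ f (B 0)).comp (fderivWithin ℝ B N 0 + J.flip y), ?_⟩
  have h1 : HasFDerivWithinAt (fun p : E × ∀ k, Y k => B p.1)
      ((fderivWithin ℝ B N 0).comp (.fst ℝ E _)) T (0, y) :=
    HasFDerivWithinAt.comp (f := Prod.fst) (g := B) (x := ((0, y) : E × ∀ k, Y k))
      hB.hasFDerivWithinAt hasFDerivWithinAt_fst hT
  have h2 : HasFDerivWithinAt (fun p : E × ∀ k, Y k => J p.1 p.2)
      ((J 0).comp (.snd ℝ E _) + (J.comp (.fst ℝ E _)).flip y) T (0, y) := by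
    have ha : HasFDerivWithinAt (fun p : E × ∀ k, Y k => J p.1) (J.comp (.fst ℝ E _)) T (0, y) :=
      (J.comp (.fst ℝ E (∀ k, Y k))).hasFDerivWithinAt
    exact ha.clm_apply hasFDerivWithinAt_snd
  have h3 : HasFDerivAt f (fderiv ℝ f (B 0)) (B 0 + J 0 y) := by
    simpa using hf.hasFDerivAt
  have h4 : HasFDerivWithinAt (fun p : E × ∀ k, Y k => f (B p.1 + J p.1 p.2)) _ T (0, y) :=
    HasFDerivAt.comp_hasFDerivWithinAt (f := fun p : E × ∀ k, Y k => B p.1 + J p.1 p.2)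
      (0, y) h3 (h1.add h2)
  have h5 : HasFDerivWithinAt (fun p : E × ∀ k, Y k => negDegree Y p.2)
      ((negDegree Y).comp (.snd ℝ E _)) T (0, y) :=
    ((negDegree Y).comp (.snd ℝ E (∀ k, Y k))).hasFDerivWithinAt
  have h6 := (hasFDerivWithinAt_fst (𝕜 := ℝ) (s := T) (p := ((0, y) : E × ∀ k, Y k))).prodMk
    (h5.add h4)
  refine h6.congr_fderiv ?_
  ext v k <;> simp [linearization]

variable {n ℓ : ℕ} {W : Fin (ℓ + 1) → Type u} [∀ k, NormedAddCommGroup (W k)]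
  [∀ k, NormedSpace ℝ (W k)] [∀ k, FiniteDimensional ℝ (W k)] {U : TopologicalSpace.Opens (W 0)}

/-- The base component of `Ê` forces `x = 0`, where `i_E` vanishes; the fibre equation then becomes
`(k+1) y_k = F_Q(B 0)_k`, with one solution. -/
theorem isHyperbolicFixedPoint (Q : Differential W U) {N : Set (Euc n)} (h0 : (0 : Euc n) ∈ N)
    {B : Euc n → Fiber W n 0} (hB : DifferentiableWithinAt ℝ B N 0) (hB0 : zeroPart (B 0) ∈ U)
    {P : Euc n × Fiber W n 1} (hP1 : P.1 = 0)
    (hP2 : ∀ k : Fin (ℓ + 1), P.2 k = ((k : ℝ) + 1)⁻¹ • FQ Q (B 0) k) :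
    IsHyperbolicFixedPoint Q N B P := by
  have hcomplete : ∀ k, CompleteSpace (W k) := fun k => FiniteDimensional.complete ℝ (W k)
  obtain ⟨P₁, y⟩ := P
  obtain rfl : P₁ = 0 := hP1
  have hiE : ∀ z : Fiber W n 1, iE (0 : Euc n) z = 0 := fun z => by
    rw [← contraction_apply]; simp
  refine ⟨rfl, ⟨h0, by simpa [hiE] using hB0⟩, ?_, ?_⟩
  · rintro ⟨x, z⟩ hp
    rw [hatE, Prod.mk_eq_zero, Prod.mk.injEq]
    simp only
    refine and_congr_right fun hx => ?_
    subst hx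
    rw [hiE, add_zero, funext_iff, funext_iff]
    refine forall_congr' fun k => ?_
    have hk : (k : ℝ) + 1 ≠ 0 := by positivity
    have hy : y k = ((k : ℝ) + 1)⁻¹ • FQ Q (B 0) k := hP2 k
    rw [hy]
    simp only [Pi.add_apply, Pi.zero_apply]
    rw [neg_smul, neg_add_eq_zero]
    constructor
    · intro h
      rw [← h, smul_smul, inv_mul_cancel₀ hk, one_smul]
    · intro h
      rw [h, smul_smul, mul_inv_cancel₀ hk, one_smul]
  · have hf : DifferentiableAt ℝ (FQ Q : Fiber W n 0 → Fiber W n 1) (B 0) :=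
      ((contDiffOn_FQ Q).differentiableOn (by simp)).differentiableAt
        ((isOpen_zeroPart_mem U).mem_nhds hB0)
    obtain ⟨M, hM⟩ := hasFDerivWithinAt_eulerField (Y := Comp W n) (J := contraction W n) hB hf y
      (T := hatDomain U N B) (fun p hp => hp.1)
    refine ⟨linearization M, hM, isCompl_linearization M, ?_, fun y => ?_,
      bijective_fst_unstableSubspace M, ?_⟩
    · ext ⟨ξ, y⟩
      rw [mem_stableSubspace_linearization]
      rfl
    · rw [linearization_apply, map_zero, zero_add]
      rfl
    · rintro ⟨ξ, y⟩ h
      rw [mem_unstableSubspace_linearization] at h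
      subst h
      exact linearization_slope M ξ

end FixedPoint

end Kuranishi

end

noncomputable section

namespace Kuranishi

open Set Filter Topology Metric unitInterval

/-! ### The greatest solution and the unstable manifold -/

section Solution

universe u

variable {n ℓ : ℕ} {W : Fin (ℓ + 1) → Type u} [∀ k, NormedAddCommGroup (W k)]
  [∀ k, NormedSpace ℝ (W k)] [∀ k, FiniteDimensional ℝ (W k)] {U : TopologicalSpace.Opens (W 0)}
  {Q : Differential W U} {N : Set (Euc n)} {ρ : ℕ∞} {B : Euc n → Fiber W n 0} {N' : Set (Euc n)}
  {a : Euc n → Fiber W n 1}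

/-- The greatest solution for the data given by `Q`. -/
abbrev IsGreatest (Q : Differential W U) (N : Set (Euc n)) (ρ : ℕ∞) (B : Euc n → Fiber W n 0)
    (N' : Set (Euc n)) (a : Euc n → Fiber W n 1) : Prop :=
  IsGreatestSolution (Y := Comp W n) (contraction W n) (FQ Q) {α | zeroPart α ∈ U} B N ρ N' a

theorem IsGreatest.subset (h : IsGreatest Q N ρ B N' a) : N' ⊆ N := by
  obtain ⟨O, -, rfl⟩ := h.isOpen
  exact inter_subset_left

theorem IsGreatest.isSolution (h : IsGreatest Q N ρ B N' a) : IsSolution Q N ρ B N' a where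
  zero_mem := h.zero_mem
  starConvex := h.starConvex
  isOpen := h.isOpen
  contDiffOn := h.contDiffOn
  mem := h.mem
  eqn x hx := by
    have h1 := h.deriv x hx 0 le_rfl
    rw [lieW_eq h1]
    simp only [Real.exp_zero, one_smul]
    funext k
    simp only [eulerField, Pi.add_apply, neg_smul, contraction_apply]
    rw [add_neg_cancel_left]

theorem hasDerivWithinAt_exp_smul (x : Euc n) (s : ℝ) (T : Set ℝ) :
    HasDerivWithinAt (fun s : ℝ => Real.exp s • x) (Real.exp s • x) T s :=
  ((Real.hasDerivAt_exp s).smul_const x).hasDerivWithinAt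

theorem exp_mem_unitInterval {s : ℝ} (hs : s ≤ 0) : Real.exp s ∈ I :=
  ⟨(Real.exp_pos s).le, Real.exp_le_one_iff.2 hs⟩

/-- Restricted to a ray, any solution satisfies the radial equation, and the clause `greatest`
applies to each ray separately. -/
theorem IsGreatest.eq_of_isSolution (h : IsGreatest Q N ρ B N' a) (hρ : 1 ≤ ρ)
    {N'' : Set (Euc n)} {a' : Euc n → Fiber W n 1} (h' : IsSolution Q N ρ B N'' a') {x : Euc n}
    (hx : x ∈ N'') : x ∈ N' ∧ a' x = a x := by
  have hsub : N'' ⊆ N := by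
    obtain ⟨O, -, rfl⟩ := h'.isOpen
    exact inter_subset_left
  have hdiff : DifferentiableOn ℝ a' N'' :=
    h'.contDiffOn.differentiableOn (by
      rintro h0
      rw [show ρ = 0 from by exact_mod_cast h0] at hρ
      simp at hρ)
  have hac := h'.contDiffOn.continuousOn
  have hmem : ∀ t ∈ Icc (0 : ℝ) 1, t • x ∈ N'' := fun t ht => h'.starConvex.smul_mem hx ht.1 ht.2
  set v : C(I, ∀ k, Comp W n k) := nem a' (ray (Euc n) x) with hv
  have hvt : ∀ t : I, v t = a' ((t : ℝ) • x) := nem_apply hac (ray_mem h'.starConvex hx)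
  have hvt' : ∀ t ∈ Icc (0 : ℝ) 1, extend v t = a' (t • x) := fun t ht =>
    (extend_coe v ⟨t, ht⟩).trans (hvt ⟨t, ht⟩)
  have key := h.greatest x (hsub hx) v (fun t => ?_) (fun t ht => ?_)
  · refine ⟨key.1, ?_⟩
    rw [key.2, hvt]
    simp
  · rw [hvt]
    have := h'.mem _ (hmem t t.2)
    rw [← contraction_apply] at this
    simpa using this
  · have htI : t ∈ Icc (0 : ℝ) 1 := ⟨ht.1.le, ht.2.le⟩
    set L := fderivWithin ℝ a' N'' (t • x)
    have hL : HasFDerivWithinAt a' L N'' (t • x) := (hdiff _ (hmem t htI)).hasFDerivWithinAt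
    refine ⟨L x, ?_, ?_⟩
    · have h1 : HasDerivWithinAt (fun t : ℝ => t • x) x (Icc 0 1) t := by
        simpa using ((hasDerivAt_id t).smul_const x).hasDerivWithinAt (s := Icc 0 1)
      have h2 : HasDerivWithinAt (fun t : ℝ => a' (t • x)) (L x) (Icc 0 1) t :=
        hL.comp_hasDerivWithinAt t h1 hmem
      have h3 := h2.hasDerivAt (Icc_mem_nhds ht.1 ht.2)
      refine h3.congr_of_eventuallyEq ?_
      filter_upwards [Icc_mem_nhds ht.1 ht.2] with s hs
      exact hvt' s hs
    -- The Lie derivative at `t x` sees the derivative along the flow, `L (t • x) = t • L x`, which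
    -- is the required `t • d`.
    · have h1 : HasDerivWithinAt (fun s : ℝ => a' (Real.exp s • t • x)) (L (t • x)) (Iic 0) 0 := by
        have h2 := hasDerivWithinAt_exp_smul (t • x) 0 (Iic 0)
        rw [Real.exp_zero, one_smul] at h2
        refine HasFDerivWithinAt.comp_hasDerivWithinAt (l := a') (f := fun s => Real.exp s • t • x)
          (t := N'') 0 (by simpa using hL) h2 fun s hs => ?_
        have hs' := exp_mem_unitInterval (mem_Iic.1 hs)
        exact h'.starConvex.smul_mem (hmem t htI) hs'.1 hs'.2
      have h2 := h'.eqn _ (hmem t htI)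
      rw [lieW_eq h1] at h2
      rw [← map_smul, hvt' t htI]
      funext k
      have h3 := congrFun h2 k
      simp only [eulerField, Pi.add_apply, neg_smul, contraction_apply] at h3 ⊢
      rw [← h3, neg_add_cancel_left]

theorem IsGreatest.graph_subset_unstableManifold (h : IsGreatest Q N ρ B N' a) {x : Euc n}
    (hx : x ∈ N') : (x, a x) ∈ unstableManifold (hatE Q B) (hatDomain U N B) (0, a 0) := by
  have hmem : ∀ s : ℝ, s ≤ 0 → Real.exp s • x ∈ N' := fun s hs =>
    h.starConvex.smul_mem hx (exp_mem_unitInterval hs).1 (exp_mem_unitInterval hs).2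
  refine ⟨fun s => (Real.exp s • x, a (Real.exp s • x)), by simp,
    fun s hs => ⟨⟨h.subset (hmem s hs),
    h.mem _ (hmem s hs)⟩, (hasDerivWithinAt_exp_smul x s _).prodMk (h.deriv x hx s hs)⟩, ?_⟩
  have h1 : Tendsto (fun s : ℝ => Real.exp s • x) atBot (𝓝 0) := by
    simpa using Real.tendsto_exp_atBot.smul_const x
  have h2 : Tendsto (fun s : ℝ => Real.exp s • x) atBot (𝓝[N'] 0) :=
    tendsto_nhdsWithin_iff.2 ⟨h1, (eventually_le_atBot 0).mono hmem⟩
  exact h1.prodMk_nhds ((h.contDiffOn.continuousOn 0 h.zero_mem).tendsto.comp h2)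

theorem eq_exp_smul_of_hasDerivWithinAt {V : Type*} [NormedAddCommGroup V] [NormedSpace ℝ V]
    {g : ℝ → V} (h : ∀ s ≤ 0, HasDerivWithinAt g (g s) (Iic 0) s) {s : ℝ} (hs : s ≤ 0) :
    g s = Real.exp s • g 0 := by
  have h1 : ∀ s ∈ Iic (0 : ℝ), HasDerivWithinAt (fun s => Real.exp (-s) • g s) 0 (Iic 0) s := by
    intro s hs
    have h2 := (hasDerivAt_neg s).exp.hasDerivWithinAt (s := Iic 0) |>.fun_smul (h s hs)
    refine h2.congr_deriv ?_
    simp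
  have h3 := (convex_Iic (0 : ℝ)).norm_image_sub_le_of_norm_hasDerivWithin_le (C := 0) h1
    (fun s _ => by simp) (mem_Iic.2 le_rfl) (mem_Iic.2 hs)
  rw [zero_mul, norm_le_zero_iff, sub_eq_zero] at h3
  simp only [neg_zero, Real.exp_zero, one_smul] at h3
  rw [← h3, smul_smul, ← Real.exp_add]
  simp

/-- The substitution `t = e^s` compactifies the half-line: the limit at `-∞` becomes the value at
`0`. -/
theorem continuousOn_comp_log {V : Type*} [TopologicalSpace V] {g : ℝ → V} {y : V}
    (hg : ContinuousOn g (Iic 0)) (hy : Tendsto g atBot (𝓝 y)) :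
    ContinuousOn (fun t : ℝ => if t ≤ 0 then y else g (Real.log t)) (Icc 0 1) := by
  intro t ht
  rcases eq_or_lt_of_le ht.1 with rfl | ht0
  · rw [← Set.Ioc_insert_left zero_le_one, continuousWithinAt_insert_self]
    have h1 : Tendsto (fun t => g (Real.log t)) (𝓝[Ioc 0 1] 0) (𝓝 y) :=
      hy.comp (Real.tendsto_log_nhdsGT_zero.mono_left (nhdsWithin_mono _ fun t ht => ht.1))
    rw [ContinuousWithinAt, if_pos le_rfl]
    refine h1.congr' ?_
    filter_upwards [self_mem_nhdsWithin] with t ht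
    rw [if_neg (not_le.2 ht.1)]
  · have h1 : ContinuousWithinAt (fun t => g (Real.log t)) (Icc 0 1 ∩ Ioi 0) t := by
      refine ContinuousWithinAt.comp (t := Iic 0) (hg _ (Real.log_nonpos ht.1 ht.2))
        (Real.continuousAt_log ht0.ne').continuousWithinAt fun s hs => ?_
      exact Real.log_nonpos hs.1.1 hs.1.2
    rw [← continuousWithinAt_inter (Ioi_mem_nhds ht0)]
    refine h1.congr (fun s hs => ?_) ?_
    · rw [if_neg (not_le.2 hs.2)]
    · rw [if_neg (not_le.2 ht0)]

/-- The base component satisfies `x' = x`, so it is `e^s x`. In the variable `t = e^s` the fibre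
component is continuous on `[0, 1]` and solves the radial equation, so it must end on the graph of
`a`. -/
theorem IsGreatest.mem_graph_of_mem_unstableManifold (h : IsGreatest Q N ρ B N' a)
    (hB0 : zeroPart (B 0) ∈ U) {p : Euc n × Fiber W n 1}
    (hp : p ∈ unstableManifold (hatE Q B) (hatDomain U N B) (0, a 0)) :
    p.1 ∈ N' ∧ p.2 = a p.1 := by
  obtain ⟨γ, rfl, hγ, hlim⟩ := hp
  set x := (γ 0).1 with hx
  have hxN : x ∈ N := (hγ 0 le_rfl).1.1
  have hd1 : ∀ s ≤ 0, HasDerivWithinAt (fun s => (γ s).1) (γ s).1 (Iic 0) s := fun s hs => by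
    have h1 := (ContinuousLinearMap.fst ℝ (Euc n) (Fiber W n 1)).hasFDerivAt.comp_hasDerivWithinAt
      s (hγ s hs).2
    exact h1
  have hd2 : ∀ s ≤ 0, HasDerivWithinAt (fun s => (γ s).2) (hatE Q B (γ s)).2 (Iic 0) s :=
    fun s hs => (ContinuousLinearMap.snd ℝ (Euc n) (Fiber W n 1)).hasFDerivAt.comp_hasDerivWithinAt
      s (hγ s hs).2
  have hγ1 : ∀ s ≤ 0, (γ s).1 = Real.exp s • x := fun s hs =>
    eq_exp_smul_of_hasDerivWithinAt hd1 hs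
  have hγ1' : ∀ t ∈ Ioc (0 : ℝ) 1, (γ (Real.log t)).1 = t • x := fun t ht => by
    rw [hγ1 _ (Real.log_nonpos ht.1.le ht.2), Real.exp_log ht.1]
  set w : ℝ → ∀ k, Comp W n k := fun t => if t ≤ 0 then a 0 else (γ (Real.log t)).2 with hw
  have hwc : ContinuousOn w (Icc 0 1) :=
    continuousOn_comp_log (g := fun s => (γ s).2) (fun s hs => (hd2 s hs).continuousWithinAt)
      ((continuous_snd.tendsto _).comp hlim)
  set v : C(I, ∀ k, Comp W n k) := ⟨fun t => w t, continuousOn_iff_continuous_domRestrict.1 hwc⟩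
  have hvt : ∀ t : I, v t = w t := fun t => rfl
  have hvt' : ∀ t ∈ Ioc (0 : ℝ) 1, extend v t = (γ (Real.log t)).2 := fun t ht => by
    refine (extend_coe v ⟨t, ht.1.le, ht.2⟩).trans ?_
    rw [hvt, hw]
    exact if_neg (not_le.2 ht.1)
  have key := h.greatest x hxN v (fun t => ?_) (fun t ht => ?_)
  · refine ⟨key.1, ?_⟩
    rw [key.2, hvt, hw]
    simp
  -- At `t = 0` the contraction term vanishes and only `B 0` has to be admissible.
  · rcases eq_or_lt_of_le t.2.1 with ht | ht
    · rw [← ht]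
      simpa using hB0
    · have htI : (t : ℝ) ∈ Ioc (0 : ℝ) 1 := ⟨ht, t.2.2⟩
      have h1 := (hγ _ (Real.log_nonpos ht.le t.2.2)).1.2
      rw [hγ1' t htI, ← contraction_apply, map_smul] at h1
      rw [hvt, hw]
      simp only [if_neg (not_le.2 ht)]
      exact h1
  · have htI : t ∈ Ioc (0 : ℝ) 1 := ⟨ht.1, ht.2.le⟩
    have hlog : Real.log t < 0 := Real.log_neg ht.1 ht.2
    refine ⟨t⁻¹ • (hatE Q B (γ (Real.log t))).2, ?_, ?_⟩
    · have h1 := (hd2 _ hlog.le).hasDerivAt (Iic_mem_nhds hlog)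
      have h2 := h1.scomp t (Real.hasDerivAt_log ht.1.ne')
      refine h2.congr_of_eventuallyEq ?_
      filter_upwards [Ioc_mem_nhds ht.1 ht.2] with s hs
      exact hvt' s hs
    · rw [smul_inv_smul₀ ht.1.ne', hvt' t htI, ← hγ1' t htI]
      rfl

theorem IsGreatest.image_eq_unstableManifold (h : IsGreatest Q N ρ B N' a)
    (hB0 : zeroPart (B 0) ∈ U) :
    (fun x => (x, a x)) '' N' =
      unstableManifold (hatE Q B) (hatDomain U N B) (0, a 0) := by
  ext p
  constructor
  · rintro ⟨x, hx, rfl⟩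
    exact h.graph_subset_unstableManifold hx
  · intro hp
    obtain ⟨h1, h2⟩ := h.mem_graph_of_mem_unstableManifold hB0 hp
    exact ⟨p.1, h1, Prod.ext rfl h2.symm⟩

theorem kappa_eq (hstar : StarConvex ℝ 0 N) {A : Euc n → Fiber W n 0} (hA : ContinuousOn A N)
    (hAU : ∀ x ∈ N, zeroPart (A x) ∈ U) {x : Euc n} (hx : x ∈ N) :
    kappa Q A x = A x - contraction W n x
      (average (Comp W n) (nem (fun y => FQ Q (A y)) (ray (Euc n) x)) 1) := by
  have hcomplete : ∀ k, CompleteSpace (W k) := fun k => FiniteDimensional.complete ℝ (W k)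
  have h1 : ContinuousOn (fun y => FQ Q (A y)) N := (contDiffOn_FQ Q).continuousOn.comp hA hAU
  rw [kappa, hW_eq hstar h1 hx]

theorem IsGreatest.eqOn_of_isPreimage (h : IsGreatest Q N ρ B N' a) (hstar : StarConvex ℝ 0 N)
    {A : Euc n → Fiber W n 0} (hA : IsPreimage Q N ρ B A) :
    ∀ x ∈ N, x ∈ N' ∧ A x = B x + iE x (a x) := by
  refine h.of_integral A hA.contDiffOn.continuousOn hA.mem fun x hx => ?_
  rw [hA.eqn x hx, kappa_eq hstar hA.contDiffOn.continuousOn hA.mem hx]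
  simp

theorem IsGreatest.isPreimage (h : IsGreatest Q N ρ B N a) (hstar : StarConvex ℝ 0 N)
    (hB : ContDiffOn ℝ ρ B N) : IsPreimage Q N ρ B (fun x => B x + iE x (a x)) := by
  have hc : ContDiffOn ℝ ρ (fun x => B x + iE x (a x)) N :=
    hB.add ((contraction W n).contDiff.contDiffOn.clm_apply h.contDiffOn)
  refine ⟨hc, h.mem, fun x hx => ?_⟩
  rw [kappa_eq hstar hc.continuousOn h.mem hx]
  have h1 := h.integral x hx
  simp only [contraction_apply] at h1
  rw [← h1, contraction_apply, add_sub_cancel_right]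

theorem exists_isGreatest (Q : Differential W U) (hN : IsSubmanifoldWithCorners N)
    (h0 : (0 : Euc n) ∈ N) (hstar : StarConvex ℝ 0 N) (hB : ContDiffOn ℝ ρ B N)
    (hB0 : zeroPart (B 0) ∈ U) : ∃ N' a, IsGreatest Q N ρ B N' a := by
  have hcomplete : ∀ k, CompleteSpace (W k) := fun k => FiniteDimensional.complete ℝ (W k)
  exact exists_isGreatestSolution (contraction W n) (isOpen_zeroPart_mem U) (contDiffOn_FQ Q)
    hN.locallyQuasiconvex hN.uniqueDiffOn h0 hstar hB hB0

theorem IsGreatest.isHyperbolicFixedPoint (h : IsGreatest Q N ρ B N' a) (hρ : 1 ≤ ρ)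
    (h0 : (0 : Euc n) ∈ N) (hB : ContDiffOn ℝ ρ B N) (hB0 : zeroPart (B 0) ∈ U) :
    IsHyperbolicFixedPoint Q N B (0, a 0) := by
  refine Kuranishi.isHyperbolicFixedPoint Q h0 (hB.differentiableOn ?_ 0 h0) hB0 rfl h.at_zero
  rintro h0
  rw [show ρ = 0 from by exact_mod_cast h0] at hρ
  simp at hρ

theorem exists_greatest_solution (Q : Differential W U) (hN : IsSubmanifoldWithCorners N)
    (h0 : (0 : Euc n) ∈ N) (hstar : StarConvex ℝ 0 N) (hρ : 1 ≤ ρ) (hB : ContDiffOn ℝ ρ B N)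
    (hB0 : zeroPart (B 0) ∈ U) :
    ∃ (N' : Set (Euc n)) (a : Euc n → Fiber W n 1),
      IsSolution Q N ρ B N' a ∧
      (∀ N'' a', IsSolution Q N ρ B N'' a' → N'' ⊆ N' ∧ EqOn a' a N'') ∧
      ((∃ A, IsPreimage Q N ρ B A) ↔ N' = N) ∧
      (∀ A, IsPreimage Q N ρ B A → EqOn A (fun x => B x + iE x (a x)) N) ∧
      ∃ P, IsHyperbolicFixedPoint Q N B P ∧
        (fun x => (x, a x)) '' N' = unstableManifold (hatE Q B) (hatDomain U N B) P := by
  obtain ⟨N', a, h⟩ := exists_isGreatest Q hN h0 hstar hB hB0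
  refine ⟨N', a, h.isSolution, fun N'' a' h' => ⟨fun x hx => (h.eq_of_isSolution hρ h' hx).1,
    fun x hx => (h.eq_of_isSolution hρ h' hx).2⟩, ⟨?_, ?_⟩, fun A hA x hx =>
    (h.eqOn_of_isPreimage hstar hA x hx).2, (0, a 0), h.isHyperbolicFixedPoint hρ h0 hB hB0,
    h.image_eq_unstableManifold hB0⟩
  · rintro ⟨A, hA⟩
    exact h.subset.antisymm fun x hx => (h.eqOn_of_isPreimage hstar hA x hx).1
  · rintro rfl
    exact ⟨_, h.isPreimage hstar hB⟩

end Solution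

end Kuranishi

end

noncomputable section

namespace Kuranishi

open Set Filter Topology Metric

/-! ### The Banach spaces `C^r(N, F)` -/

section CrMap

variable {n : ℕ} {N : Set (Euc n)} {r : ℕ} {F : Type*} [NormedAddCommGroup F] [NormedSpace ℝ F]

theorem JetSpace.norm_apply_le (J : JetSpace N r F) (i : Fin (r + 1)) (x : N) : ‖J i x‖ ≤ ‖J‖ :=
  (BoundedContinuousFunction.norm_coe_le_norm _ x).trans
    (norm_le_pi_norm (G := fun i : Fin (r + 1) =>
      BoundedContinuousFunction N (Euc n [×(i : ℕ)]→L[ℝ] F)) J i)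

theorem JetSpace.norm_le {J : JetSpace N r F} {C : ℝ} (hC : 0 ≤ C)
    (h : ∀ (i : Fin (r + 1)) (x : N), ‖J i x‖ ≤ C) : ‖J‖ ≤ C :=
  (pi_norm_le_iff_of_nonneg (G := fun i : Fin (r + 1) =>
      BoundedContinuousFunction N (Euc n [×(i : ℕ)]→L[ℝ] F)) hC).2 fun i =>
    (BoundedContinuousFunction.norm_le hC).2 (h i)

theorem JetSpace.sub_apply (J K : JetSpace N r F) (i : Fin (r + 1)) (x : N) :
    (J - K) i x = J i x - K i x := rfl

instance [CompleteSpace F] : CompleteSpace (JetSpace N r F) :=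
  inferInstanceAs (CompleteSpace
    (∀ i : Fin (r + 1), BoundedContinuousFunction N (Euc n [×(i : ℕ)]→L[ℝ] F)))

theorem ev_of_mem (A : CrMap N r F) {x : Euc n} (hx : x ∈ N) :
    ev A x = (A.1 0 ⟨x, hx⟩).curry0 := dif_pos hx

theorem norm_ev_le (A : CrMap N r F) {x : Euc n} (hx : x ∈ N) : ‖ev A x‖ ≤ ‖A‖ :=
  (congrArg norm (ev_of_mem A hx)).trans_le
    ((ContinuousMultilinearMap.curry0_norm _).le.trans (JetSpace.norm_apply_le A.1 0 _))

/-- Evaluation at a point as a continuous linear map. -/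
def evL (r : ℕ) (F : Type*) [NormedAddCommGroup F] [NormedSpace ℝ F] {x : Euc n} (hx : x ∈ N) :
    CrMap N r F →L[ℝ] F :=
  LinearMap.mkContinuous
    { toFun := fun A => ev A x
      map_add' := fun A B => by
        rw [ev_of_mem _ hx, ev_of_mem _ hx, ev_of_mem _ hx]
        rfl
      map_smul' := fun c A => by
        rw [ev_of_mem _ hx, ev_of_mem _ hx]
        rfl } 1 (fun A => by
    change ‖ev A x‖ ≤ _
    rw [one_mul]
    exact norm_ev_le A hx)

@[simp]
theorem evL_apply {x : Euc n} (hx : x ∈ N) (A : CrMap N r F) : evL r F hx A = ev A x := rfl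

theorem CrMap.exists_taylor (A : CrMap N r F) :
    ∃ p : Euc n → FormalMultilinearSeries ℝ (Euc n) F, HasFTaylorSeriesUpToOn r (ev A) p N ∧
      ∀ (i : Fin (r + 1)) (x : N), A.1 i x = p x i := by
  obtain ⟨p, hp, h⟩ := A.2
  refine ⟨p, hp.congr fun x hx => ?_, h⟩
  rw [ev_of_mem A hx, h]
  rfl

theorem CrMap.contDiffOn_ev (A : CrMap N r F) : ContDiffOn ℝ r (ev A) N := by
  obtain ⟨p, hp, -⟩ := CrMap.exists_taylor A
  exact HasFTaylorSeriesUpToOn.contDiffOn (n := (r : ℕ∞)) hp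

/-- On a uniquely differentiable set the recorded derivatives are determined by the map, so `CrMap`
is a space of functions and equality can be tested on values. -/
theorem CrMap.jet_eq (hu : UniqueDiffOn ℝ N) (A : CrMap N r F) (i : Fin (r + 1)) (x : N) :
    A.1 i x = iteratedFDerivWithin ℝ i (ev A) N x := by
  obtain ⟨p, hp, h⟩ := CrMap.exists_taylor A
  rw [h]
  exact hp.eq_iteratedFDerivWithin_of_uniqueDiffOn
    (by exact_mod_cast Nat.lt_succ_iff.1 i.2) hu x.2

theorem CrMap.ext_ev (hu : UniqueDiffOn ℝ N) {A B : CrMap N r F}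
    (h : ∀ x ∈ N, ev A x = ev B x) : A = B := by
  refine Subtype.ext (funext fun i => BoundedContinuousFunction.ext fun x => ?_)
  rw [CrMap.jet_eq hu A, CrMap.jet_eq hu B]
  exact iteratedFDerivWithin_congr (fun y hy => h y hy) x.2 i

theorem CrMap.norm_le_iff (hu : UniqueDiffOn ℝ N) {A : CrMap N r F} {C : ℝ} (hC : 0 ≤ C) :
    ‖A‖ ≤ C ↔ ∀ i ≤ r, ∀ x ∈ N, ‖iteratedFDerivWithin ℝ i (ev A) N x‖ ≤ C := by
  constructor
  · intro h i hi x hx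
    rw [← CrMap.jet_eq hu A ⟨i, Nat.lt_succ_of_le hi⟩ ⟨x, hx⟩]
    exact (JetSpace.norm_apply_le A.1 _ _).trans h
  · intro h
    refine JetSpace.norm_le (J := A.1) hC fun i x => ?_
    rw [CrMap.jet_eq hu A]
    exact h i (Nat.lt_succ_iff.1 i.2) x x.2

/-- Convergence in `JetSpace` is uniform convergence of all derivatives up to order `r`;
quasiconvexity lets each derivative relation pass to the limit. -/
theorem isClosed_crMap (hq : LocallyQuasiconvex N) :
    IsClosed (CrMap N r F : Set (JetSpace N r F)) := by
  refine IsSeqClosed.isClosed fun J K hJ hlim => ?_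
  choose p hp hJp using hJ
  classical
  set q : Euc n → FormalMultilinearSeries ℝ (Euc n) F := fun x i =>
    if h : x ∈ N ∧ i < r + 1 then K ⟨i, h.2⟩ ⟨x, h.1⟩ else 0 with hq'
  have hqK : ∀ {x i} (hx : x ∈ N) (hi : i < r + 1), q x i = K ⟨i, hi⟩ ⟨x, hx⟩ :=
    fun hx hi => dif_pos ⟨hx, hi⟩
  have hconv : ∀ ε > 0, ∀ᶠ m in atTop, ∀ x ∈ N, ∀ i < r + 1, ‖p m x i - q x i‖ ≤ ε := by
    intro ε hε
    filter_upwards [hlim.eventually (closedBall_mem_nhds K hε)] with m hm x hx i hi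
    rw [dist_eq_norm] at hm
    rw [hqK hx hi, ← hJp m ⟨i, hi⟩ ⟨x, hx⟩, ← JetSpace.sub_apply]
    exact (JetSpace.norm_apply_le _ _ _).trans hm
  refine ⟨q, ⟨fun x _ => rfl, fun m hm x hx => ?_, fun m hm => ?_⟩, fun i x => ?_⟩
  · have hm' : m < r := by exact_mod_cast hm
    refine hq.hasFDerivWithinAt_of_tendsto (f := fun j x => p j x m)
      (f' := fun j x => (p j x m.succ).curryLeft) (g' := fun x => (q x m.succ).curryLeft)
      (fun j x hx => (hp j).fderivWithin m hm x hx) (fun x hx => ?_) (fun ε hε => ?_) hx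
    · rw [Metric.tendsto_nhds]
      intro ε hε
      filter_upwards [hconv (ε / 2) (by positivity)] with j hj
      rw [dist_eq_norm]
      exact (hj x hx m (by omega)).trans_lt (half_lt_self hε)
    · filter_upwards [hconv ε hε] with j hj x hx
      have h1 := hj x hx m.succ (by omega)
      have h2 : (p j x m.succ).curryLeft - (q x m.succ).curryLeft =
          (p j x m.succ - q x m.succ).curryLeft := rfl
      rw [h2, ContinuousMultilinearMap.curryLeft_norm]
      exact h1
  · have hm' : m < r + 1 := Nat.lt_succ_of_le (by exact_mod_cast hm)
    rw [continuousOn_iff_continuous_domRestrict]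
    refine (K ⟨m, hm'⟩).continuous.congr fun x => ?_
    exact (hqK x.2 hm').symm
  · exact (hqK x.2 i.2).symm

theorem completeSpace_crMap [CompleteSpace F] (hq : LocallyQuasiconvex N) :
    CompleteSpace (CrMap N r F) :=
  (isClosed_crMap hq).completeSpace_coe

open Classical in
/-- The element of `C^r(N, F)` given by a map (`0` if there is none). -/
def crMk (N : Set (Euc n)) (r : ℕ) (f : Euc n → F) : CrMap N r F :=
  if h : ∃ A : CrMap N r F, ∀ x ∈ N, ev A x = f x then h.choose else 0

theorem ev_crMk [CompactSpace N] (hu : UniqueDiffOn ℝ N) {f : Euc n → F}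
    (hf : ContDiffOn ℝ r f N) {x : Euc n} (hx : x ∈ N) : ev (crMk N r f) x = f x := by
  have hex : ∃ A : CrMap N r F, ∀ x ∈ N, ev A x = f x := by
    have hp := hf.ftaylorSeriesWithin hu
    have hcont : ∀ i : Fin (r + 1), Continuous fun x : N => ftaylorSeriesWithin ℝ f N x i :=
      fun i => continuousOn_iff_continuous_domRestrict.1
        (hp.cont i (by exact_mod_cast Nat.lt_succ_iff.1 i.2))
    refine ⟨⟨fun i => BoundedContinuousFunction.mkOfCompact ⟨_, hcont i⟩,
      ftaylorSeriesWithin ℝ f N, hp.congr fun x hx => hp.zero_eq x hx, fun i x => rfl⟩,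
      fun x hx => ?_⟩
    rw [ev_of_mem _ hx]
    exact hp.zero_eq x hx
  rw [crMk, dif_pos hex]
  exact hex.choose_spec x hx

/-! ### Bounded operators between spaces of `C^r` maps -/

section Operators

variable [CompactSpace N] {G H : Type*} [NormedAddCommGroup G] [NormedSpace ℝ G]
  [NormedAddCommGroup H] [NormedSpace ℝ H]

/-- A pointwise continuous linear operator with values in `C^r` maps is continuous. -/
theorem exists_clm_crMap [CompleteSpace G] (hq : LocallyQuasiconvex N) (hu : UniqueDiffOn ℝ N)
    {Z : Type*} [NormedAddCommGroup Z] [NormedSpace ℝ Z] [CompleteSpace Z]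
    (T : Z → Euc n → G) (hT : ∀ z, ContDiffOn ℝ r (T z) N)
    (hL : ∀ x ∈ N, ∃ L : Z →L[ℝ] G, ∀ z, T z x = L z) :
    ∃ L : Z →L[ℝ] CrMap N r G, ∀ z, ∀ x ∈ N, ev (L z) x = T z x := by
  have hcomp : CompleteSpace (CrMap N r G) := completeSpace_crMap hq
  have hev : ∀ z, ∀ x ∈ N, ev (crMk N r (T z)) x = T z x := fun z x hx => ev_crMk hu (hT z) hx
  let L₀ : Z →ₗ[ℝ] CrMap N r G :=
    { toFun := fun z => crMk N r (T z)
      map_add' := fun z z' => CrMap.ext_ev hu fun x hx => by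
        obtain ⟨L, hL⟩ := hL x hx
        rw [← evL_apply hx (_ + _), map_add, evL_apply, evL_apply, hev _ x hx, hev _ x hx,
          hev _ x hx, hL, hL, hL, map_add]
      map_smul' := fun c z => CrMap.ext_ev hu fun x hx => by
        obtain ⟨L, hL⟩ := hL x hx
        rw [← evL_apply hx (_ • _), map_smul, evL_apply, hev _ x hx, hev _ x hx, hL, hL, map_smul]
        rfl }
  -- Closed graph theorem: evaluations are continuous and separate points, so the graph is closed.
  have hcont : Continuous L₀ := by
    refine LinearMap.continuous_of_seq_closed_graph L₀ fun u z A hu' hLu => ?_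
    refine CrMap.ext_ev hu fun x hx => ?_
    obtain ⟨L, hL⟩ := hL x hx
    have h1 : Tendsto (fun m => ev (L₀ (u m)) x) atTop (𝓝 (ev A x)) :=
      ((evL r G hx).continuous.tendsto A).comp hLu
    have h2 : Tendsto (fun m => ev (L₀ (u m)) x) atTop (𝓝 (ev (L₀ z) x)) := by
      have h3 : ∀ z, ev (L₀ z) x = L z := fun z => (hev z x hx).trans (hL z)
      simp only [h3]
      exact (L.continuous.tendsto z).comp hu'
    exact tendsto_nhds_unique h1 h2
  exact ⟨⟨L₀, hcont⟩, hev⟩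

/-- The closed graph theorem is used twice, for each fixed `A` and then for the operator-valued map
in `A`; no Leibniz estimate is needed. -/
theorem exists_bilinear_crMap [CompleteSpace F] [CompleteSpace G] [CompleteSpace H]
    (hq : LocallyQuasiconvex N) (hu : UniqueDiffOn ℝ N) (b : F →L[ℝ] G →L[ℝ] H) :
    ∃ L : CrMap N r F →L[ℝ] CrMap N r G →L[ℝ] CrMap N r H,
      ∀ A B, ∀ x ∈ N, ev (L A B) x = b (ev A x) (ev B x) := by
  have hcF : CompleteSpace (CrMap N r F) := completeSpace_crMap hq
  have hcG : CompleteSpace (CrMap N r G) := completeSpace_crMap hq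
  have hcH : CompleteSpace (CrMap N r H) := completeSpace_crMap hq
  have h1 : ∀ A : CrMap N r F, ∃ L : CrMap N r G →L[ℝ] CrMap N r H,
      ∀ B, ∀ x ∈ N, ev (L B) x = b (ev A x) (ev B x) := fun A =>
    exists_clm_crMap hq hu (fun B x => b (ev A x) (ev B x))
      (fun B => (b.contDiff.comp_contDiffOn (CrMap.contDiffOn_ev A)).clm_apply
        (CrMap.contDiffOn_ev B))
      (fun x hx => ⟨(b (ev A x)).comp (evL r G hx), fun B => rfl⟩)
  choose M hM using h1
  let L₀ : CrMap N r F →ₗ[ℝ] CrMap N r G →L[ℝ] CrMap N r H :=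
    { toFun := M
      map_add' := fun A A' => ContinuousLinearMap.ext fun B => CrMap.ext_ev hu fun x hx => by
        rw [hM _ _ x hx, _root_.add_apply, ← evL_apply hx (M A B + M A' B), map_add, evL_apply,
          evL_apply, hM _ _ x hx, hM _ _ x hx, ← evL_apply hx (A + A'), map_add, map_add]
        rfl
      map_smul' := fun c A => ContinuousLinearMap.ext fun B => CrMap.ext_ev hu fun x hx => by
        rw [hM _ _ x hx, _root_.smul_apply, RingHom.id_apply, ← evL_apply hx (c • M A B), map_smul,
          evL_apply, hM _ _ x hx, ← evL_apply hx (c • A), map_smul, map_smul]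
        rfl }
  have hcont : Continuous L₀ := by
    refine LinearMap.continuous_of_seq_closed_graph (𝕜 := ℝ) (E := CrMap N r F)
      (F := CrMap N r G →L[ℝ] CrMap N r H) (g := L₀) fun u A S hu' hLu => ?_
    refine ContinuousLinearMap.ext fun B => CrMap.ext_ev hu fun x hx => ?_
    have h1 : Tendsto (fun m => ev (L₀ (u m) B) x) atTop (𝓝 (ev (S B) x)) :=
      (((evL r H hx).comp (ContinuousLinearMap.apply ℝ _ B)).continuous.tendsto S).comp hLu
    have h2 : Tendsto (fun m => ev (L₀ (u m) B) x) atTop (𝓝 (ev (L₀ A B) x)) := by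
      have h3 : ∀ A, ev (L₀ A B) x = b (evL r F hx A) (ev B x) := fun A => hM A B x hx
      simp only [h3]
      have h4 : Continuous fun A => b (evL r F hx A) (ev B x) := by fun_prop
      exact (h4.tendsto A).comp hu'
    exact tendsto_nhds_unique h1 h2
  exact ⟨⟨L₀, hcont⟩, fun A B x hx => hM A B x hx⟩

/-- The underlying continuous map. -/
def toC (N : Set (Euc n)) [CompactSpace N] (r : ℕ) (F : Type*) [NormedAddCommGroup F]
    [NormedSpace ℝ F] : CrMap N r F →L[ℝ] C(N, F) :=
  LinearMap.mkContinuous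
    { toFun := fun A => ⟨fun x => ev A x, continuousOn_iff_continuous_domRestrict.1
        (CrMap.contDiffOn_ev A).continuousOn⟩
      map_add' := fun A B => ContinuousMap.ext fun x => (evL r F x.2).map_add A B
      map_smul' := fun c A => ContinuousMap.ext fun x => (evL r F x.2).map_smul c A } 1
    (fun A => by
      refine (ContinuousMap.norm_le _ (by positivity)).2 fun x => ?_
      change ‖ev A x‖ ≤ _
      rw [one_mul]
      exact norm_ev_le A x.2)

theorem exists_deriv_crMap [CompleteSpace F] (hq : LocallyQuasiconvex N)
    (hu : UniqueDiffOn ℝ N) : ∃ L : CrMap N (r + 1) F →L[ℝ] CrMap N r (Euc n →L[ℝ] F),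
      ∀ A, ∀ x ∈ N, ev (L A) x = fderivWithin ℝ (ev A) N x := by
  have hcF : CompleteSpace (CrMap N (r + 1) F) := completeSpace_crMap hq
  refine exists_clm_crMap hq hu (fun A => fderivWithin ℝ (ev A) N)
    (fun A => (CrMap.contDiffOn_ev A).fderivWithin hu (by simp)) fun x hx => ?_
  let jet : CrMap N (r + 1) F →L[ℝ] Euc n [×1]→L[ℝ] F :=
    LinearMap.mkContinuous
      { toFun := fun A => A.1 ⟨1, by omega⟩ ⟨x, hx⟩
        map_add' := fun A B => rfl
        map_smul' := fun c A => rfl } 1 (fun A => by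
      rw [one_mul]
      exact JetSpace.norm_apply_le A.1 _ _)
  refine ⟨(continuousMultilinearCurryFin1 ℝ
    (Euc n) F).toContinuousLinearEquiv.toContinuousLinearMap.comp jet, fun A => ?_⟩
  obtain ⟨p, hp, h⟩ := CrMap.exists_taylor A
  have h1 := hp.hasFDerivWithinAt (by simp) hx
  rw [h1.fderivWithin (hu x hx)]
  exact congrArg (continuousMultilinearCurryFin1 ℝ (Euc n) F) (h ⟨1, by omega⟩ ⟨x, hx⟩).symm

theorem exists_inclusion_crMap [CompleteSpace F] (hq : LocallyQuasiconvex N)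
    (hu : UniqueDiffOn ℝ N) : ∃ L : CrMap N (r + 1) F →L[ℝ] CrMap N r F,
      ∀ A, ∀ x ∈ N, ev (L A) x = ev A x := by
  have hcF : CompleteSpace (CrMap N (r + 1) F) := completeSpace_crMap hq
  exact exists_clm_crMap hq hu (fun A => ev A)
    (fun A => (CrMap.contDiffOn_ev A).of_le (by exact_mod_cast Nat.le_succ r))
    fun x hx => ⟨evL (r + 1) F hx, fun A => rfl⟩

/-- The map `A ↦ (A, dA)` into `C⁰ × C^r` is bounded below on `C^{r+1}`; this allows induction on
`r`. -/
theorem norm_le_of_deriv (hu : UniqueDiffOn ℝ N) {A : CrMap N (r + 1) F}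
    {A' : CrMap N r (Euc n →L[ℝ] F)} (h : ∀ x ∈ N, ev A' x = fderivWithin ℝ (ev A) N x) :
    ‖A‖ ≤ max ‖toC N (r + 1) F A‖ ‖A'‖ := by
  refine (CrMap.norm_le_iff hu (le_max_of_le_left (norm_nonneg _))).2 fun i hi x hx => ?_
  cases i with
  | zero =>
    rw [norm_iteratedFDerivWithin_zero]
    exact le_max_of_le_left ((toC N (r + 1) F A).norm_coe_le_norm ⟨x, hx⟩)
  | succ i =>
    rw [← norm_iteratedFDerivWithin_fderivWithin hu hx,
      ← iteratedFDerivWithin_congr (fun y hy => h y hy) hx]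
    exact le_max_of_le_right ((CrMap.norm_le_iff hu (norm_nonneg _)).1 le_rfl i (by omega) x hx)

end Operators

end CrMap

end Kuranishi

end

noncomputable section

namespace Kuranishi

open Set Filter Topology Metric unitInterval

/-! ### Superposition operators on `C^r(N, X)` -/

universe u

section CrSuperposition

variable {n : ℕ} {N : Set (Euc n)} {r : ℕ} {X : Type u} [NormedAddCommGroup X] [NormedSpace ℝ X]
  {Y : Type u} [NormedAddCommGroup Y] [NormedSpace ℝ Y] {f : X → Y} {D : Set X}

/-- The superposition operator `A ↦ f ∘ A` on `C^r` maps. -/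
def crNem (N : Set (Euc n)) (r : ℕ) (f : X → Y) (A : CrMap N r X) : CrMap N r Y :=
  crMk N r fun x => f (ev A x)

theorem contDiffOn_comp_ev (hf : ContDiffOn ℝ ∞ f D) {A : CrMap N r X}
    (hA : ∀ x ∈ N, ev A x ∈ D) : ContDiffOn ℝ r (fun x => f (ev A x)) N :=
  (hf.of_le (by exact_mod_cast le_top)).comp (CrMap.contDiffOn_ev A) hA

variable [CompactSpace N]

theorem ev_crNem (hu : UniqueDiffOn ℝ N) (hf : ContDiffOn ℝ ∞ f D) {A : CrMap N r X}
    (hA : ∀ x ∈ N, ev A x ∈ D) {x : Euc n} (hx : x ∈ N) :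
    ev (crNem N r f A) x = f (ev A x) :=
  ev_crMk hu (contDiffOn_comp_ev hf hA) hx

theorem isOpen_setOf_ev_mem (hD : IsOpen D) :
    IsOpen {A : CrMap N r X | ∀ x ∈ N, ev A x ∈ D} := by
  have h : {A : CrMap N r X | ∀ x ∈ N, ev A x ∈ D} = toC N r X ⁻¹' {A | ∀ t, A t ∈ D} :=
    Set.ext fun A => ⟨fun h t => h t t.2, fun h x hx => h ⟨x, hx⟩⟩
  rw [h]
  exact (isOpen_setOf_mem hD).preimage (toC N r X).continuous

theorem contDiffOn_toC_crNem (hu : UniqueDiffOn ℝ N) (hD : IsOpen D) (hf : ContDiffOn ℝ ∞ f D) :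
    ContDiffOn ℝ ∞ (fun A : CrMap N r X => toC N r Y (crNem N r f A))
      {A | ∀ x ∈ N, ev A x ∈ D} := by
  have hmaps : MapsTo (toC N r X) {A | ∀ x ∈ N, ev A x ∈ D} {A | ∀ t, A t ∈ D} :=
    fun A hA t => hA t t.2
  refine ((contDiffOn_nem.{u, u} (K := N) (ρ := ⊤) (IsOpen.locallyQuasiconvex hD)
    hD.uniqueDiffOn hf).comp (toC N r X).contDiff.contDiffOn hmaps).congr fun A hA => ?_
  ext t
  exact (ev_crNem hu hf hA t.2).trans
    (nem_apply hf.continuousOn (hmaps hA) t).symm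

/-- By `contDiffOn_of_comp_antilipschitz` it suffices to treat `f ∘ A` in `C⁰` and its derivative in
`C^r`. The latter is `f'(A) · dA`, bilinear in the superposition with `f'`, smooth by induction, and
in `dA`. -/
theorem contDiffOn_crNem [CompleteSpace X] (hq : LocallyQuasiconvex N) (hu : UniqueDiffOn ℝ N)
    (hD : IsOpen D) (r : ℕ) {Y : Type u} [NormedAddCommGroup Y] [NormedSpace ℝ Y]
    [CompleteSpace Y] {f : X → Y} (hf : ContDiffOn ℝ ∞ f D) :
    ContDiffOn ℝ ∞ (crNem N r f) {A | ∀ x ∈ N, ev A x ∈ D} := by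
  induction r generalizing Y with
  | zero =>
    have hc : CompleteSpace (CrMap N 0 Y) := completeSpace_crMap hq
    refine contDiffOn_of_comp_antilipschitz (isOpen_setOf_ev_mem hD) (toC N 0 Y) (fun A => ?_)
      (contDiffOn_toC_crNem hu hD hf)
    refine (CrMap.norm_le_iff hu (norm_nonneg _)).2 fun i hi x hx => ?_
    obtain rfl : i = 0 := Nat.le_zero.1 hi
    rw [norm_iteratedFDerivWithin_zero]
    exact (toC N 0 Y A).norm_coe_le_norm ⟨x, hx⟩
  | succ r ih =>
    have hc : CompleteSpace (CrMap N (r + 1) Y) := completeSpace_crMap hq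
    obtain ⟨dY, hdY⟩ := exists_deriv_crMap (r := r) (F := Y) hq hu
    obtain ⟨dX, hdX⟩ := exists_deriv_crMap (r := r) (F := X) hq hu
    obtain ⟨incl, hincl⟩ := exists_inclusion_crMap (r := r) (F := X) hq hu
    obtain ⟨b, hb⟩ := exists_bilinear_crMap (r := r) hq hu
      (ContinuousLinearMap.compL ℝ (Euc n) X Y)
    have hf' : ContDiffOn ℝ ∞ (fderiv ℝ f) D := hf.fderiv_of_isOpen hD (by simp)
    refine contDiffOn_of_comp_antilipschitz (isOpen_setOf_ev_mem hD) ((toC N (r + 1) Y).prod dY)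
      (fun A => norm_le_of_deriv hu (hdY A)) ((contDiffOn_toC_crNem hu hD hf).prodMk ?_)
    have hmem : ∀ A : CrMap N (r + 1) X, (∀ x ∈ N, ev A x ∈ D) → ∀ x ∈ N, ev (incl A) x ∈ D :=
      fun A hA x hx => by rw [hincl A x hx]; exact hA x hx
    have hbs : ContDiff ℝ ∞ fun M => b M := ContinuousLinearMap.contDiff (𝕜 := ℝ)
      (E := CrMap N r (X →L[ℝ] Y))
      (F := CrMap N r (Euc n →L[ℝ] X) →L[ℝ] CrMap N r (Euc n →L[ℝ] Y)) b
    have h1 : ContDiffOn ℝ ∞ (fun A => b (crNem N r (fderiv ℝ f) (incl A)) (dX A))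
        {A | ∀ x ∈ N, ev A x ∈ D} :=
      (hbs.comp_contDiffOn ((ih hf').comp incl.contDiff.contDiffOn hmem)).clm_apply
        dX.contDiff.contDiffOn
    refine h1.congr fun A hA => CrMap.ext_ev hu fun x hx => ?_
    have hfA : HasFDerivAt f (fderiv ℝ f (ev A x)) (ev A x) :=
      ((hf.contDiffAt (hD.mem_nhds (hA x hx))).differentiableAt (by simp)).hasFDerivAt
    have hA' : HasFDerivWithinAt (ev A) (fderivWithin ℝ (ev A) N x) N x :=
      ((CrMap.contDiffOn_ev A).differentiableOn (by simp) x hx).hasFDerivWithinAt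
    change ev (dY (crNem N (r + 1) f A)) x = _
    rw [hdY _ x hx, hb _ _ x hx, ev_crNem hu hf' (hmem A hA) hx, hincl A x hx, hdX A x hx]
    exact ((hfA.comp_hasFDerivWithinAt x hA').congr (fun y hy => ev_crNem hu hf hA hy)
      (ev_crNem hu hf hA hx)).fderivWithin (hu x hx)

theorem ev_fderiv_crNem [CompleteSpace X] [CompleteSpace Y] (hq : LocallyQuasiconvex N)
    (hu : UniqueDiffOn ℝ N) (hD : IsOpen D) (hf : ContDiffOn ℝ ∞ f D) {A : CrMap N r X}
    (hA : ∀ x ∈ N, ev A x ∈ D) (H : CrMap N r X) {x : Euc n} (hx : x ∈ N) :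
    ev (fderiv ℝ (crNem N r f) A H) x = fderiv ℝ f (ev A x) (ev H x) := by
  have hmem := (isOpen_setOf_ev_mem (N := N) (r := r) hD).mem_nhds hA
  have h1 : HasFDerivAt (crNem N r f) (fderiv ℝ (crNem N r f) A) A :=
    (((contDiffOn_crNem hq hu hD r hf).contDiffAt hmem).differentiableAt (by simp)).hasFDerivAt
  have h2 : HasFDerivAt (fun A => ev (crNem N r f A) x)
      ((evL r Y hx).comp (fderiv ℝ (crNem N r f) A)) A := (evL r Y hx).hasFDerivAt.comp A h1
  have h3 : HasFDerivAt (fun A => f (evL r X hx A)) ((fderiv ℝ f (ev A x)).comp (evL r X hx)) A :=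
    HasFDerivAt.comp A
      ((hf.contDiffAt (hD.mem_nhds (hA x hx))).differentiableAt (by simp)).hasFDerivAt
      (evL r X hx).hasFDerivAt
  have h4 := h3.congr_of_eventuallyEq (f₁ := fun A => ev (crNem N r f A) x)
    (by filter_upwards [hmem] with A' hA' using ev_crNem hu hf hA' hx)
  exact DFunLike.congr_fun (h2.unique h4) H

end CrSuperposition

/-! ### The map `A ↦ A - h(f(A))` on `C^r(N, X)` -/

section CrKappa

theorem nem_congr {K X Y : Type*} [TopologicalSpace K] [CompactSpace K] [TopologicalSpace X]
    [TopologicalSpace Y] [Zero Y] {f g : X → Y} {S : Set X} (hf : ContinuousOn f S)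
    (h : EqOn f g S) {A : C(K, X)} (hA : ∀ t, A t ∈ S) : nem f A = nem g A := by
  ext t
  rw [nem_apply hf hA, nem_apply (hf.congr h.symm) hA, h (hA t)]

variable {n ℓ : ℕ} {N : Set (Euc n)} {r : ℕ} {X : Type u} [NormedAddCommGroup X]
  [NormedSpace ℝ X] {Y : Fin (ℓ + 1) → Type u} [∀ k, NormedAddCommGroup (Y k)]
  [∀ k, NormedSpace ℝ (Y k)]

theorem average_nem_ray (hstar : StarConvex ℝ 0 N) {β : Euc n → ∀ k, Y k}
    (hβ : ContinuousOn β N) {x : Euc n} (hx : x ∈ N) (t : I) :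
    average Y (nem β (ray (Euc n) ((t : ℝ) • x))) 1 = average Y (nem β (ray (Euc n) x)) t := by
  have h : nem β (ray (Euc n) ((t : ℝ) • x)) = (nem β (ray (Euc n) x)).comp (mulI t) := by
    have htx : (t : ℝ) • x ∈ N := ray_mem hstar hx t
    ext s : 1
    rw [ContinuousMap.comp_apply, nem_apply hβ (ray_mem hstar hx),
      nem_apply hβ (ray_mem hstar htx), ray_apply, ray_apply, smul_smul]
    exact congrArg (fun c : ℝ => β (c • x)) (mul_comm _ _)
  rw [h]
  exact (average_comp_mul _ t 1).trans (by rw [mul_one])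

variable [CompactSpace N] [CompleteSpace X] [∀ k, CompleteSpace (Y k)]

/-- No derivative is lost: `x ↦ β ∘ ray_x` is already `C^r` into curves, and averaging, evaluation
and contraction are bounded. -/
theorem exists_homotopy_crMap (J : Euc n →L[ℝ] (∀ k, Y k) →L[ℝ] X) (hq : LocallyQuasiconvex N)
    (hu : UniqueDiffOn ℝ N) (hstar : StarConvex ℝ 0 N) :
    ∃ L : CrMap N r (∀ k, Y k) →L[ℝ] CrMap N r X, ∀ β, ∀ x ∈ N,
      ev (L β) x = J x (average Y (nem (ev β) (ray (Euc n) x)) 1) := by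
  have hc : CompleteSpace (CrMap N r (∀ k, Y k)) := completeSpace_crMap hq
  refine exists_clm_crMap hq hu (fun β x => J x (average Y (nem (ev β) (ray (Euc n) x)) 1))
    (fun β => ?_) fun x hx => ?_
  · exact J.contDiff.contDiffOn.clm_apply ((contDiff_eval 1).comp_contDiffOn
      ((average Y).contDiff.comp_contDiffOn
        (contDiffOn_ray hq hu hstar (ρ := (r : ℕ∞)) (CrMap.contDiffOn_ev β))))
  · have hnem : ∀ (β : CrMap N r (∀ k, Y k)) (t : I), nem (ev β) (ray (Euc n) x) t =
        evL r _ (ray_mem hstar hx t) β := fun β t =>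
      nem_apply (CrMap.contDiffOn_ev β).continuousOn (ray_mem hstar hx) t
    let P : CrMap N r (∀ k, Y k) →L[ℝ] C(I, ∀ k, Y k) :=
      LinearMap.mkContinuous
        { toFun := fun β => nem (ev β) (ray (Euc n) x)
          map_add' := fun β β' => ContinuousMap.ext fun t => by
            rw [ContinuousMap.add_apply, hnem, hnem, hnem, map_add]
          map_smul' := fun c β => ContinuousMap.ext fun t => by
            rw [ContinuousMap.smul_apply, hnem, hnem, map_smul]
            rfl } 1
        (fun β => (ContinuousMap.norm_le _ (by positivity)).2 fun t => by
          rw [one_mul]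
          exact (congrArg norm (hnem β t)).trans_le (norm_ev_le β (ray_mem hstar hx t)))
    exact ⟨(J x).comp ((ContinuousMap.evalCLM ℝ 1).comp ((average Y).comp P)), fun β => rfl⟩

/-- The map `A ↦ A - h(f(A))` is an open embedding of the maps with values in `D`. -/
theorem exists_kappa_crMap (J : Euc n →L[ℝ] (∀ k, Y k) →L[ℝ] X) (hq : LocallyQuasiconvex N)
    (hu : UniqueDiffOn ℝ N) (hstar : StarConvex ℝ 0 N) {f : X → ∀ k, Y k} {D : Set X}
    (hD : IsOpen D) (hf : ContDiffOn ℝ ∞ f D) :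
    ∃ κ : OpenPartialHomeomorph (CrMap N r X) (CrMap N r X),
      κ.source = {A | ∀ x ∈ N, ev A x ∈ D} ∧
      (∀ A ∈ κ.source, ∀ x ∈ N, ev (κ A) x =
        ev A x - J x (average Y (nem (fun y => f (ev A y)) (ray (Euc n) x)) 1)) ∧
      ContDiffOn ℝ ∞ κ κ.source ∧ ContDiffOn ℝ ∞ κ.symm κ.target := by
  have hc : CompleteSpace (CrMap N r X) := completeSpace_crMap hq
  obtain ⟨h, hh⟩ := exists_homotopy_crMap (r := r) J hq hu hstar
  set S : Set (CrMap N r X) := {A | ∀ x ∈ N, ev A x ∈ D} with hS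
  have hSo : IsOpen S := isOpen_setOf_ev_mem hD
  have hsmooth : ContDiffOn ℝ ∞ (crNem N r f) S := contDiffOn_crNem hq hu hD r hf
  have hev : ∀ A ∈ S, ∀ x ∈ N, ev (A - h (crNem N r f A)) x =
      ev A x - J x (average Y (nem (fun y => f (ev A y)) (ray (Euc n) x)) 1) := by
    intro A hA x hx
    rw [← evL_apply hx, map_sub, evL_apply, evL_apply, hh _ x hx,
      nem_congr (CrMap.contDiffOn_ev _).continuousOn (fun y hy => ev_crNem hu hf hA hy)
        (ray_mem hstar hx)]
  have hκ : ContDiffOn ℝ ∞ (fun A => A - h (crNem N r f A)) S :=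
    contDiffOn_id.sub (h.contDiff.comp_contDiffOn hsmooth)
  have hinj : InjOn (fun A => A - h (crNem N r f A)) S := by
    intro A hA A' hA' hAA'
    -- Along a ray, `κ` becomes the nonlinear Volterra map of `eq_of_volterra_eq`.
    have key : ∀ A ∈ S, ∀ x ∈ N, ∀ t : I, ev (A - h (crNem N r f A)) ((t : ℝ) • x) =
        nem (ev A) (ray (Euc n) x) t -
          (t : ℝ) • J x (average Y (nem f (nem (ev A) (ray (Euc n) x))) t) := by
      intro A hA x hx t
      have hfA : ContinuousOn (fun y => f (ev A y)) N := (contDiffOn_comp_ev hf hA).continuousOn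
      have hAc : ContinuousOn (ev A) N := (CrMap.contDiffOn_ev A).continuousOn
      have hV : ∀ t, nem (ev A) (ray (Euc n) x) t ∈ D := fun t => by
        rw [nem_apply hAc (ray_mem hstar hx)]
        exact hA _ (ray_mem hstar hx t)
      have hnn : nem (fun y => f (ev A y)) (ray (Euc n) x) =
          nem f (nem (ev A) (ray (Euc n) x)) := by
        ext s : 1
        rw [nem_apply hfA (ray_mem hstar hx), nem_apply hf.continuousOn hV,
          nem_apply hAc (ray_mem hstar hx)]
      have htx : (t : ℝ) • x ∈ N := ray_mem hstar hx t
      rw [hev A hA _ htx, average_nem_ray hstar hfA hx, hnn,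
        nem_apply hAc (ray_mem hstar hx), map_smul, ray_apply]
      rfl
    refine CrMap.ext_ev hu fun x hx => ?_
    have hV : ∀ A ∈ S, ∀ t, nem (ev A) (ray (Euc n) x) t ∈ D := fun A hA t => by
      rw [nem_apply (CrMap.contDiffOn_ev A).continuousOn (ray_mem hstar hx)]
      exact hA _ (ray_mem hstar hx t)
    have heq := eq_of_volterra_eq hD hf (hV A hA) (hV A' hA') (J x) fun t => by
      rw [← key A hA x hx t, ← key A' hA' x hx t]
      exact congrArg (fun C => ev C ((t : ℝ) • x)) hAA'
    have h1 := DFunLike.congr_fun heq 1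
    rw [nem_apply (CrMap.contDiffOn_ev A).continuousOn (ray_mem hstar hx),
      nem_apply (CrMap.contDiffOn_ev A').continuousOn (ray_mem hstar hx), ray_apply] at h1
    simpa using h1
  have hfderiv : ∀ A ∈ S, ∀ H, ∀ x ∈ N,
      ev (fderiv ℝ (fun A => A - h (crNem N r f A)) A H) x = ev H x -
        J x (average Y (nem (fun y => fderiv ℝ f (ev A y) (ev H y)) (ray (Euc n) x)) 1) := by
    intro A hA H x hx
    have h1 : HasFDerivAt (crNem N r f) (fderiv ℝ (crNem N r f) A) A :=
      ((hsmooth.contDiffAt (hSo.mem_nhds hA)).differentiableAt (by simp)).hasFDerivAt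
    have h2 : fderiv ℝ (fun A => A - h (crNem N r f A)) A =
        .id ℝ _ - h.comp (fderiv ℝ (crNem N r f) A) :=
      ((hasFDerivAt_id A).sub (h.hasFDerivAt.comp A h1)).fderiv
    rw [h2]
    change ev (H - h (fderiv ℝ (crNem N r f) A H)) x = _
    rw [← evL_apply hx, map_sub, evL_apply, evL_apply, hh _ x hx,
      nem_congr (CrMap.contDiffOn_ev _).continuousOn
        (fun y hy => ev_fderiv_crNem hq hu hD hf hA H hy) (ray_mem hstar hx)]
  have hbij : ∀ A ∈ S, Function.Bijective (fderiv ℝ (fun A => A - h (crNem N r f A)) A) := by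
    intro A hA
    -- Since `f` is smooth, `f' ∘ A` is still `C^r`, so the solution of the linearized equation is
    -- `C^r` and not merely continuous.
    have hM : ContDiffOn ℝ ((r : ℕ∞) : WithTop ℕ∞) (fun y => fderiv ℝ f (ev A y)) N :=
      contDiffOn_comp_ev (hf.fderiv_of_isOpen hD (by simp)) hA
    refine ⟨(injective_iff_map_eq_zero _).2 fun H hH => CrMap.ext_ev hu fun x hx => ?_,
      fun K => ?_⟩
    · rw [← evL_apply hx 0, map_zero]
      refine linear_solution_unique J hstar hM.continuousOn
        (CrMap.contDiffOn_ev H).continuousOn (fun y hy => ?_) x hx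
      rw [← sub_eq_zero, ← hfderiv A hA H y hy, hH, ← evL_apply hy 0, map_zero]
    · obtain ⟨H, hH, hHK⟩ := exists_linear_solution J hq hu hstar hM
        (ρ := (r : ℕ∞)) (CrMap.contDiffOn_ev K)
      have hcr : ∀ x ∈ N, ev (crMk N r H) x = H x := fun x hx => ev_crMk hu hH hx
      refine ⟨crMk N r H, CrMap.ext_ev hu fun x hx => ?_⟩
      rw [hfderiv A hA _ x hx, hcr x hx, sub_eq_iff_eq_add, hHK x hx]
      congr 4
      refine nem_congr (hM.continuousOn.clm_apply hH.continuousOn) (fun y hy => ?_)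
        (ray_mem hstar hx)
      simp only [hcr y hy]
  obtain ⟨κ, hκs, hκf, hκi⟩ := exists_openPartialHomeomorph hSo hκ hinj hbij
  refine ⟨κ, hκs, fun A hA x hx => ?_, ?_, hκi⟩
  · rw [hκf]
    exact hev A (hκs ▸ hA) x hx
  · rw [hκf, hκs]
    exact hκ

end CrKappa

end Kuranishi

end

noncomputable section

namespace Kuranishi

open Set Filter Topology Metric

/-! ### The Kuranishi map on a compact `N` -/

section CompactKappa

universe u

variable {n ℓ : ℕ} {W : Fin (ℓ + 1) → Type u} [∀ k, NormedAddCommGroup (W k)]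
  [∀ k, NormedSpace ℝ (W k)] [∀ k, FiniteDimensional ℝ (W k)] {U : TopologicalSpace.Opens (W 0)}
  {N : Set (Euc n)} {r : ℕ}

theorem completeSpace_omegaR (hN : IsSubmanifoldWithCorners N) :
    CompleteSpace (OmegaR W N r) := by
  have hW : ∀ k, CompleteSpace (W k) := fun k => FiniteDimensional.complete ℝ (W k)
  exact completeSpace_crMap hN.locallyQuasiconvex

theorem exists_kappa_openPartialHomeomorph (Q : Differential W U)
    (hN : IsSubmanifoldWithCorners N) (hstar : StarConvex ℝ 0 N) (hcpt : IsCompact N) (r : ℕ) :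
    ∃ κ : OpenPartialHomeomorph (OmegaR W N r) (OmegaR W N r), κ.source = OmegaRU W N r U ∧
      (∀ A ∈ κ.source, ∀ x ∈ N, ev (κ A) x = kappa Q (ev A) x) ∧
      ContDiffOn ℝ ∞ κ κ.source ∧ ContDiffOn ℝ ∞ κ.symm κ.target := by
  have hW : ∀ k, CompleteSpace (W k) := fun k => FiniteDimensional.complete ℝ (W k)
  have hcN : CompactSpace N := isCompact_iff_compactSpace.1 hcpt
  obtain ⟨κ, hsource, hev, hκ, hκ'⟩ := exists_kappa_crMap (r := r) (Y := Comp W n)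
    (contraction W n) hN.locallyQuasiconvex hN.uniqueDiffOn hstar (isOpen_zeroPart_mem U)
    (contDiffOn_FQ Q)
  refine ⟨κ, hsource, fun A hA x hx => ?_, hκ, hκ'⟩
  have hAU : A ∈ OmegaRU W N r U := hsource.subset hA
  rw [hev A hA x hx]
  exact (kappa_eq hstar (CrMap.contDiffOn_ev A).continuousOn hAU hx).symm

theorem exists_global_solution (Q : Differential W U) (hN : IsSubmanifoldWithCorners N)
    (h0 : (0 : Euc n) ∈ N) (hstar : StarConvex ℝ 0 N) {ρ : ℕ∞} (hρ : 1 ≤ ρ)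
    {A B : Euc n → Fiber W n 0} (hB : ContDiffOn ℝ ρ B N) (hA : IsPreimage Q N ρ B A) :
    ∃ (a : Euc n → Fiber W n 1) (P : Euc n × Fiber W n 1), IsSolution Q N ρ B N a ∧
      IsHyperbolicFixedPoint Q N B P ∧
      (fun x => (x, a x)) '' N = unstableManifold (hatE Q B) (hatDomain U N B) P ∧
      ∀ x ∈ N, A x = B x + iE x (a x) := by
  -- Contraction with `x` vanishes at `x = 0`, so `κ` does not change the value there and `B 0 = A
  -- 0`.
  have hB0 : zeroPart (B 0) ∈ U := by
    rw [hA.eqn 0 h0, kappa_eq hstar hA.contDiffOn.continuousOn hA.mem h0, map_zero]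
    simpa using hA.mem 0 h0
  obtain ⟨N', a, ha, -, hiff, heq, P, hP, him⟩ :=
    exists_greatest_solution Q hN h0 hstar hρ hB hB0
  obtain rfl : N' = N := hiff.1 ⟨A, hA⟩
  exact ⟨a, P, ha, hP, him, heq A hA⟩

end CompactKappa

end Kuranishi

end

theorem mainTheorem3 {n ℓ : ℕ} (N : Set (Kuranishi.Euc n))
    (hN : Kuranishi.IsSubmanifoldWithCorners N) (h0 : (0 : Kuranishi.Euc n) ∈ N)
    (hstar : StarConvex ℝ 0 N)
    (W : Fin (ℓ + 1) → Type*) [∀ k, NormedAddCommGroup (W k)] [∀ k, NormedSpace ℝ (W k)]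
    [∀ k, FiniteDimensional ℝ (W k)]
    (U : TopologicalSpace.Opens (W 0)) (Q : Kuranishi.Differential W U) :
    (∀ ρ : ℕ∞, 1 ≤ ρ → ∀ B : Kuranishi.Euc n → Kuranishi.Fiber W n 0, ContDiffOn ℝ ρ B N →
      Kuranishi.zeroPart (B 0) ∈ U →
      ∃ (N' : Set (Kuranishi.Euc n)) (a : Kuranishi.Euc n → Kuranishi.Fiber W n 1),
        Kuranishi.IsSolution Q N ρ B N' a ∧
        (∀ N'' a', Kuranishi.IsSolution Q N ρ B N'' a' → N'' ⊆ N' ∧ Set.EqOn a' a N'') ∧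
        ((∃ A, Kuranishi.IsPreimage Q N ρ B A) ↔ N' = N) ∧
        (∀ A, Kuranishi.IsPreimage Q N ρ B A →
          Set.EqOn A (fun x => B x + Kuranishi.iE x (a x)) N) ∧
        ∃ P, Kuranishi.IsHyperbolicFixedPoint Q N B P ∧
          (fun x => (x, a x)) '' N' =
            Kuranishi.unstableManifold (Kuranishi.hatE Q B) (Kuranishi.hatDomain U N B) P) ∧
    (IsCompact N → ∀ r : ℕ, 1 ≤ r →
      CompleteSpace (Kuranishi.OmegaR W N r) ∧
      ∃ κ : OpenPartialHomeomorph (Kuranishi.OmegaR W N r) (Kuranishi.OmegaR W N r),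
        κ.source = Kuranishi.OmegaRU W N r U ∧
        (∀ A ∈ κ.source, ∀ x ∈ N, Kuranishi.ev (κ A) x = Kuranishi.kappa Q (Kuranishi.ev A) x) ∧
        ContDiffOn ℝ ∞ κ κ.source ∧ ContDiffOn ℝ ∞ κ.symm κ.target ∧
        ∀ B ∈ κ.target, ∃ (a : Kuranishi.Euc n → Kuranishi.Fiber W n 1) (P : _),
          Kuranishi.IsSolution Q N r (Kuranishi.ev B) N a ∧
          Kuranishi.IsHyperbolicFixedPoint Q N (Kuranishi.ev B) P ∧
          (fun x => (x, a x)) '' N = Kuranishi.unstableManifold (Kuranishi.hatE Q (Kuranishi.ev B))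
            (Kuranishi.hatDomain U N (Kuranishi.ev B)) P ∧
          ∀ x ∈ N, Kuranishi.ev (κ.symm B) x = Kuranishi.ev B x + Kuranishi.iE x (a x)) := by
  refine ⟨fun ρ hρ B hB hB0 => Kuranishi.exists_greatest_solution Q hN h0 hstar hρ hB hB0,
    fun hcpt r hr => ⟨Kuranishi.completeSpace_omegaR hN, ?_⟩⟩
  obtain ⟨κ, hsource, hev, hκ, hκ'⟩ :=
    Kuranishi.exists_kappa_openPartialHomeomorph Q hN hstar hcpt r
  refine ⟨κ, hsource, hev, hκ, hκ', fun B hB => ?_⟩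
  have hA : κ.symm B ∈ κ.source := κ.map_target hB
  refine Kuranishi.exists_global_solution Q hN h0 hstar (by exact_mod_cast hr)
    (Kuranishi.CrMap.contDiffOn_ev B) ⟨Kuranishi.CrMap.contDiffOn_ev (κ.symm B), hsource.subset hA,
      fun x hx => ?_⟩
  rw [← hev _ hA x hx, κ.right_inv hB]
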